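/- **Setting.** Let $F\in C^2[0,\infty)\cap C^3(0,\bar x)$, $\bar x>0$, with $F(0)=F(\bar x)=0$, $F>0$ on $(0,\bar x)$, $F''<0$ on $[0,\bar x]$, and let $\delta,r,c,\gamma>0$, $p\in\mathbb R$. Put $\kappa=\delta+\gamma$, $r'=r\kappa$, $c_*=c+r'$ and, for $0<x<\bar x$, $$g=\delta-F'+\tfrac{F}{x},\qquad \psi=(px-c)(\delta-F')-\tfrac{cF}{x},\qquad \psi_*=(px-c_*)(\delta-F')-\tfrac{c_*F}{x}.$$ Assume $c_*<p\bar x$; there are $\tilde x,x^*\in(0,\bar x)$ with $\psi<0$ on $(0,\tilde x)$, $\psi(\tilde x)=0$, $\psi>0$ on $(\tilde x,\bar x)$ and $\psi_*<0$ on $(0,x^*)$, $\psi_*(x^*)=0$, $\psi_*>0$ on $(x^*,\bar x)$; $\psi'>0$ on $(0,\tilde x)$, $\psi_*'>0$ on $(\tilde x,\bar x)$; and $g'>0$ on $(0,\bar x)$. Put $K^*=F(x^*)/x^*$. For an initial state $(x_0,K_0)$, consider the minimization of $$J=\int_{[0,\infty)}e^{-\delta t}r\,\mu(dt)+\int_0^\infty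 e^{-\delta t}(c-px(t))u(t)K(t)\,dt$$ over measurable $u:[0,\infty)\to[0,1]$ and locally finite nonnegative Borel measures $\mu$ on $[0,\infty)$, where $x'=F(x)-uKx$, $x(0)=x_0$, $K(t)=K_0-\int_0^t\gamma K\,ds+\mu([0,t])$, $x,K\ge0$. Write $K_{0,+}=\lim_{t\downarrow0}K(t)$. Adjoint variables of a process $(x,K,u,\mu)$ are continuous functions $z,\lambda$ on $[0,\infty)$ with $$z'=zg(x)-\psi(x),\quad \lambda'=(\lambda-r)\kappa-zu+r',\quad \lambda\le r,\quad \lambda=r\ \ \mu\text{-a.e.},\quad zKu=\max_{w\in[0,1]}zKw\ \text{ a.e.};$$ write $z_0=z(0)$, $\lambda_0=\lambda(0)$. **Curves.** $\Sigma^*=\{(x^*,K):0\le K\le K^*\}$. For $K_1\in[0,K^*]$ let $(x,z)(\cdot;K_1)$ solve $$x'=-F(x)+K_1e^{\gamma t}x,\ x(0)=x^*,\qquad z'=-(z-r')g(x)+\psi_*(x),\ z(0)=r',$$ and let $l(K_1)$ be the first time $\sigma>0$ with $z(\sigma)=0$, if there is one such that $x(t)<x^*$ for all $t\in(0,\sigma]$.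 Let $\widetilde K_1$ be the largest $K_1$ for which $l(K_1)$ exists, and $\widetilde{\widetilde K}=\widetilde K_1e^{\gamma l(\widetilde K_1)}$. Then $\Sigma_0=\{(x(l(K_1);K_1),\,K_1e^{\gamma l(K_1)}):0\le K_1\le\widetilde K_1\}$ and $\widetilde\Sigma=\{(\tilde x,K):K\ge\widetilde{\widetilde K}\}$. **Theorem.** Let $(x,K,u,\mu)$ be optimal for the initial state $(x_0,K_0)$, with adjoint variables $z,\lambda$. (a) If $(x_0,K_0)\in\Sigma^*$, then $z_0=r'$, $\lambda\equiv r$ on $[0,\infty)$, $(x_0,K_{0,+})=(x^*,K^*)$, $u=1$ a.e. on $[0,\infty)$, and $\mu=(K^*-K_0)\,\delta_0+\gamma K\,dt$, where $\delta_0$ is the unit mass at time $0$. (b) If $(x_0,K_0)\in\Sigma_0$, then $z_0=0$, $\lambda_0<r$, and there is $\tau>0$ with $(x(\tau),K(\tau))\in\Sigma^*$, $\mu=0$ on $(0,\tau)$ and, provided $K_0>0$, $u=1$ a.e. on $(0,\tau)$. (c) If $(x_0,K_0)\in\widetilde\Sigma$, then $z_0=0$, $\lambda_0<r$, and there are $0\le\tau_1<\tau_2$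 with $(x(\tau_1),K(\tau_1))=(\tilde x,\widetilde{\widetilde K})$, $(x(\tau_2),K(\tau_2))\in\Sigma^*$, $\mu=0$ on $(0,\tau_1)$, $u(t)=F(\tilde x)/(\tilde xK(t))$ for a.e. $t\in(0,\tau_1)$, $\mu=0$ on $(\tau_1,\tau_2)$ and $u=1$ a.e. on $(\tau_1,\tau_2)$. -/

import Mathlib

open Set Filter Topology MeasureTheory

noncomputable section

/-- The data of the fishery model: natural growth function `F`, carrying capacity `xbar`, discount
rate `δ`, depreciation rate `γ`, price of fish `p`, effort cost `c`, price of capital `r`, and the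
two singular stock levels `xTilde`, `xStar` (pinned down by condition `V4` below). -/
structure Fishery where
  F : ℝ → ℝ
  xbar : ℝ
  δ : ℝ
  γ : ℝ
  p : ℝ
  c : ℝ
  r : ℝ
  xTilde : ℝ
  xStar : ℝ

namespace Fishery

variable (M : Fishery)

def κ : ℝ := M.δ + M.γ

/-- The constant `r'`. -/
def r' : ℝ := M.r * M.κ

/-- The constant `c_*`. -/
def cStar : ℝ := M.c + M.r'

def g (y : ℝ) : ℝ := M.δ - deriv M.F y + M.F y / y

def ψ (y : ℝ) : ℝ := (M.p * y - M.c) * (M.δ - deriv M.F y) - M.c * M.F y / y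

/-- The function `ψ_*`. -/
def ψStar (y : ℝ) : ℝ :=
  (M.p * y - M.cStar) * (M.δ - deriv M.F y) - M.cStar * M.F y / y

/-- `K^* = F(x^*) / x^*`. -/
def KStar : ℝ := M.F M.xStar / M.xStar

/-- The conditions `(V1)`, ..., `(V6)`. -/
structure Standing : Prop where
  xbar_pos : 0 < M.xbar
  V1_C2 : ContDiffOn ℝ 2 M.F (Ici 0)
  V1_C3 : ContDiffOn ℝ 3 M.F (Ioo 0 M.xbar)
  V1_zero : M.F 0 = 0
  V1_xbar : M.F M.xbar = 0
  V1_pos : ∀ y ∈ Ioo 0 M.xbar, 0 < M.F y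
  V1_concave : ∀ y ∈ Icc 0 M.xbar, iteratedDerivWithin 2 M.F (Ici 0) y < 0
  V2 : 0 < M.δ ∧ 0 < M.r ∧ 0 < M.c ∧ 0 < M.γ
  V3 : M.cStar - M.p * M.xbar < 0
  V4_xTilde : M.xTilde ∈ Ioo 0 M.xbar
  V4_xStar : M.xStar ∈ Ioo 0 M.xbar
  V4_ψ_neg : ∀ y ∈ Ioo 0 M.xTilde, M.ψ y < 0
  V4_ψ_zero : M.ψ M.xTilde = 0
  V4_ψ_pos : ∀ y ∈ Ioo M.xTilde M.xbar, 0 < M.ψ y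
  V4_ψStar_neg : ∀ y ∈ Ioo 0 M.xStar, M.ψStar y < 0
  V4_ψStar_zero : M.ψStar M.xStar = 0
  V4_ψStar_pos : ∀ y ∈ Ioo M.xStar M.xbar, 0 < M.ψStar y
  V5_ψ : ∀ y ∈ Ioo 0 M.xTilde, 0 < deriv M.ψ y
  V5_ψStar : ∀ y ∈ Ioo M.xTilde M.xbar, 0 < deriv M.ψStar y
  V6 : ∀ y ∈ Ioo 0 M.xbar, 0 < deriv M.g y

/-! ### The impulsive control problem -/

/-- `(x, K, u, μ)` is an admissible process of the problem with initial state `(x₀, K₀)`. Time is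
`[0, ∞)`: only the values of `x, K, u` there matter, and `μ` is a Borel measure carried by `[0, ∞)`
and finite on compact sets. The equation for `K` is
`K(t) = K₀ - ∫₀ᵗ γ K ds + μ([0,t])`, so `K` is right continuous and an atom of `μ` at `0` is an
initial jump: `K(0) = K(0+) = K₀ + μ({0})`. The equation for `x` holds in the sense of
Caratheodory. -/
structure IsAdmissible (x₀ K₀ : ℝ) (x K u : ℝ → ℝ) (μ : Measure ℝ) : Prop where
  u_meas : AEMeasurable u (volume.restrict (Ici 0))
  u_mem : ∀ᵐ t ∂(volume.restrict (Ici (0 : ℝ))), u t ∈ Icc (0 : ℝ) 1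
  μ_supp : μ (Iio 0) = 0
  μ_fin : ∀ t : ℝ, μ (Icc 0 t) < ⊤
  K_int : ∀ t, 0 ≤ t → IntervalIntegrable K volume 0 t
  K_eq : ∀ t, 0 ≤ t → K t = K₀ - (∫ s in (0 : ℝ)..t, M.γ * K s) + (μ (Icc 0 t)).toReal
  x_cont : ContinuousOn x (Ici 0)
  x_eq : ∀ t, 0 ≤ t → x t = x₀ + ∫ s in (0 : ℝ)..t, (M.F (x s) - u s * K s * x s)
  x_nonneg : ∀ t, 0 ≤ t → 0 ≤ x t
  K_nonneg : ∀ t, 0 ≤ t → 0 ≤ K t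

/-- The discounted running cost `e^{-δt} (c - p x(t)) u(t) K(t)`. -/
def runningCost (x K u : ℝ → ℝ) (t : ℝ) : ℝ :=
  Real.exp (-M.δ * t) * ((M.c - M.p * x t) * (u t * K t))

/-- The objective `∫ e^{-δt} r μ(dt) + ∫ e^{-δt} (c - p x) u K dt`, as an extended real: the second
integral is the integral of the positive part minus that of the negative part. (Along an
admissible process starting in `(0, xbar) × [0, ∞)` the latter is finite, because
`u K x = F(x) - x'` and `x` is bounded.) -/
def cost (x K u : ℝ → ℝ) (μ : Measure ℝ) : EReal :=
  ((∫⁻ t in Ici (0 : ℝ), ENNReal.ofReal (Real.exp (-M.δ * t) * M.r) ∂μ : ENNReal) : EReal) +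
    (((∫⁻ t in Ici (0 : ℝ), ENNReal.ofReal (M.runningCost x K u t) : ENNReal) : EReal) -
      ((∫⁻ t in Ici (0 : ℝ), ENNReal.ofReal (-M.runningCost x K u t) : ENNReal) : EReal))

/-- `(x, K, u, μ)` is an optimal process for the initial state `(x₀, K₀)`. -/
def IsOptimal (x₀ K₀ : ℝ) (x K u : ℝ → ℝ) (μ : Measure ℝ) : Prop :=
  M.IsAdmissible x₀ K₀ x K u μ ∧
    ∀ (x₁ K₁ u₁ : ℝ → ℝ) (μ₁ : Measure ℝ), M.IsAdmissible x₀ K₀ x₁ K₁ u₁ μ₁ →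
      M.cost x K u μ ≤ M.cost x₁ K₁ u₁ μ₁

/-- `z`, `lam` are adjoint (switch) variables of the process `(x, K, u, μ)`: the adjoint equations,
the jump conditions and the maximum condition of the maximum principle, with the multiplier of the
objective normalised to one. -/
structure IsAdjoint (x K u : ℝ → ℝ) (μ : Measure ℝ) (z lam : ℝ → ℝ) : Prop where
  z_cont : ContinuousOn z (Ici 0)
  z_eq : ∀ t, 0 ≤ t → z t = z 0 + ∫ s in (0 : ℝ)..t, (z s * M.g (x s) - M.ψ (x s))
  lam_cont : ContinuousOn lam (Ici 0)
  lam_eq : ∀ t, 0 ≤ t →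
    lam t = lam 0 + ∫ s in (0 : ℝ)..t, ((lam s - M.r) * M.κ - z s * u s + M.r')
  lam_le : ∀ t, 0 ≤ t → lam t ≤ M.r
  lam_eq_r : ∀ᵐ t ∂μ, lam t = M.r
  max_cond : ∀ᵐ t ∂(volume.restrict (Ici (0 : ℝ))),
    ∀ w ∈ Icc (0 : ℝ) 1, z t * K t * w ≤ z t * K t * u t

/-! ### The special curves -/

/-- `(x, z)` solves on `[0, σ]` the time-reversed system with `u ≡ 1`, `μ ≡ 0`,
`x' = -F(x) + K₁ e^{γt} x`, `z' = -(z - r') g(x) + ψ_*(x)`, `x(0) = x^*`, `z(0) = r'`; up to time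
`σ` the stock has not returned to `x^*`; and `σ > 0` is the first zero of `z`. -/
structure IsFirstZero (K₁ σ : ℝ) (x z : ℝ → ℝ) : Prop where
  σ_pos : 0 < σ
  x_zero : x 0 = M.xStar
  z_zero : z 0 = M.r'
  x_ode : ∀ t ∈ Icc 0 σ,
    HasDerivWithinAt x (-M.F (x t) + K₁ * Real.exp (M.γ * t) * x t) (Icc 0 σ) t
  z_ode : ∀ t ∈ Icc 0 σ,
    HasDerivWithinAt z (-(z t - M.r') * M.g (x t) + M.ψStar (x t)) (Icc 0 σ) t
  x_mem : ∀ t ∈ Ioc 0 σ, x t ∈ Ioo 0 M.xStar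
  z_pos : ∀ t ∈ Ico 0 σ, 0 < z t
  z_σ : z σ = 0

/-- The critical level `K̃₁`: the largest `K₁` for which the reversed trajectory has a zero of `z`
before the stock returns to `x^*`. -/
def K1Tilde : ℝ := sSup {K₁ | K₁ ∈ Icc 0 M.KStar ∧ ∃ σ x z, M.IsFirstZero K₁ σ x z}

/-- `l(K₁)`, the first zero of `z` along the reversed trajectory with parameter `K₁` (the set has at
most one element). -/
def firstZeroTime (K₁ : ℝ) : ℝ := sInf {σ | ∃ x z, M.IsFirstZero K₁ σ x z}

/-- The level written as `K` with two tildes: the capital at the first zero of `z` along the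
reversed trajectory with parameter `K̃₁`; there the stock is `x̃`. -/
def KTildeTilde : ℝ := M.K1Tilde * Real.exp (M.γ * M.firstZeroTime M.K1Tilde)

/-- The curve `Σ^*`. -/
def SigmaStar : Set (ℝ × ℝ) := {P | P.1 = M.xStar ∧ P.2 ∈ Icc 0 M.KStar}

/-- The curve `Σ₀`: the points of the reversed trajectories at the first zero of `z`, for
`K₁ ∈ [0, K̃₁]`. -/
def SigmaZero : Set (ℝ × ℝ) :=
  {P | ∃ K₁ ∈ Icc 0 M.K1Tilde, ∃ σ x z, M.IsFirstZero K₁ σ x z ∧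
    P = (x σ, K₁ * Real.exp (M.γ * σ))}

/-- The curve `Σ̃`: the half line `x = x̃` above the level `KTildeTilde`. -/
def SigmaTilde : Set (ℝ × ℝ) := {P | P.1 = M.xTilde ∧ M.KTildeTilde ≤ P.2}

end Fishery

end

open Set Filter Topology MeasureTheory

noncomputable section

/-! At `x^*` the problem can be solved directly. Integrate the investment cost by parts and
substitute `u K x = F(x) - x'` in the running cost. For a process starting at `x^*`, the cost
becomes, up to discounted end terms, `-r K₀ + ∫ e^{-δt} (r' (1 - u) K + H(x)) dt` with `H' = ψ_* /
x`. The sign of `ψ_*` makes `x^*` the strict minimum of `H`, so the cost is at least `-r K₀ + H(x^*)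
/ δ`, and equality forces `x ≡ x^*`, `u K = K`, hence `K ≡ K^*` (`IsAdmissible.eq_of_cost_le`). If
`K₀ ≤ K^*`, jumping to `K^*` and holding attains the bound. This is (a); the adjoint variables
follow because `μ` then charges every interval (`IsOptimal.adjoint_eq`).

To the left of `x^*` an optimal process does not invest. Investment at time `s` needs `λ(s) = r`,
hence `z(s) ≥ r'`; then `z` stays strictly above `r'` until the stock reaches `x^*`, where
optimality of the tail and (a) demand `z = r'`. The stock cannot arrive at `x^*` with more capital
than `K^*` either. If `z ≤ 0` on arrival, there would be no fishing ever after, at cost zero, and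
holding is cheaper; if `z > 0`, all capital is in use shortly before arrival, and a catch rate above
`K^*` does not let the stock rise to `x^*`. So up to its arrival the process is an `Arc` ending in
`x^*` with `z = r'` (`IsOptimal.exists_arc`).

Arcs with the same initial state coincide (`Arc.unique`). For two of them the product `(log x₂ - log
x₁)(z₂ - z₁)` has derivative at most a multiple of its absolute value minus a nonnegative term. This
uses the maximum condition and the monotonicity of `ψ - z g` where `p x ≥ z + c`. The product starts
at zero and is nonnegative when the first arc ends, so the subtracted term vanishes and the stocks
agree.

It remains to exhibit one arc for each initial state. From `Σ₀` it is a reversed trajectory run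
forward. From `Σ~` it stays at `x~` with `z = 0`, which is consistent because `ψ(x~) = 0`, until the
capital has decayed to the critical level, and then follows the critical reversed trajectory. That
this trajectory exists, has its first zero of `z` exactly in `x~`, and carries more capital there
than `F(x~) / x~` comes from compactness and a perturbation of the parameter
(`Standing.exists_critical`). -/

/-- `φ` is absolutely continuous on `[a, b]` with derivative `φ'` almost everywhere on `(a, b)`. -/
structure ACDeriv (φ φ' : ℝ → ℝ) (a b : ℝ) : Prop where
  le : a ≤ b
  ac : AbsolutelyContinuousOnInterval φ a b
  deriv_ae : ∀ᵐ t, t ∈ Ioo a b → HasDerivAt φ (φ' t) t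

/-! ### Calculus of absolutely continuous functions -/

namespace ACDeriv

variable {φ φ' χ χ' : ℝ → ℝ} {a b c d : ℝ}

lemma continuousOn (h : ACDeriv φ φ' a b) : ContinuousOn φ (Icc a b) := by
  simpa [uIcc_of_le h.le] using h.ac.continuousOn

lemma mono (h : ACDeriv φ φ' a b) (hac : a ≤ c) (hcd : c ≤ d) (hdb : d ≤ b) :
    ACDeriv φ φ' c d := by
  refine ⟨hcd, h.ac.mono ?_, ?_⟩
  · rw [uIcc_of_le hcd, uIcc_of_le h.le]
    exact Icc_subset_Icc hac hdb
  · filter_upwards [h.deriv_ae] with t ht ht'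
    exact ht ⟨hac.trans_lt ht'.1, ht'.2.trans_le hdb⟩

lemma congr_ae (h : ACDeriv φ φ' a b) (h' : ∀ᵐ t, t ∈ Ioo a b → φ' t = χ' t) :
    ACDeriv φ χ' a b := by
  refine ⟨h.le, h.ac, ?_⟩
  filter_upwards [h.deriv_ae, h'] with t h1 h2 ht
  rw [← h2 ht]
  exact h1 ht

lemma congr (h : ACDeriv φ φ' a b) (h' : ∀ t ∈ Icc a b, χ t = φ t) : ACDeriv χ φ' a b := by
  refine ⟨h.le, ?_, ?_⟩
  · have := h.ac
    rw [absolutelyContinuousOnInterval_iff] at this ⊢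
    intro ε hε
    obtain ⟨η, hη, H⟩ := this ε hε
    refine ⟨η, hη, fun E hE hE' => ?_⟩
    have := H E hE hE'
    refine lt_of_eq_of_lt (Finset.sum_congr rfl fun i hi => ?_) this
    have hm := hE.1 i (by simpa using hi)
    rw [uIcc_of_le h.le] at hm
    rw [h' _ hm.1, h' _ hm.2]
  · filter_upwards [h.deriv_ae] with t h1 ht
    refine (h1 ht).congr_of_eventuallyEq ?_
    filter_upwards [Ioo_mem_nhds ht.1 ht.2] with s hs
    exact h' s (Ioo_subset_Icc_self hs)

/-- Lebesgue differentiation. State and adjoint equations are given in integral form and enter the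
calculus here. -/
lemma of_integral (hab : a ≤ b) (hi : IntervalIntegrable φ' volume a b) {k : ℝ}
    (h : ∀ t ∈ Icc a b, φ t = k + ∫ s in a..t, φ' s) : ACDeriv φ φ' a b := by
  have h1 : ACDeriv (fun t => (∫ s in a..t, φ' s) + k) φ' a b := by
    refine ⟨hab, ?_, ?_⟩
    · refine (hi.absolutelyContinuousOnInterval_intervalIntegral (c := a) (by simp)).fun_add ?_
      exact (LipschitzWith.const k).lipschitzOnWith.absolutelyContinuousOnInterval
    · filter_upwards [hi.ae_hasDerivAt_integral] with t ht ht'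
      refine (ht ?_ a (by simp)).add_const k
      rw [uIcc_of_le hab]
      exact Ioo_subset_Icc_self ht'
  exact h1.congr fun t ht => by rw [h t ht, add_comm]

lemma of_contDiffOn (hab : a ≤ b) (hc : ContDiffOn ℝ 1 φ (Icc a b))
    (h : ∀ t ∈ Ioo a b, HasDerivAt φ (φ' t) t) : ACDeriv φ φ' a b :=
  ⟨hab, (by rw [← uIcc_of_le hab] at hc; exact hc.absolutelyContinuousOnInterval),
    Eventually.of_forall h⟩

lemma const (hab : a ≤ b) (k : ℝ) : ACDeriv (fun _ => k) (fun _ => 0) a b :=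
  of_contDiffOn hab contDiffOn_const fun t _ => hasDerivAt_const t k

lemma exp (hab : a ≤ b) (k : ℝ) :
    ACDeriv (fun t => Real.exp (k * t)) (fun t => k * Real.exp (k * t)) a b :=
  of_contDiffOn hab (by fun_prop) fun t _ => by
    have := ((hasDerivAt_id t).const_mul k).exp
    simpa [mul_comm] using this

lemma mul (h : ACDeriv φ φ' a b) (h' : ACDeriv χ χ' a b) :
    ACDeriv (fun t => φ t * χ t) (fun t => φ' t * χ t + φ t * χ' t) a b := by
  refine ⟨h.le, h.ac.fun_mul h'.ac, ?_⟩
  filter_upwards [h.deriv_ae, h'.deriv_ae] with t h1 h2 ht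
  exact (h1 ht).mul (h2 ht)

lemma add (h : ACDeriv φ φ' a b) (h' : ACDeriv χ χ' a b) :
    ACDeriv (fun t => φ t + χ t) (fun t => φ' t + χ' t) a b := by
  refine ⟨h.le, h.ac.fun_add h'.ac, ?_⟩
  filter_upwards [h.deriv_ae, h'.deriv_ae] with t h1 h2 ht
  exact (h1 ht).add (h2 ht)

lemma sub (h : ACDeriv φ φ' a b) (h' : ACDeriv χ χ' a b) :
    ACDeriv (fun t => φ t - χ t) (fun t => φ' t - χ' t) a b := by
  refine ⟨h.le, h.ac.fun_sub h'.ac, ?_⟩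
  filter_upwards [h.deriv_ae, h'.deriv_ae] with t h1 h2 ht
  exact (h1 ht).sub (h2 ht)

lemma const_mul (k : ℝ) (h : ACDeriv φ φ' a b) :
    ACDeriv (fun t => k * φ t) (fun t => k * φ' t) a b := by
  refine ⟨h.le, h.ac.const_mul k, ?_⟩
  filter_upwards [h.deriv_ae] with t h1 ht
  exact (h1 ht).const_mul k

/-- On a compact interval a `C¹` function is Lipschitz, and a Lipschitz function of an absolutely
continuous one is absolutely continuous. -/
lemma comp {G G' : ℝ → ℝ} {m m' : ℝ} (h : ACDeriv φ φ' a b) (hm : ∀ t ∈ Icc a b, φ t ∈ Icc m m')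
    (hG : ContDiffOn ℝ 1 G (Icc m m')) (hG' : ∀ t ∈ Icc a b, HasDerivAt G (G' (φ t)) (φ t)) :
    ACDeriv (fun t => G (φ t)) (fun t => G' (φ t) * φ' t) a b := by
  obtain ⟨K, hK⟩ := hG.exists_lipschitzOnWith (by decide) (convex_Icc _ _) isCompact_Icc
  refine ⟨h.le, ?_, ?_⟩
  · have := h.ac
    rw [absolutelyContinuousOnInterval_iff] at this ⊢
    intro ε hε
    obtain ⟨η, hη, H⟩ := this (ε / (K + 1)) (by positivity)
    refine ⟨η, hη, fun E hE hE' => ?_⟩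
    have h2 := H E hE hE'
    have h3 : ∑ i ∈ Finset.range E.1, dist (G (φ (E.2 i).1)) (G (φ (E.2 i).2)) ≤
        (K + 1) * ∑ i ∈ Finset.range E.1, dist (φ (E.2 i).1) (φ (E.2 i).2) := by
      rw [Finset.mul_sum]
      refine Finset.sum_le_sum fun i hi => ?_
      have hmem := hE.1 i (by simpa using hi)
      rw [uIcc_of_le h.le] at hmem
      refine (hK.dist_le_mul _ (hm _ hmem.1) _ (hm _ hmem.2)).trans ?_
      gcongr
      linarith
    refine h3.trans_lt ?_
    rw [lt_div_iff₀ (by positivity)] at h2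
    linarith
  · filter_upwards [h.deriv_ae] with t h1 ht
    exact (hG' t (Ioo_subset_Icc_self ht)).comp t (h1 ht)

lemma ae_deriv_eq (h : ACDeriv φ φ' a b) :
    ∀ᵐ t, t ∈ Ioo a b → deriv φ t = φ' t := by
  filter_upwards [h.deriv_ae] with t h1 ht using (h1 ht).deriv

lemma ae_deriv_eq' (h : ACDeriv φ φ' a b) :
    ∀ᵐ t, t ∈ uIoc a b → deriv φ t = φ' t := by
  have hb : ∀ᵐ t : ℝ, t ≠ b := by simp [ae_iff, measure_singleton]
  filter_upwards [h.ae_deriv_eq, hb] with t h1 h2 ht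
  rw [uIoc_of_le h.le] at ht
  exact h1 ⟨ht.1, lt_of_le_of_ne ht.2 h2⟩

lemma intervalIntegrable (h : ACDeriv φ φ' a b) : IntervalIntegrable φ' volume a b :=
  h.ac.intervalIntegrable_deriv.congr_ae
    ((ae_restrict_iff' measurableSet_uIoc).2 h.ae_deriv_eq')

lemma integral_eq (h : ACDeriv φ φ' a b) : ∫ t in a..b, φ' t = φ b - φ a := by
  rw [← h.ac.integral_deriv_eq_sub]
  refine intervalIntegral.integral_congr_ae ?_
  filter_upwards [h.ae_deriv_eq'] with t ht ht' using (ht ht').symm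

lemma le_of_nonpos (h : ACDeriv φ φ' a b) (hn : ∀ᵐ t, t ∈ Ioo a b → φ' t ≤ 0) : φ b ≤ φ a := by
  have h1 := h.integral_eq
  have h2 : 0 ≤ ∫ t in a..b, - φ' t := by
    refine intervalIntegral.integral_nonneg_of_ae_restrict h.le ?_
    have hb : ∀ᵐ t : ℝ, t ≠ b ∧ t ≠ a := by
      have h1 : ∀ᵐ t : ℝ, t ≠ b := by simp [ae_iff, measure_singleton]
      have h2 : ∀ᵐ t : ℝ, t ≠ a := by simp [ae_iff, measure_singleton]
      exact h1.and h2
    refine (ae_restrict_iff' measurableSet_Icc).2 ?_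
    filter_upwards [hn, hb] with t h3 h4 h5
    have := h3 ⟨lt_of_le_of_ne h5.1 (Ne.symm h4.2), lt_of_le_of_ne h5.2 h4.1⟩
    simpa using this
  rw [intervalIntegral.integral_neg] at h2
  linarith

lemma le_of_nonneg (h : ACDeriv φ φ' a b) (hn : ∀ᵐ t, t ∈ Ioo a b → 0 ≤ φ' t) : φ a ≤ φ b := by
  have := (h.const_mul (-1)).le_of_nonpos
    (by filter_upwards [hn] with t h1 h2; have := h1 h2; linarith)
  linarith

lemma eq_of_zero (h : ACDeriv φ φ' a b) (hn : ∀ᵐ t, t ∈ Ioo a b → φ' t = 0) : φ b = φ a :=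
  le_antisymm
    (h.le_of_nonpos (by filter_upwards [hn] with t h1 h2 using (h1 h2).le))
    (h.le_of_nonneg (by filter_upwards [hn] with t h1 h2 using (h1 h2).ge))

/-- A nonincreasing absolutely continuous function that returns to its initial value has
derivative zero almost everywhere. -/
lemma ae_eq_zero_of_nonpos (h : ACDeriv φ φ' a b) (hn : ∀ᵐ t, t ∈ Ioo a b → φ' t ≤ 0)
    (hab : φ a ≤ φ b) : ∀ᵐ t, t ∈ Ioo a b → φ' t = 0 := by
  have hc : ∀ t ∈ Icc a b, φ t = φ a := by
    intro t ht
    have h1 := (h.mono le_rfl ht.1 ht.2).le_of_nonpos (by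
      filter_upwards [hn] with s h1 h2 using h1 ⟨h2.1, h2.2.trans_le ht.2⟩)
    have h2 := (h.mono ht.1 ht.2 le_rfl).le_of_nonpos (by
      filter_upwards [hn] with s h1 h2 using h1 ⟨ht.1.trans_lt h2.1, h2.2⟩)
    linarith
  filter_upwards [h.deriv_ae] with t h1 ht
  have h2 : HasDerivAt φ 0 t := by
    refine (hasDerivAt_const t (φ a)).congr_of_eventuallyEq ?_
    filter_upwards [Ioo_mem_nhds ht.1 ht.2] with s hs
    exact hc s (Ioo_subset_Icc_self hs)
  exact (h1 ht).unique h2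

/-- If `φ` did not drop, its derivative would vanish almost everywhere, which is impossible on an
interval of positive length. -/
lemma lt_of_neg (h : ACDeriv φ φ' a b) (hab : a < b) (hn : ∀ᵐ t, t ∈ Ioo a b → φ' t < 0) :
    φ b < φ a := by
  by_contra hcon
  have h1 := h.ae_eq_zero_of_nonpos (by filter_upwards [hn] with t h1 h2 using (h1 h2).le)
    (not_lt.1 hcon)
  have h2 : ∀ᵐ t : ℝ, t ∉ Ioo a b := by
    filter_upwards [h1, hn] with t h1 h2 ht
    exact absurd (h1 ht) (h2 ht).ne
  rw [ae_iff] at h2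
  simp only [not_not] at h2
  have h3 : volume (Ioo a b) = 0 := h2
  rw [Real.volume_Ioo] at h3
  simp at h3
  linarith

lemma lt_of_pos (h : ACDeriv φ φ' a b) (hab : a < b) (hn : ∀ᵐ t, t ∈ Ioo a b → 0 < φ' t) :
    φ a < φ b := by
  have := (h.const_mul (-1)).lt_of_neg hab
    (by filter_upwards [hn] with t h1 h2; have := h1 h2; linarith)
  linarith

end ACDeriv

/-! ### Passage times and Gronwall estimates -/

/-- The last time before `t` at which a continuous function is nonpositive. -/
lemma exists_last_nonpos {P : ℝ → ℝ} {a t : ℝ} (hat : a ≤ t) (hc : ContinuousOn P (Icc a t))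
    (ha : P a ≤ 0) (ht : 0 < P t) : ∃ s ∈ Ico a t, P s ≤ 0 ∧ ∀ q ∈ Ioc s t, 0 < P q := by
  have hcomp : IsCompact (Icc a t ∩ P ⁻¹' Iic 0) :=
    isCompact_Icc.of_isClosed_subset
      (hc.preimage_isClosed_of_isClosed isClosed_Icc isClosed_Iic) inter_subset_left
  obtain ⟨s, ⟨hs1, hs2⟩, hmax⟩ := hcomp.exists_isGreatest ⟨a, ⟨le_rfl, hat⟩, ha⟩
  refine ⟨s, ⟨hs1.1, lt_of_le_of_ne hs1.2 ?_⟩, hs2, fun q hq => ?_⟩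
  · rintro rfl
    exact absurd ht (not_lt.2 hs2)
  · by_contra hcon
    have := hmax ⟨⟨hs1.1.trans hq.1.le, hq.2⟩, not_lt.1 hcon⟩
    exact absurd hq.1 (not_lt.2 this)

/-- The first time at which a continuous function reaches a level from below. -/
lemma exists_first_hit {P : ℝ → ℝ} {a t k : ℝ} (hat : a ≤ t) (hc : ContinuousOn P (Icc a t))
    (ha : P a < k) (ht : k ≤ P t) : ∃ s ∈ Ioc a t, P s = k ∧ ∀ q ∈ Ico a s, P q < k := by
  have hcomp : IsCompact (Icc a t ∩ P ⁻¹' Ici k) :=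
    isCompact_Icc.of_isClosed_subset
      (hc.preimage_isClosed_of_isClosed isClosed_Icc isClosed_Ici) inter_subset_left
  obtain ⟨s, ⟨hs1, hs2⟩, hmin⟩ := hcomp.exists_isLeast ⟨t, ⟨hat, le_rfl⟩, ht⟩
  have hbelow : ∀ q ∈ Ico a s, P q < k := by
    intro q hq
    by_contra hcon
    have := hmin ⟨⟨hq.1, hq.2.le.trans hs1.2⟩, not_lt.1 hcon⟩
    exact absurd hq.2 (not_lt.2 this)
  have has : a < s := lt_of_le_of_ne hs1.1 (by rintro rfl; exact absurd ha (not_lt.2 hs2))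
  refine ⟨s, ⟨has, hs1.2⟩, le_antisymm ?_ hs2, hbelow⟩
  have h1 : Tendsto P (𝓝[Ico a s] s) (𝓝 (P s)) :=
    (hc s hs1).mono_left (nhdsWithin_mono _ fun q hq => ⟨hq.1, hq.2.le.trans hs1.2⟩)
  have : (𝓝[Ico a s] s).NeBot := by
    rw [← mem_closure_iff_nhdsWithin_neBot, closure_Ico has.ne]
    exact ⟨has.le, le_rfl⟩
  exact le_of_tendsto h1 (eventually_nhdsWithin_of_forall fun q hq => (hbelow q hq).le)

namespace ACDeriv
variable {P P' : ℝ → ℝ} {a b M : ℝ}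

lemma mul_exp (h : ACDeriv P P' a b) (k : ℝ) :
    ACDeriv (fun t => P t * Real.exp (k * t)) (fun t => (P' t + k * P t) * Real.exp (k * t)) a b :=
  (h.mul (ACDeriv.exp h.le k)).congr_ae (Eventually.of_forall fun t _ => by ring)

/-- One-sided Gronwall inequality. -/
lemma nonpos_of_deriv_le (h : ACDeriv P P' a b)
    (hM : ∀ᵐ t, t ∈ Ioo a b → 0 < P t → P' t ≤ M * P t) (ha : P a ≤ 0) :
    ∀ t ∈ Icc a b, P t ≤ 0 := by
  intro t ht
  by_contra hcon
  push Not at hcon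
  obtain ⟨s, hs, hs0, hpos⟩ := exists_last_nonpos ht.1
    (h.continuousOn.mono (Icc_subset_Icc le_rfl ht.2)) ha hcon
  have h1 := (((h.mono hs.1 hs.2.le ht.2).mul_exp (-M))).le_of_nonpos (by
    filter_upwards [hM] with q h1 hq
    have := h1 ⟨hs.1.trans_lt hq.1, hq.2.trans_le ht.2⟩ (hpos q ⟨hq.1, hq.2.le⟩)
    have h3 := Real.exp_pos (-M * q)
    nlinarith)
  have h2 : P s * Real.exp (-M * s) ≤ 0 :=
    mul_nonpos_of_nonpos_of_nonneg hs0 (Real.exp_pos _).le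
  have h3 := mul_pos hcon (Real.exp_pos (-M * t))
  linarith

/-- If `P' ≤ M |P| - ν` with `ν ≥ 0`, `P a = 0` and `P b ≥ 0`, then `ν` vanishes. -/
lemma ae_eq_zero_of_deriv_le {ν : ℝ → ℝ} (h : ACDeriv P P' a b)
    (hM : ∀ᵐ t, t ∈ Ioo a b → 0 ≤ ν t ∧ P' t ≤ M * |P t| - ν t) (ha : P a = 0) (hb : 0 ≤ P b) :
    ∀ᵐ t, t ∈ Ioo a b → ν t = 0 := by
  -- Gronwall gives `P ≤ 0`, so `|P| = -P` and `P e^{Mt}` is nonincreasing. It starts at zero and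
  -- does not end below zero, so it is constant and leaves no room for `ν`.
  have hP : ∀ t ∈ Icc a b, P t ≤ 0 := h.nonpos_of_deriv_le (M := M) (by
    filter_upwards [hM] with t h1 ht hpos
    have := h1 ht
    rw [abs_of_pos hpos] at this
    linarith) ha.le
  have hbound : ∀ᵐ t, t ∈ Ioo a b → 0 ≤ ν t ∧ P' t + M * P t ≤ - ν t := by
    filter_upwards [hM] with t h1 ht
    have h2 := h1 ht
    rw [abs_of_nonpos (hP t (Ioo_subset_Icc_self ht))] at h2
    exact ⟨h2.1, by linarith⟩
  have h2 := (h.mul_exp M).ae_eq_zero_of_nonpos (by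
    filter_upwards [hbound] with t h1 ht
    have := h1 ht
    exact mul_nonpos_of_nonpos_of_nonneg (by linarith) (Real.exp_pos _).le)
    (by rw [ha, zero_mul]; exact mul_nonneg hb (Real.exp_pos _).le)
  filter_upwards [h2, hbound] with t h1 h2 ht
  have h3 := h1 ht
  have h4 := h2 ht
  rcases mul_eq_zero.1 h3 with h5 | h5
  · linarith
  · exact absurd h5 (Real.exp_pos _).ne'

end ACDeriv

/-- A continuous function vanishing almost everywhere on an open interval vanishes on its
closure. -/
lemma ContinuousOn.eq_of_ae_eq_Ioo {f g : ℝ → ℝ} {a b : ℝ} (hab : a < b)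
    (hf : ContinuousOn f (Icc a b)) (hg : ContinuousOn g (Icc a b))
    (h : ∀ᵐ t, t ∈ Ioo a b → f t = g t) : ∀ t ∈ Icc a b, f t = g t := by
  have h1 : EqOn f g (Icc a b) := by
    refine Measure.eqOn_Icc_of_ae_eq (μ := volume) hab.ne ?_ hf hg
    rw [← Measure.restrict_congr_set Ioo_ae_eq_Icc]
    exact (ae_restrict_iff' measurableSet_Ioo).2 h
  exact h1


/-! ### Consequences of the standing assumptions -/

namespace Fishery
variable {M : Fishery}

/-- The growth rate `F(y) / y`. -/
def rate (M : Fishery) (y : ℝ) : ℝ := M.F y / y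

/-- A primitive of `c_* / y - p`, normalised at `x^*`. -/
def GStar (M : Fishery) (y : ℝ) : ℝ :=
  M.cStar * Real.log (y / M.xStar) - M.p * (y - M.xStar)

/-- The running cost in terms of the stock, when all capital is in use. -/
def HStar (M : Fishery) (y : ℝ) : ℝ := (M.cStar / y - M.p) * M.F y - M.δ * M.GStar y

namespace Standing
variable (hM : M.Standing)
include hM

lemma δ_pos : 0 < M.δ := hM.V2.1
lemma r_pos : 0 < M.r := hM.V2.2.1
lemma c_pos : 0 < M.c := hM.V2.2.2.1
lemma γ_pos : 0 < M.γ := hM.V2.2.2.2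
lemma κ_pos : 0 < M.κ := add_pos hM.δ_pos hM.γ_pos
lemma r'_pos : 0 < M.r' := mul_pos hM.r_pos hM.κ_pos
lemma cStar_pos : 0 < M.cStar := add_pos hM.c_pos hM.r'_pos
lemma p_pos : 0 < M.p := by
  have h1 := hM.V3
  have h2 := hM.cStar_pos
  have h3 := hM.xbar_pos
  by_contra h
  nlinarith

lemma xStar_pos : 0 < M.xStar := hM.V4_xStar.1
lemma xTilde_pos : 0 < M.xTilde := hM.V4_xTilde.1

lemma contDiffAt {y : ℝ} (hy : 0 < y) : ContDiffAt ℝ 2 M.F y :=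
  hM.V1_C2.contDiffAt (Ici_mem_nhds hy)

lemma hasDerivAt {y : ℝ} (hy : 0 < y) : HasDerivAt M.F (deriv M.F y) y :=
  ((hM.contDiffAt hy).differentiableAt (by norm_num)).hasDerivAt

lemma continuousOn_deriv : ContinuousOn (deriv M.F) (Ioi 0) := by
  have h : ContDiffOn ℝ 2 M.F (Ioi 0) := hM.V1_C2.mono Ioi_subset_Ici_self
  exact h.continuousOn_deriv_of_isOpen isOpen_Ioi (by norm_num)

lemma continuousOn_F : ContinuousOn M.F (Ici 0) := hM.V1_C2.continuousOn

lemma deriv_deriv_neg {y : ℝ} (hy : y ∈ Ioc 0 M.xbar) : deriv (deriv M.F) y < 0 := by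
  have h1 := hM.V1_concave y ⟨hy.1.le, hy.2⟩
  have h2 : iteratedDerivWithin 2 M.F (Ici 0) y = iteratedDeriv 2 M.F y :=
    iteratedDerivWithin_eq_iteratedDeriv (uniqueDiffOn_Ici 0) (hM.contDiffAt hy.1)
      (mem_Ici.2 hy.1.le)
  rwa [h2, iteratedDeriv_succ, iteratedDeriv_one] at h1

lemma strictAntiOn_deriv : StrictAntiOn (deriv M.F) (Ioc 0 M.xbar) := by
  refine strictAntiOn_of_deriv_neg (convex_Ioc _ _)
    (hM.continuousOn_deriv.mono fun y hy => hy.1) fun y hy => ?_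
  rw [interior_Ioc] at hy
  exact hM.deriv_deriv_neg ⟨hy.1, hy.2.le⟩

lemma deriv_lt_rate {y : ℝ} (hy : y ∈ Ioc 0 M.xbar) : deriv M.F y < M.rate y := by
  obtain ⟨ξ, hξ, h⟩ := exists_deriv_eq_slope M.F hy.1
    (hM.continuousOn_F.mono fun t ht => ht.1)
    (fun t ht => (hM.hasDerivAt ht.1).differentiableAt.differentiableWithinAt)
  rw [hM.V1_zero, sub_zero, sub_zero] at h
  rw [rate, ← h]
  exact hM.strictAntiOn_deriv ⟨hξ.1, hξ.2.le.trans hy.2⟩ hy hξ.2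

lemma hasDerivAt_rate {y : ℝ} (hy : 0 < y) :
    HasDerivAt M.rate ((deriv M.F y - M.rate y) / y) y := by
  have := (hM.hasDerivAt hy).div (hasDerivAt_id y) hy.ne'
  refine this.congr_deriv ?_
  simp only [rate, id]
  field_simp

lemma continuousOn_rate : ContinuousOn M.rate (Ioi 0) :=
  fun _ hy => (hM.hasDerivAt_rate hy).continuousAt.continuousWithinAt

lemma strictAntiOn_rate : StrictAntiOn M.rate (Ioc 0 M.xbar) := by
  refine strictAntiOn_of_deriv_neg (convex_Ioc _ _)
    (hM.continuousOn_rate.mono fun y hy => hy.1) fun y hy => ?_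
  rw [interior_Ioc] at hy
  rw [(hM.hasDerivAt_rate hy.1).deriv]
  exact div_neg_of_neg_of_pos (sub_neg.2 (hM.deriv_lt_rate ⟨hy.1, hy.2.le⟩)) hy.1

lemma rate_pos {y : ℝ} (hy : y ∈ Ioo 0 M.xbar) : 0 < M.rate y := div_pos (hM.V1_pos y hy) hy.1

lemma contDiffOn_rate : ContDiffOn ℝ 1 M.rate (Ioi 0) := by
  refine ContDiffOn.div ?_ contDiffOn_id fun y hy => (mem_Ioi.1 hy).ne'
  exact (hM.V1_C2.mono Ioi_subset_Ici_self).of_le (by norm_num)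

lemma continuousOn_g : ContinuousOn M.g (Ioi 0) := by
  have : M.g = fun y => M.δ - deriv M.F y + M.rate y := rfl
  rw [this]
  exact (continuousOn_const.sub hM.continuousOn_deriv).add hM.continuousOn_rate

lemma continuousOn_ψ : ContinuousOn M.ψ (Ioi 0) := by
  have : M.ψ = fun y => (M.p * y - M.c) * (M.δ - deriv M.F y) - M.c * M.rate y := by
    ext y; simp only [ψ, rate]; ring
  rw [this]
  have h1 := hM.continuousOn_deriv
  have h2 := hM.continuousOn_rate
  fun_prop

omit hM in
lemma ψStar_eq (y : ℝ) : M.ψStar y = M.ψ y - M.r' * M.g y := by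
  simp only [ψStar, ψ, g, cStar]; ring

omit hM in
lemma ψ_eq (y : ℝ) : M.ψ y = M.p * y * (M.δ - deriv M.F y) - M.c * M.g y := by
  simp only [ψ, g]; ring

lemma continuousOn_ψStar : ContinuousOn M.ψStar (Ioi 0) := by
  have : M.ψStar = fun y => M.ψ y - M.r' * M.g y := funext fun y => ψStar_eq y
  rw [this]
  exact hM.continuousOn_ψ.sub (continuousOn_const.mul hM.continuousOn_g)

lemma strictMonoOn_g : StrictMonoOn M.g (Ioo 0 M.xbar) := by
  refine strictMonoOn_of_deriv_pos (convex_Ioo _ _)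
    (hM.continuousOn_g.mono fun y hy => hy.1) fun y hy => ?_
  rw [interior_Ioo] at hy
  exact hM.V6 y hy

lemma δ_lt_g {y : ℝ} (hy : y ∈ Ioc 0 M.xbar) : M.δ < M.g y := by
  have := hM.deriv_lt_rate hy
  simp only [g, rate] at *
  linarith

lemma g_pos {y : ℝ} (hy : y ∈ Ioc 0 M.xbar) : 0 < M.g y := hM.δ_pos.trans (hM.δ_lt_g hy)

lemma strictMonoOn_ψ : StrictMonoOn M.ψ (Ioo 0 M.xTilde) := by
  refine strictMonoOn_of_deriv_pos (convex_Ioo _ _)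
    (hM.continuousOn_ψ.mono fun y hy => hy.1) fun y hy => ?_
  rw [interior_Ioo] at hy
  exact hM.V5_ψ y hy

/-- `F'(y)` and `F(y) / y` have the same limit `d` at `0`, so its two occurrences in `ψ`, with
factors `c` and `-c`, cancel. -/
lemma tendsto_ψ_zero : Tendsto M.ψ (𝓝[>] 0) (𝓝 (-(M.c * M.δ))) := by
  set d := derivWithin M.F (Ici 0) 0
  have hd : HasDerivWithinAt M.F d (Ici 0) 0 :=
    ((hM.V1_C2 0 (mem_Ici.2 le_rfl)).differentiableWithinAt (by norm_num)).hasDerivWithinAt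
  have h1 : Tendsto M.rate (𝓝[>] 0) (𝓝 d) := by
    have := (hasDerivWithinAt_iff_tendsto_slope' (self_notMem_Ioi (a := (0 : ℝ)))).1
      (hd.mono Ioi_subset_Ici_self)
    refine this.congr' ?_
    filter_upwards [self_mem_nhdsWithin] with y hy
    simp [slope_def_field, hM.V1_zero, rate]
  have h2 : Tendsto (deriv M.F) (𝓝[>] 0) (𝓝 d) := by
    have h3 := (hM.V1_C2.continuousOn_derivWithin (uniqueDiffOn_Ici 0) (by norm_num)) 0
      (mem_Ici.2 le_rfl)
    refine (h3.mono_left (nhdsWithin_mono _ Ioi_subset_Ici_self)).congr' ?_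
    filter_upwards [self_mem_nhdsWithin] with y hy
    exact derivWithin_of_mem_nhds (Ici_mem_nhds hy)
  have h0 : Tendsto (fun y : ℝ => y) (𝓝[>] 0) (𝓝 0) := tendsto_id.mono_left nhdsWithin_le_nhds
  have h4 := (((h0.const_mul M.p).sub_const M.c).mul (h2.const_sub M.δ)).sub (h1.const_mul M.c)
  have h5 : (M.p * 0 - M.c) * (M.δ - d) - M.c * d = -(M.c * M.δ) := by ring
  rw [h5] at h4
  refine h4.congr fun y => ?_
  simp only [ψ, rate]; ring

/-- The bound is the limit of `ψ` at `0`, from which `ψ` increases; the detour through `y / 2` makes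
the inequality strict. -/
lemma neg_lt_ψ {y : ℝ} (hy : y ∈ Ioo 0 M.xTilde) : -(M.c * M.δ) < M.ψ y := by
  have hy2 : y / 2 ∈ Ioo 0 M.xTilde := ⟨by linarith [hy.1], by linarith [hy.1, hy.2]⟩
  have h1 : -(M.c * M.δ) ≤ M.ψ (y / 2) := by
    refine le_of_tendsto hM.tendsto_ψ_zero ?_
    filter_upwards [Ioo_mem_nhdsGT hy2.1] with t ht
    exact (hM.strictMonoOn_ψ ⟨ht.1, ht.2.trans hy2.2⟩ hy2 ht.2).le
  exact h1.trans_lt (hM.strictMonoOn_ψ hy2 hy (by linarith [hy.1]))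

/-- The marginal growth of the stock is everywhere below the discount rate. -/
lemma deriv_lt_δ {y : ℝ} (hy : y ∈ Ioc 0 M.xbar) : deriv M.F y < M.δ := by
  -- `p t (δ - F'(t)) = ψ(t) + c g(t)` exceeds `-cδ + cδ = 0` to the left of `x~`. Concavity carries
  -- the inequality to larger arguments.
  have key : ∀ t ∈ Ioo 0 M.xTilde, deriv M.F t < M.δ := by
    intro t ht
    have h1 := hM.neg_lt_ψ ht
    have h2 := hM.δ_lt_g (y := t) ⟨ht.1, ht.2.le.trans hM.V4_xTilde.2.le⟩
    rw [ψ_eq] at h1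
    have h3 : 0 < M.p * t * (M.δ - deriv M.F t) := by
      have := hM.c_pos
      nlinarith
    have := (pos_iff_pos_of_mul_pos h3).1 (mul_pos hM.p_pos ht.1)
    linarith
  set t := min y (M.xTilde / 2)
  have ht0 : 0 < t := lt_min hy.1 (by linarith [hM.xTilde_pos])
  have ht : t ∈ Ioo 0 M.xTilde :=
    ⟨ht0, (min_le_right _ _).trans_lt (by linarith [hM.xTilde_pos])⟩
  refine lt_of_le_of_lt ?_ (key t ht)
  exact hM.strictAntiOn_deriv.antitoneOn ⟨ht0, (min_le_left _ _).trans hy.2⟩ hy (min_le_left _ _)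

/-- Monotonicity of `ψ - z g` to the right of `(z + c) / p`. -/
lemma ψ_sub_lt {y₁ y₂ z : ℝ} (h₁ : 0 < y₁) (h₁₂ : y₁ < y₂) (h₂ : y₂ < M.xbar)
    (hz : z + M.c ≤ M.p * y₁) : M.ψ y₁ - z * M.g y₁ < M.ψ y₂ - z * M.g y₂ := by
  have hy₁ : y₁ ∈ Ioo 0 M.xbar := ⟨h₁, h₁₂.trans h₂⟩
  have hy₂ : y₂ ∈ Ioo 0 M.xbar := ⟨h₁.trans h₁₂, h₂⟩
  have hg := hM.strictMonoOn_g hy₁ hy₂ h₁₂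
  have hr := hM.strictAntiOn_rate (Ioo_subset_Ioc_self hy₁) (Ioo_subset_Ioc_self hy₂) h₁₂
  have hh := hM.deriv_lt_δ (Ioo_subset_Ioc_self hy₂)
  have hp := hM.p_pos
  rw [ψ_eq, ψ_eq]
  have e1 : M.g y₁ = M.δ - deriv M.F y₁ + M.rate y₁ := rfl
  have e2 : M.g y₂ = M.δ - deriv M.F y₂ + M.rate y₂ := rfl
  -- The increment of `ψ - z g = p y (δ - F') - (z + c) g` is the sum of the three products bounded
  -- here; `δ - F' = g - F / y` splits it that way.
  have k1 : 0 ≤ (M.p * y₁ - (z + M.c)) * (M.g y₂ - M.g y₁) :=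
    mul_nonneg (sub_nonneg.2 hz) (sub_nonneg.2 hg.le)
  have k2 : 0 < M.p * ((y₂ - y₁) * (M.δ - deriv M.F y₂)) :=
    mul_pos hp (mul_pos (sub_pos.2 h₁₂) (sub_pos.2 hh))
  have k3 : 0 < M.p * (y₁ * (M.rate y₁ - M.rate y₂)) :=
    mul_pos hp (mul_pos h₁ (sub_pos.2 hr))
  rw [e1, e2] at *
  nlinarith

/-- At the zero of `ψ_*` the product `(p x^* - c_*)(δ - F'(x^*))` equals `c_* F(x^*) / x^* > 0`, and
its second factor is positive. -/
lemma cStar_lt : M.cStar < M.p * M.xStar := by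
  have h1 := hM.V4_ψStar_zero
  have h2 := hM.deriv_lt_δ (Ioo_subset_Ioc_self hM.V4_xStar)
  have h3 : 0 < M.cStar * M.F M.xStar / M.xStar :=
    div_pos (mul_pos hM.cStar_pos (hM.V1_pos _ hM.V4_xStar)) hM.xStar_pos
  simp only [ψStar] at h1
  have h4 : 0 < (M.p * M.xStar - M.cStar) * (M.δ - deriv M.F M.xStar) := by linarith
  have := (pos_iff_pos_of_mul_pos h4).2 (sub_pos.2 h2)
  linarith

/-- `ψ_* = ψ - r' g` is negative at the zero `x~` of `ψ`, and `ψ_*` is negative only to the left of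
`x^*`. -/
lemma xTilde_lt_xStar : M.xTilde < M.xStar := by
  by_contra hcon
  push Not at hcon
  have h1 : 0 ≤ M.ψStar M.xTilde := by
    rcases hcon.eq_or_lt with h | h
    · rw [← h, hM.V4_ψStar_zero]
    · exact (hM.V4_ψStar_pos _ ⟨h, hM.V4_xTilde.2⟩).le
  rw [ψStar_eq, hM.V4_ψ_zero] at h1
  have := mul_pos hM.r'_pos (hM.g_pos (Ioo_subset_Ioc_self hM.V4_xTilde))
  linarith

lemma KStar_pos : 0 < M.KStar := hM.rate_pos hM.V4_xStar

omit hM in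
lemma KStar_eq : M.KStar = M.rate M.xStar := rfl

lemma hasDerivAt_GStar {y : ℝ} (hy : 0 < y) : HasDerivAt M.GStar (M.cStar / y - M.p) y := by
  have hx := hM.xStar_pos
  have h1 := ((((hasDerivAt_id y).div_const M.xStar).log (div_pos hy hx).ne').const_mul
    M.cStar).sub (((hasDerivAt_id y).sub_const M.xStar).const_mul M.p)
  refine h1.congr_deriv ?_
  simp only [id]
  field_simp

lemma hasDerivAt_HStar {y : ℝ} (hy : 0 < y) : HasDerivAt M.HStar (M.ψStar y / y) y := by
  have h1 := ((((hasDerivAt_inv hy.ne').const_mul M.cStar).sub_const M.p).mul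
    (hM.hasDerivAt hy)).sub ((hM.hasDerivAt_GStar hy).const_mul M.δ)
  refine (h1.congr_deriv ?_).congr_of_eventuallyEq (Eventually.of_forall fun t => ?_)
  · simp only [ψStar]
    field_simp
    ring
  · simp [HStar, div_eq_mul_inv]

lemma continuousOn_HStar : ContinuousOn M.HStar (Ioi 0) :=
  fun _ hy => (hM.hasDerivAt_HStar hy).continuousAt.continuousWithinAt

/-- The derivative `ψ_* / y` changes from negative to positive at `x^*`. -/
lemma HStar_lt {y : ℝ} (hy : y ∈ Ioo 0 M.xbar) (hne : y ≠ M.xStar) :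
    M.HStar M.xStar < M.HStar y := by
  rcases lt_or_gt_of_ne hne with h | h
  · have : StrictAntiOn M.HStar (Ioc 0 M.xStar) := by
      refine strictAntiOn_of_deriv_neg (convex_Ioc _ _)
        (hM.continuousOn_HStar.mono fun t ht => ht.1) fun t ht => ?_
      rw [interior_Ioc] at ht
      rw [(hM.hasDerivAt_HStar ht.1).deriv]
      exact div_neg_of_neg_of_pos (hM.V4_ψStar_neg t ht) ht.1
    exact this ⟨hy.1, h.le⟩ ⟨hM.xStar_pos, le_rfl⟩ h
  · have : StrictMonoOn M.HStar (Ico M.xStar M.xbar) := by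
      refine strictMonoOn_of_deriv_pos (convex_Ico _ _)
        (hM.continuousOn_HStar.mono fun t ht => hM.xStar_pos.trans_le ht.1) fun t ht => ?_
      rw [interior_Ico] at ht
      have ht0 := hM.xStar_pos.trans ht.1
      rw [(hM.hasDerivAt_HStar ht0).deriv]
      exact div_pos (hM.V4_ψStar_pos t ht) ht0
    exact this ⟨le_rfl, hM.V4_xStar.2⟩ ⟨h.le, hy.2⟩ h

lemma HStar_le {y : ℝ} (hy : y ∈ Ioo 0 M.xbar) : M.HStar M.xStar ≤ M.HStar y := by
  rcases eq_or_ne y M.xStar with rfl | h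
  · exact le_rfl
  · exact (hM.HStar_lt hy h).le

lemma HStar_xStar : M.HStar M.xStar = M.KStar * (M.cStar - M.p * M.xStar) := by
  have := hM.xStar_pos.ne'
  simp only [HStar, GStar, KStar, div_self this, Real.log_one, sub_self]
  field_simp
  ring

/-- `-e^{-δT} G(x(T))` is the end term of the transformed running cost. In a lower bound of the cost
only an upper bound of `G` matters; `G` is unbounded below near `0`. -/
lemma GStar_le {y : ℝ} (hy : y ∈ Ioo 0 M.xbar) :
    M.GStar y ≤ M.cStar * (M.xbar / M.xStar) + M.p * M.xStar := by
  have hx := hM.xStar_pos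
  have h1 := Real.log_le_sub_one_of_pos (div_pos hy.1 hx)
  have h2 : y / M.xStar ≤ M.xbar / M.xStar := by gcongr; exact hy.2.le
  have h3 : M.cStar * Real.log (y / M.xStar) ≤ M.cStar * (M.xbar / M.xStar) :=
    mul_le_mul_of_nonneg_left (by linarith) hM.cStar_pos.le
  have h4 := mul_pos hM.p_pos hy.1
  simp only [GStar]
  linarith

/-- The growth rate is Lipschitz in the logarithm of the stock, on compact sets. -/
lemma exists_rate_lipschitz {m : ℝ} (hm : 0 < m) (m' : ℝ) :
    ∃ L : ℝ, 0 ≤ L ∧ ∀ y₁ ∈ Icc m m', ∀ y₂ ∈ Icc m m',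
      |M.rate y₁ - M.rate y₂| ≤ L * |Real.log y₁ - Real.log y₂| := by
  have h1 : ContDiffOn ℝ 1 (fun s => M.rate (Real.exp s)) (Icc (Real.log m) (Real.log m')) :=
    hM.contDiffOn_rate.comp Real.contDiff_exp.contDiffOn fun s _ => Real.exp_pos s
  obtain ⟨K, hK⟩ := h1.exists_lipschitzOnWith (by decide) (convex_Icc _ _) isCompact_Icc
  refine ⟨K, K.2, fun y₁ h₁ y₂ h₂ => ?_⟩
  have e1 := hm.trans_le h₁.1
  have e2 := hm.trans_le h₂.1
  have := hK.dist_le_mul (Real.log y₁)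
    ⟨Real.log_le_log hm h₁.1, Real.log_le_log e1 h₁.2⟩ (Real.log y₂)
    ⟨Real.log_le_log hm h₂.1, Real.log_le_log e2 h₂.2⟩
  simpa [Real.dist_eq, Real.exp_log e1, Real.exp_log e2] using this

lemma exists_F_lipschitz (B : ℝ) : ∃ L : ℝ, 0 ≤ L ∧ ∀ y₁ ∈ Icc 0 B, ∀ y₂ ∈ Icc 0 B,
    |M.F y₁ - M.F y₂| ≤ L * |y₁ - y₂| := by
  have h1 : ContDiffOn ℝ 1 M.F (Icc 0 B) :=
    (hM.V1_C2.mono fun t ht => ht.1).of_le (by norm_num)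
  obtain ⟨K, hK⟩ := h1.exists_lipschitzOnWith (by decide) (convex_Icc _ _) isCompact_Icc
  exact ⟨K, K.2, fun y₁ h₁ y₂ h₂ => by simpa [Real.dist_eq] using hK.dist_le_mul _ h₁ _ h₂⟩

end Standing
end Fishery

/-! ### Extremal arcs and their uniqueness -/

namespace Fishery
variable {M : Fishery}

/-- An extremal arc without investment that starts with capital `K₀`, stays to the left of `x^*`
before time `τ`, and ends in `x^*` with switch variable `r'`. The catch rate is `v = u K`. -/
structure Arc (M : Fishery) (K₀ τ : ℝ) (x z v : ℝ → ℝ) : Prop where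
  τ_pos : 0 < τ
  x_ac : ACDeriv x (fun t => M.F (x t) - v t * x t) 0 τ
  z_ac : ACDeriv z (fun t => z t * M.g (x t) - M.ψ (x t)) 0 τ
  x_mem : ∀ t ∈ Ico 0 τ, x t ∈ Ioo 0 M.xStar
  x_end : x τ = M.xStar
  z_end : z τ = M.r'
  max : ∀ᵐ t, t ∈ Ioo 0 τ → v t ∈ Icc 0 (K₀ * Real.exp (-M.γ * t)) ∧
    ∀ w ∈ Icc 0 (K₀ * Real.exp (-M.γ * t)), z t * w ≤ z t * v t

/-- In the logarithm of the stock the catch rate enters additively, with coefficient `-1`; this is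
what lets the maximum condition compare two arcs. -/
lemma acDeriv_log {x v : ℝ → ℝ} {a b : ℝ}
    (hx : ACDeriv x (fun t => M.F (x t) - v t * x t) a b)
    (hpos : ∀ t ∈ Icc a b, 0 < x t) :
    ACDeriv (fun t => Real.log (x t)) (fun t => M.rate (x t) - v t) a b := by
  have hne : (Icc a b).Nonempty := nonempty_Icc.2 hx.le
  obtain ⟨t₁, ht₁, h₁⟩ := isCompact_Icc.exists_isMinOn hne hx.continuousOn
  obtain ⟨t₂, ht₂, h₂⟩ := isCompact_Icc.exists_isMaxOn hne hx.continuousOn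
  have h := hx.comp (G := Real.log) (G' := fun y => y⁻¹) (m := x t₁) (m' := x t₂)
    (fun t ht => ⟨h₁ ht, h₂ ht⟩)
    (Real.contDiffOn_log.mono fun y hy => ((hpos t₁ ht₁).trans_le hy.1).ne')
    (fun t ht => Real.hasDerivAt_log (hpos t ht).ne')
  refine h.congr_ae (Eventually.of_forall fun t ht => ?_)
  have := (hpos t (Ioo_subset_Icc_self ht)).ne'
  simp only [rate]
  field_simp

/-- Once the switch variable has reached `r'` it exceeds `r'` as long as the stock is to the left
of `x^*`. -/
lemma Standing.r'_lt_of_le (hM : M.Standing) {x z : ℝ → ℝ} {a b : ℝ} (hab : a < b)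
    (hz : ACDeriv z (fun t => z t * M.g (x t) - M.ψ (x t)) a b)
    (hx : ∀ t ∈ Ico a b, x t ∈ Ioo 0 M.xStar) (ha : M.r' ≤ z a) : M.r' < z b := by
  -- `Q = r' - z` solves `Q' = Q g + ψ_*` with `ψ_* < 0` to the left of `x^*`: it cannot become
  -- positive, and being nonpositive it decreases strictly.
  have hQ : ACDeriv (fun t => M.r' - z t) (fun t => (M.r' - z t) * M.g (x t) + M.ψStar (x t))
      a b := by
    refine ((ACDeriv.const hab.le M.r').sub hz).congr_ae (Eventually.of_forall fun t _ => ?_)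
    rw [Standing.ψStar_eq]; ring
  have hn := hQ.nonpos_of_deriv_le (M := M.g M.xStar) (by
    refine Eventually.of_forall fun t ht hpos => ?_
    have hxt := hx t (Ioo_subset_Ico_self ht)
    have h1 := hM.V4_ψStar_neg _ hxt
    have h2 := hM.strictMonoOn_g ⟨hxt.1, hxt.2.trans hM.V4_xStar.2⟩ hM.V4_xStar hxt.2
    nlinarith) (by linarith)
  have h2 := hQ.lt_of_neg hab (by
    refine Eventually.of_forall fun t ht => ?_
    have hxt := hx t (Ioo_subset_Ico_self ht)
    have h1 := hM.V4_ψStar_neg _ hxt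
    have h2 := hn t (Ioo_subset_Icc_self ht)
    have h3 := hM.g_pos ⟨hxt.1, (hxt.2.trans hM.V4_xStar.2).le⟩
    nlinarith)
  have := hn a ⟨le_rfl, hab.le⟩
  linarith

namespace Arc
variable {K₀ τ τ' : ℝ} {x z v x' z' v' : ℝ → ℝ}

lemma pos (hM : M.Standing) (h : M.Arc K₀ τ x z v) {t : ℝ} (ht : t ∈ Icc 0 τ) : 0 < x t := by
  rcases ht.2.eq_or_lt with rfl | h1
  · rw [h.x_end]; exact hM.xStar_pos
  · exact (h.x_mem t ⟨ht.1, h1⟩).1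

lemma le_xStar (h : M.Arc K₀ τ x z v) {t : ℝ} (ht : t ∈ Icc 0 τ) : x t ≤ M.xStar := by
  rcases ht.2.eq_or_lt with rfl | h1
  · exact h.x_end.le
  · exact (h.x_mem t ⟨ht.1, h1⟩).2.le

lemma lt_xbar (hM : M.Standing) (h : M.Arc K₀ τ x z v) {t : ℝ} (ht : t ∈ Icc 0 τ) :
    x t < M.xbar := (h.le_xStar ht).trans_lt hM.V4_xStar.2

/-- The level `r'` cannot be reached early: from there `z` would exceed `r'` at the end of the arc.
-/
lemma z_lt (hM : M.Standing) (h : M.Arc K₀ τ x z v) {t : ℝ} (ht : t ∈ Ico 0 τ) : z t < M.r' := by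
  by_contra hcon
  have := hM.r'_lt_of_le ht.2 (h.z_ac.mono ht.1 ht.2.le le_rfl)
    (fun s hs => h.x_mem s ⟨ht.1.trans hs.1, hs.2⟩) (not_lt.1 hcon)
  exact absurd h.z_end this.ne'

lemma z_le (hM : M.Standing) (h : M.Arc K₀ τ x z v) {t : ℝ} (ht : t ∈ Icc 0 τ) : z t ≤ M.r' := by
  rcases ht.2.eq_or_lt with rfl | h1
  · exact h.z_end.le
  · exact (h.z_lt hM ⟨ht.1, h1⟩).le

/-- Along an arc a marginal unit of stock has positive value. -/
lemma z_add_lt (hM : M.Standing) (h : M.Arc K₀ τ x z v) {t : ℝ} (ht : t ∈ Icc 0 τ) :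
    z t + M.c < M.p * x t := by
  by_contra hcon
  push Not at hcon
  -- `S = p x - z - c` satisfies `S' = S (g - v) - (z + c) v`, and `z v ≥ 0` by the maximum
  -- condition. So once `S ≤ 0` it stays so up to `τ`, where `S = p x^* - c_* > 0`.
  have hS : ACDeriv (fun s => M.p * x s - (z s + M.c))
      (fun s => (M.p * x s - (z s + M.c)) * (M.g (x s) - v s) - (z s + M.c) * v s) t τ := by
    have h1 := ((h.x_ac.const_mul M.p).sub (h.z_ac.add (ACDeriv.const h.τ_pos.le M.c))).mono
      ht.1 ht.2 le_rfl
    refine h1.congr_ae (Eventually.of_forall fun s hs => ?_)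
    have := (h.pos hM ⟨ht.1.trans hs.1.le, hs.2.le⟩).ne'
    simp only [g, ψ]
    field_simp
    ring
  have h2 := hS.nonpos_of_deriv_le (M := M.g M.xStar) (by
    filter_upwards [h.max] with s hs hst hpos
    have hs0 : s ∈ Ioo 0 τ := ⟨ht.1.trans_lt hst.1, hst.2⟩
    obtain ⟨hv, hw⟩ := hs hs0
    have h3 := hw 0 ⟨le_rfl, hv.1.trans hv.2⟩
    have hxs := h.x_mem s (Ioo_subset_Ico_self hs0)
    have h4 := hM.strictMonoOn_g ⟨hxs.1, hxs.2.trans hM.V4_xStar.2⟩ hM.V4_xStar hxs.2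
    have h5 := mul_nonneg hM.c_pos.le hv.1
    have h6 := mul_nonneg hpos.le hv.1
    have h7 := mul_le_mul_of_nonneg_left h4.le hpos.le
    nlinarith) (by linarith) τ ⟨ht.2, le_rfl⟩
  simp only [h.x_end, h.z_end] at h2
  have := hM.cStar_lt
  simp only [cStar] at this
  linarith

/-- The derivative of `P = (log x' - log x)(z' - z)` consists of `-(v' - v)(z' - z) ≤ 0` by the two
maximum conditions, terms bounded by a multiple of `|P|`, and `-ν`, where `ν ≥ 0` vanishes only if
the stocks agree. The signs of `P` at both ends force `ν = 0`. -/
lemma eqOn_of_le (hM : M.Standing) (h : M.Arc K₀ τ x z v) (h' : M.Arc K₀ τ' x' z' v')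
    (h0 : x 0 = x' 0) (hττ' : τ ≤ τ') : ∀ t ∈ Icc 0 τ, x t = x' t := by
  have hmem' : ∀ {t}, t ∈ Icc 0 τ → t ∈ Icc 0 τ' := fun ht => ⟨ht.1, ht.2.trans hττ'⟩
  have hx'c := h'.x_ac.mono le_rfl h.τ_pos.le hττ'
  have hz'c := h'.z_ac.mono le_rfl h.τ_pos.le hττ'
  have hlog := acDeriv_log h.x_ac fun t ht => h.pos hM ht
  have hlog' := acDeriv_log hx'c fun t ht => h'.pos hM (hmem' ht)
  have hne : (Icc 0 τ).Nonempty := nonempty_Icc.2 h.τ_pos.le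
  obtain ⟨t₁, ht₁, hm₁⟩ := isCompact_Icc.exists_isMinOn hne h.x_ac.continuousOn
  obtain ⟨t₂, ht₂, hm₂⟩ := isCompact_Icc.exists_isMinOn hne hx'c.continuousOn
  set m := min (x t₁) (x' t₂)
  have hm : 0 < m := lt_min (h.pos hM ht₁) (h'.pos hM (hmem' ht₂))
  obtain ⟨L, hL0, hL⟩ := hM.exists_rate_lipschitz hm M.xStar
  have hP := (hlog'.sub hlog).mul (hz'c.sub h.z_ac)
  set D : ℝ → ℝ := fun t => Real.log (x' t) - Real.log (x t) with hD
  -- The switch variable used is that of the arc with the smaller stock: `ψ_sub_lt` needs `z + c ≤ p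
  -- y₁` at the smaller argument, and each arc provides this for its own pair.
  let ν : ℝ → ℝ := fun t => if x t ≤ x' t then
      D t * ((M.ψ (x' t) - z t * M.g (x' t)) - (M.ψ (x t) - z t * M.g (x t)))
    else D t * ((M.ψ (x' t) - z' t * M.g (x' t)) - (M.ψ (x t) - z' t * M.g (x t)))
  have hνpos : ∀ t ∈ Icc 0 τ, 0 ≤ ν t ∧ (ν t = 0 → x t = x' t) := by
    intro t ht
    have hxp := h.pos hM ht
    have hxp' := h'.pos hM (hmem' ht)
    rcases lt_trichotomy (x t) (x' t) with hlt | heq | hgt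
    · have h1 := hM.ψ_sub_lt hxp hlt (h'.lt_xbar hM (hmem' ht)) (h.z_add_lt hM ht).le
      have h2 := Real.log_lt_log hxp hlt
      have : 0 < ν t := by
        simp only [ν, if_pos hlt.le, hD]
        exact mul_pos (sub_pos.2 h2) (sub_pos.2 h1)
      exact ⟨this.le, fun h0 => absurd h0 this.ne'⟩
    · refine ⟨?_, fun _ => heq⟩
      simp [ν, heq]
    · have h1 := hM.ψ_sub_lt hxp' hgt (h.lt_xbar hM ht) (h'.z_add_lt hM (hmem' ht)).le
      have h2 := Real.log_lt_log hxp' hgt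
      have : 0 < ν t := by
        simp only [ν, if_neg (not_le.2 hgt), hD]
        exact mul_pos_of_neg_of_neg (sub_neg.2 h2) (sub_neg.2 h1)
      exact ⟨this.le, fun h0 => absurd h0 this.ne'⟩
  have hzero := hP.ae_eq_zero_of_deriv_le (M := M.g M.xStar + L) (ν := ν) (by
    filter_upwards [h.max, h'.max] with t hmax hmax' ht
    have htI := Ioo_subset_Icc_self ht
    obtain ⟨hv, hw⟩ := hmax ht
    obtain ⟨hv', hw'⟩ := hmax' ⟨ht.1, ht.2.trans_le hττ'⟩
    refine ⟨(hνpos t htI).1, ?_⟩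
    have hxp := h.pos hM htI
    have hxp' := h'.pos hM (hmem' htI)
    have k1 := hw _ hv'
    have k2 := hw' _ hv
    have k3 := hL (x' t) ⟨(min_le_right _ _).trans (hm₂ htI), h'.le_xStar (hmem' htI)⟩
      (x t) ⟨(min_le_left _ _).trans (hm₁ htI), h.le_xStar htI⟩
    have g1 := hM.strictMonoOn_g.monotoneOn ⟨hxp, h.lt_xbar hM htI⟩ hM.V4_xStar (h.le_xStar htI)
    have g2 := hM.strictMonoOn_g.monotoneOn ⟨hxp', h'.lt_xbar hM (hmem' htI)⟩ hM.V4_xStar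
      (h'.le_xStar (hmem' htI))
    have g1' := hM.g_pos ⟨hxp, (h.lt_xbar hM htI).le⟩
    have g2' := hM.g_pos ⟨hxp', (h'.lt_xbar hM (hmem' htI)).le⟩
    have key : ∀ a b : ℝ, 0 < b → b ≤ M.g M.xStar → a * b ≤ M.g M.xStar * |a| := by
      intro a b hb hb'
      calc a * b ≤ |a| * b := by gcongr; exact le_abs_self a
        _ ≤ M.g M.xStar * |a| := by rw [mul_comm]; gcongr
    have k4 : (M.rate (x' t) - M.rate (x t)) * (z' t - z t) ≤ L * |D t * (z' t - z t)| := by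
      calc (M.rate (x' t) - M.rate (x t)) * (z' t - z t)
          ≤ |M.rate (x' t) - M.rate (x t)| * |z' t - z t| := by
            rw [← abs_mul]; exact le_abs_self _
        _ ≤ (L * |D t|) * |z' t - z t| := by gcongr
        _ = L * |D t * (z' t - z t)| := by rw [abs_mul]; ring
    by_cases hc : x t ≤ x' t
    · have := key (D t * (z' t - z t)) _ g2' g2
      simp only [ν, if_pos hc]
      simp only [hD] at *
      nlinarith
    · have := key (D t * (z' t - z t)) _ g1' g1
      simp only [ν, if_neg hc]
      simp only [hD] at *
      nlinarith)
    -- At `τ` the first arc has `x = x^*` and `z = r'`, upper bounds for the other one, so both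
    -- factors of the product are nonpositive.
    (by simp [h0]) (by
      have e1 : Real.log (x' τ) ≤ Real.log (x τ) := by
        rw [h.x_end]
        exact Real.log_le_log (h'.pos hM ⟨h.τ_pos.le, hττ'⟩) (h'.le_xStar ⟨h.τ_pos.le, hττ'⟩)
      have e2 : z' τ ≤ z τ := by
        rw [h.z_end]
        exact h'.z_le hM ⟨h.τ_pos.le, hττ'⟩
      exact mul_nonneg_of_nonpos_of_nonpos (sub_nonpos.2 e1) (sub_nonpos.2 e2))
  refine ContinuousOn.eq_of_ae_eq_Ioo h.τ_pos h.x_ac.continuousOn hx'c.continuousOn ?_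
  filter_upwards [hzero] with t ht ht'
  exact (hνpos t (Ioo_subset_Icc_self ht')).2 (ht ht')

lemma end_eq_of_le (hM : M.Standing) (h : M.Arc K₀ τ x z v) (h' : M.Arc K₀ τ' x' z' v')
    (h0 : x 0 = x' 0) (hττ' : τ ≤ τ') : τ = τ' := by
  rcases hττ'.eq_or_lt with h1 | h1
  · exact h1
  · have h2 := h.eqOn_of_le hM h' h0 hττ' τ ⟨h.τ_pos.le, le_rfl⟩
    have h3 := (h'.x_mem τ ⟨h.τ_pos.le, h1⟩).2
    rw [← h2, h.x_end] at h3
    exact absurd h3 (lt_irrefl _)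

/-- Extremal arcs with the same initial state coincide. -/
theorem unique (hM : M.Standing) (h : M.Arc K₀ τ x z v) (h' : M.Arc K₀ τ' x' z' v')
    (h0 : x 0 = x' 0) : τ = τ' ∧ (∀ t ∈ Icc 0 τ, x t = x' t) ∧ (∀ t ∈ Icc 0 τ, z t = z' t) ∧
      ∀ᵐ t, t ∈ Ioo 0 τ → v t = v' t := by
  have hτ : τ = τ' := by
    rcases le_total τ τ' with h1 | h1
    · exact h.end_eq_of_le hM h' h0 h1
    · exact (h'.end_eq_of_le hM h h0.symm h1).symm
  subst hτ
  have hx := h.eqOn_of_le hM h' h0 le_rfl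
  refine ⟨rfl, hx, fun t ht => ?_, ?_⟩
  -- With equal stocks `(z - z')²` has derivative `2 g (z - z')² ≥ 0` and vanishes at `τ`.
  · have hw := h.z_ac.sub h'.z_ac
    have hw2 := ((hw.mul hw).mono ht.1 ht.2 le_rfl).le_of_nonneg (by
      refine Eventually.of_forall fun s hs => ?_
      have hs' : s ∈ Icc 0 τ := ⟨ht.1.trans hs.1.le, hs.2.le⟩
      have hg := hM.g_pos ⟨h.pos hM hs', (h.lt_xbar hM hs').le⟩
      rw [← hx s hs']
      have := mul_nonneg hg.le (mul_self_nonneg (z s - z' s))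
      nlinarith)
    rw [h.z_end, h'.z_end, sub_self, mul_zero] at hw2
    have := mul_self_eq_zero.1 (le_antisymm hw2 (mul_self_nonneg _))
    linarith
  · filter_upwards [h.x_ac.deriv_ae, h'.x_ac.deriv_ae] with t h1 h2 ht
    have h3 := (h2 ht).congr_of_eventuallyEq (f₁ := x) (by
      filter_upwards [Ioo_mem_nhds ht.1 ht.2] with s hs
      exact hx s (Ioo_subset_Icc_self hs))
    have h4 := (h1 ht).unique h3
    rw [← hx t (Ioo_subset_Icc_self ht)] at h4
    have h5 := h.pos hM (Ioo_subset_Icc_self ht)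
    have h6 : v t * x t = v' t * x t := by linarith
    exact mul_right_cancel₀ h5.ne' h6

end Arc
end Fishery

/-! ### A priori bounds for admissible processes -/

namespace Fishery
variable {M : Fishery}
namespace IsAdmissible
variable {x₀ K₀ : ℝ} {x K u : ℝ → ℝ} {μ : Measure ℝ}

lemma u_mem' (h : M.IsAdmissible x₀ K₀ x K u μ) : ∀ᵐ t : ℝ, 0 ≤ t → u t ∈ Icc (0 : ℝ) 1 :=
  (ae_restrict_iff' measurableSet_Ici).1 h.u_mem

lemma K_intervalIntegrable (h : M.IsAdmissible x₀ K₀ x K u μ) {a b : ℝ} (ha : 0 ≤ a)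
    (hb : 0 ≤ b) : IntervalIntegrable K volume a b :=
  (h.K_int a ha).symm.trans (h.K_int b hb)

lemma K_sub (h : M.IsAdmissible x₀ K₀ x K u μ) {a b : ℝ} (ha : 0 ≤ a) (hab : a ≤ b) :
    K b = K a - M.γ * (∫ s in a..b, K s) + (μ (Ioc a b)).toReal := by
  have hb := ha.trans hab
  have h1 : μ (Icc 0 b) = μ (Icc 0 a) + μ (Ioc a b) := by
    rw [← Icc_union_Ioc_eq_Icc ha hab, measure_union _ measurableSet_Ioc]
    exact disjoint_left.2 fun t h1 h2 => absurd h1.2 (not_le.2 h2.1)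
  have h2 : μ (Ioc a b) < ⊤ := lt_of_le_of_lt (measure_mono (Ioc_subset_Icc_self.trans (Icc_subset_Icc ha le_rfl)))
    (h.μ_fin b)
  rw [h.K_eq b hb, h.K_eq a ha, h1, ENNReal.toReal_add (h.μ_fin a).ne h2.ne,
    ← intervalIntegral.integral_add_adjacent_intervals
      ((h.K_int a ha).const_mul M.γ) ((h.K_intervalIntegrable ha hb).const_mul M.γ),
    intervalIntegral.integral_const_mul, intervalIntegral.integral_const_mul]
  ring

lemma K_le (hM : M.Standing) (h : M.IsAdmissible x₀ K₀ x K u μ) {t T : ℝ} (ht : 0 ≤ t)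
    (htT : t ≤ T) : K t ≤ K₀ + (μ (Icc 0 T)).toReal := by
  rw [h.K_eq t ht]
  have h1 : 0 ≤ ∫ s in (0 : ℝ)..t, M.γ * K s :=
    intervalIntegral.integral_nonneg ht fun s hs => mul_nonneg hM.γ_pos.le (h.K_nonneg s hs.1)
  have h2 : (μ (Icc 0 t)).toReal ≤ (μ (Icc 0 T)).toReal :=
    ENNReal.toReal_mono (h.μ_fin T).ne (measure_mono (Icc_subset_Icc le_rfl htT))
  linarith

lemma K_aemeasurable (h : M.IsAdmissible x₀ K₀ x K u μ) :
    AEMeasurable K (volume.restrict (Ici 0)) := by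
  have h1 : (⋃ n : ℕ, Ioc (0 : ℝ) n) = Ioi 0 := by
    ext t
    simp only [mem_iUnion, mem_Ioc, mem_Ioi]
    refine ⟨fun ⟨_, h⟩ => h.1, fun ht => ?_⟩
    obtain ⟨n, hn⟩ := exists_nat_ge t
    exact ⟨n, ht, hn⟩
  rw [← restrict_Ioi_eq_restrict_Ici, ← h1, aemeasurable_iUnion_iff]
  intro n
  have := (h.K_int n (Nat.cast_nonneg n)).1
  exact this.aestronglyMeasurable.aemeasurable

lemma v_intervalIntegrable (h : M.IsAdmissible x₀ K₀ x K u μ) {a b : ℝ} (ha : 0 ≤ a)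
    (hab : a ≤ b) : IntervalIntegrable (fun t => u t * K t) volume a b := by
  have hK := h.K_intervalIntegrable ha (ha.trans hab)
  rw [intervalIntegrable_iff_integrableOn_Ioc_of_le hab] at hK ⊢
  have hsub : Ioc a b ⊆ Ici 0 := fun t ht => ha.trans ht.1.le
  refine Integrable.bdd_mul (c := 1) hK
    (h.u_meas.mono_measure (Measure.restrict_mono hsub le_rfl)).aestronglyMeasurable ?_
  refine ae_mono (Measure.restrict_mono hsub le_rfl) ?_
  filter_upwards [h.u_mem] with t ht
  rw [Real.norm_eq_abs, abs_le]
  exact ⟨by linarith [ht.1], ht.2⟩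

lemma x_acDeriv (hM : M.Standing) (h : M.IsAdmissible x₀ K₀ x K u μ) {a b : ℝ} (ha : 0 ≤ a)
    (hab : a ≤ b) : ACDeriv x (fun t => M.F (x t) - (u t * K t) * x t) a b := by
  have hb := ha.trans hab
  have hxc : ContinuousOn x (Icc 0 b) := h.x_cont.mono fun t ht => ht.1
  have h1 : IntervalIntegrable (fun t => M.F (x t) - (u t * K t) * x t) volume 0 b := by
    refine IntervalIntegrable.sub ?_ ((h.v_intervalIntegrable le_rfl hb).mul_continuousOn ?_)
    · refine ContinuousOn.intervalIntegrable ?_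
      rw [uIcc_of_le hb]
      exact hM.continuousOn_F.comp hxc fun t ht => h.x_nonneg t ht.1
    · rwa [uIcc_of_le hb]
  have h2 : ACDeriv x (fun t => M.F (x t) - (u t * K t) * x t) 0 b :=
    ACDeriv.of_integral hb h1 fun t ht => h.x_eq t ht.1
  exact h2.mono ha hab le_rfl

lemma x_zero (h : M.IsAdmissible x₀ K₀ x K u μ) : x 0 = x₀ := by
  simpa using h.x_eq 0 le_rfl

lemma v_nonneg (h : M.IsAdmissible x₀ K₀ x K u μ) : ∀ᵐ t : ℝ, 0 ≤ t → 0 ≤ u t * K t := by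
  filter_upwards [h.u_mem'] with t h1 ht
  exact mul_nonneg (h1 ht).1 (h.K_nonneg t ht)

lemma v_le (h : M.IsAdmissible x₀ K₀ x K u μ) : ∀ᵐ t : ℝ, 0 ≤ t → u t * K t ≤ K t := by
  filter_upwards [h.u_mem'] with t h1 ht
  exact mul_le_of_le_one_left (h.K_nonneg t ht) (h1 ht).2

/-- `x' ≥ -(L + C) x`, where `L` is a Lipschitz constant of `F` with `F(0) = 0` and `C` bounds the
capital on `[0, T]`. -/
lemma x_pos (hM : M.Standing) (h : M.IsAdmissible x₀ K₀ x K u μ) (hx₀ : 0 < x₀) {T : ℝ}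
    (hT : 0 ≤ T) : 0 < x T := by
  have hac := h.x_acDeriv hM le_rfl hT
  obtain ⟨B, hB⟩ := isCompact_Icc.bddAbove_image hac.continuousOn
  obtain ⟨L, hL0, hL⟩ := hM.exists_F_lipschitz B
  set C := K₀ + (μ (Icc 0 T)).toReal
  have h1 := (hac.mul_exp (L + C)).le_of_nonneg (by
    filter_upwards [h.v_le] with t hv ht
    have hv := hv ht.1.le
    have hx := h.x_nonneg t ht.1.le
    have hxB : x t ≤ B := hB ⟨t, Ioo_subset_Icc_self ht, rfl⟩
    have hK := h.K_le hM ht.1.le ht.2.le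
    have hF := hL (x t) ⟨hx, hxB⟩ 0 ⟨le_rfl, hx.trans hxB⟩
    rw [hM.V1_zero, sub_zero, sub_zero, abs_of_nonneg hx] at hF
    have hF' := (abs_le.1 hF).1
    have : u t * K t * x t ≤ C * x t := mul_le_mul_of_nonneg_right (hv.trans hK) hx
    exact mul_nonneg (by nlinarith) (Real.exp_pos _).le)
  rw [h.x_zero, mul_zero, Real.exp_zero, mul_one] at h1
  exact pos_of_mul_pos_left (hx₀.trans_le h1) (Real.exp_pos _).le

/-- Fishing only lowers the stock, and `F(x) ≤ L (xbar - x)`, so `(xbar - x) e^{Lt}` does not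
decrease before a supposed first hit of `xbar`. -/
lemma x_lt (hM : M.Standing) (h : M.IsAdmissible x₀ K₀ x K u μ) (hx₀ : x₀ < M.xbar) {T : ℝ}
    (hT : 0 ≤ T) : x T < M.xbar := by
  by_contra hcon
  obtain ⟨s, hs, hsx, hlt⟩ := exists_first_hit hT (h.x_acDeriv hM le_rfl hT).continuousOn
    (by rwa [h.x_zero]) (not_lt.1 hcon)
  obtain ⟨L, hL0, hL⟩ := hM.exists_F_lipschitz M.xbar
  have h1 := (((ACDeriv.const hs.1.le M.xbar).sub (h.x_acDeriv hM le_rfl hs.1.le)).mul_exp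
    L).le_of_nonneg (by
      filter_upwards [h.v_nonneg] with t hv ht
      have hv := hv ht.1.le
      have hx := h.x_nonneg t ht.1.le
      have hxb := hlt t (Ioo_subset_Ico_self ht)
      have hF := hL (x t) ⟨hx, hxb.le⟩ M.xbar ⟨hM.xbar_pos.le, le_rfl⟩
      rw [hM.V1_xbar, sub_zero, abs_sub_comm, abs_of_pos (sub_pos.2 hxb)] at hF
      have hF' := (abs_le.1 hF).2
      have := mul_nonneg hv hx
      exact mul_nonneg (by linarith) (Real.exp_pos _).le)
  rw [hsx, h.x_zero] at h1
  simp at h1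
  linarith

lemma x_mem (hM : M.Standing) (h : M.IsAdmissible x₀ K₀ x K u μ) (hx₀ : x₀ ∈ Ioo 0 M.xbar)
    {t : ℝ} (ht : 0 ≤ t) : x t ∈ Ioo 0 M.xbar := ⟨h.x_pos hM hx₀.1 ht, h.x_lt hM hx₀.2 ht⟩

lemma runningCost_intervalIntegrable (h : M.IsAdmissible x₀ K₀ x K u μ) {T : ℝ} (hT : 0 ≤ T) :
    IntervalIntegrable (M.runningCost x K u) volume 0 T := by
  have hv := h.v_intervalIntegrable le_rfl hT
  have hxc : ContinuousOn x (uIcc 0 T) := by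
    rw [uIcc_of_le hT]; exact h.x_cont.mono fun t ht => ht.1
  unfold runningCost
  refine IntervalIntegrable.continuousOn_mul ?_ (by fun_prop)
  exact hv.continuousOn_mul (continuousOn_const.sub (continuousOn_const.mul hxc))

lemma runningCost_aemeasurable (h : M.IsAdmissible x₀ K₀ x K u μ) :
    AEMeasurable (M.runningCost x K u) (volume.restrict (Ici 0)) := by
  have hx : AEMeasurable x (volume.restrict (Ici 0)) := h.x_cont.aemeasurable measurableSet_Ici
  have hu := h.u_meas
  have hK := h.K_aemeasurable
  unfold runningCost
  fun_prop

/-- The discounted catch is integrable. -/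
lemma catch_integrable (hM : M.Standing) (h : M.IsAdmissible x₀ K₀ x K u μ)
    (hx₀ : x₀ ∈ Ioo 0 M.xbar) :
    IntegrableOn (fun t => Real.exp (-M.δ * t) * (u t * K t * x t)) (Ioi 0) := by
  obtain ⟨B, hB⟩ := (isCompact_Icc (a := (0 : ℝ)) (b := M.xbar)).bddAbove_image
    (hM.continuousOn_F.mono fun t ht => ht.1)
  have hB0 : 0 ≤ B := by
    have := hB ⟨0, ⟨le_rfl, hM.xbar_pos.le⟩, rfl⟩
    rwa [hM.V1_zero] at this
  have hint : ∀ T : ℝ, 0 ≤ T →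
      IntervalIntegrable (fun t => Real.exp (-M.δ * t) * (u t * K t * x t)) volume 0 T := by
    intro T hT
    have hxc : ContinuousOn x (uIcc 0 T) := by
      rw [uIcc_of_le hT]; exact h.x_cont.mono fun t ht => ht.1
    exact ((h.v_intervalIntegrable le_rfl hT).mul_continuousOn hxc).continuousOn_mul (by fun_prop)
  refine integrableOn_Ioi_of_intervalIntegral_norm_bounded (l := atTop) (b := fun n : ℕ => (n : ℝ))
    (x₀ + B / M.δ) 0 (fun n => ?_) tendsto_natCast_atTop_atTop (Eventually.of_forall fun n => ?_)
  · have := hint n (Nat.cast_nonneg n)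
    rwa [intervalIntegrable_iff_integrableOn_Ioc_of_le (Nat.cast_nonneg n)] at this
  · have hn : (0 : ℝ) ≤ n := Nat.cast_nonneg n
    -- With `B` a bound of `F`, the derivative of `-(x + B/δ) e^{-δt}` dominates the discounted
    -- catch; its total increase is at most `x₀ + B/δ`.
    have hΦ := ((h.x_acDeriv hM le_rfl hn).add (ACDeriv.const hn (B / M.δ))).mul_exp (-M.δ)
    have hle : ∫ t in (0 : ℝ)..n, ‖Real.exp (-M.δ * t) * (u t * K t * x t)‖ ≤
        ∫ t in (0 : ℝ)..n, -((M.F (x t) - u t * K t * x t + 0 + -M.δ * (x t + B / M.δ)) *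
          Real.exp (-M.δ * t)) := by
      refine intervalIntegral.integral_mono_ae_restrict hn (hint n hn).norm
        hΦ.intervalIntegrable.neg ?_
      refine (ae_restrict_iff' measurableSet_Icc).2 ?_
      filter_upwards [h.v_nonneg] with t hv ht
      have hx := h.x_mem hM hx₀ ht.1
      have hF : M.F (x t) ≤ B := hB ⟨x t, ⟨hx.1.le, hx.2.le⟩, rfl⟩
      have he := Real.exp_pos (-M.δ * t)
      have hd : M.δ * (B / M.δ) = B := by field_simp [hM.δ_pos.ne']
      rw [Real.norm_of_nonneg (mul_nonneg he.le (mul_nonneg (hv ht.1) hx.1.le))]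
      have := mul_nonneg hM.δ_pos.le hx.1.le
      have : u t * K t * x t ≤
          -(M.F (x t) - u t * K t * x t + 0 + -M.δ * (x t + B / M.δ)) := by linarith
      nlinarith
    refine hle.trans ?_
    rw [intervalIntegral.integral_neg, hΦ.integral_eq]
    have hx := h.x_mem hM hx₀ hn
    have : 0 ≤ (x n + B / M.δ) * Real.exp (-M.δ * n) :=
      mul_nonneg (add_nonneg hx.1.le (div_nonneg hB0 hM.δ_pos.le)) (Real.exp_pos _).le
    simp only [mul_zero, Real.exp_zero, mul_one, h.x_zero]
    linarith

/-- The discounted revenue in excess of the effort cost is finite. -/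
lemma lintegral_neg_lt_top (hM : M.Standing) (h : M.IsAdmissible x₀ K₀ x K u μ)
    (hx₀ : x₀ ∈ Ioo 0 M.xbar) :
    ∫⁻ t in Ici (0 : ℝ), ENNReal.ofReal (-M.runningCost x K u t) < ⊤ := by
  have h1 := (h.catch_integrable hM hx₀).const_mul M.p
  rw [← restrict_Ioi_eq_restrict_Ici]
  refine lt_of_le_of_lt (lintegral_mono_ae ?_) h1.lintegral_lt_top
  refine (ae_restrict_iff' measurableSet_Ioi).2 ?_
  filter_upwards [h.v_nonneg] with t hv ht
  have hv := hv (le_of_lt ht)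
  refine ENNReal.ofReal_le_ofReal ?_
  have h2 := mul_nonneg (Real.exp_pos (-M.δ * t)).le (mul_nonneg hM.c_pos.le hv)
  simp only [runningCost]
  nlinarith

end IsAdmissible
end Fishery


/-! ### The transformed cost and its minimum at `x^*` -/

lemma EReal.coe_ennreal_add_sub {A P N : ENNReal} (hA : A ≠ ⊤) (hP : P ≠ ⊤) (hN : N ≠ ⊤) :
    (A : EReal) + ((P : EReal) - (N : EReal)) =
      ((A.toReal + (P.toReal - N.toReal) : ℝ) : EReal) := by
  lift A to NNReal using hA
  lift P to NNReal using hP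
  lift N to NNReal using hN
  simp only [ENNReal.coe_toReal, EReal.coe_add, EReal.coe_sub, EReal.coe_nnreal_eq_coe_real]

lemma EReal.coe_ennreal_add_sub_eq_top {A P N : ENNReal} (h : A = ⊤ ∨ P = ⊤) (hN : N ≠ ⊤) :
    (A : EReal) + ((P : EReal) - (N : EReal)) = ⊤ := by
  lift N to NNReal using hN
  have hb : ∀ B : ENNReal, (B : EReal) - ((N : ENNReal) : EReal) ≠ ⊥ := by
    intro B
    induction B using ENNReal.recTopCoe with
    | top =>
      rw [EReal.coe_nnreal_eq_coe_real, EReal.coe_ennreal_top, EReal.top_sub_coe]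
      exact top_ne_bot
    | coe B =>
      rw [EReal.coe_nnreal_eq_coe_real, EReal.coe_nnreal_eq_coe_real, ← EReal.coe_sub]
      exact EReal.coe_ne_bot _
  rcases h with rfl | rfl
  · rw [EReal.coe_ennreal_top, EReal.top_add_of_ne_bot (hb P)]
  · rw [EReal.coe_nnreal_eq_coe_real N, EReal.coe_ennreal_top, EReal.top_sub_coe,
      EReal.add_top_of_ne_bot (EReal.coe_ennreal_ne_bot A)]

/-- Integration by parts against a discount factor. -/
lemma integral_exp_eq (μ : Measure ℝ) (k T : ℝ) (hT : 0 ≤ T) (hμ : μ (Icc 0 T) < ⊤) :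
    ∫ t in Icc 0 T, Real.exp (-k * t) ∂μ = Real.exp (-k * T) * (μ (Icc 0 T)).toReal +
      ∫ s in (0 : ℝ)..T, k * Real.exp (-k * s) * (μ (Icc 0 s)).toReal := by
  have hfin : IsFiniteMeasure (μ.restrict (Icc 0 T)) := ⟨by rwa [Measure.restrict_apply_univ]⟩
  -- Writing `e^{-kt}` as `e^{-kT}` plus an integral over `[t, T]` reduces the claim to Fubini.
  have h1 : ∀ t ∈ Icc 0 T, Real.exp (-k * t) = Real.exp (-k * T) +
      ∫ s in Ioc 0 T, (Ici t).indicator (fun s => k * Real.exp (-k * s)) s := by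
    intro t ht
    have h2 : ∫ s in Ioc 0 T, (Ici t).indicator (fun s => k * Real.exp (-k * s)) s =
        ∫ s in t..T, k * Real.exp (-k * s) := by
      rw [setIntegral_indicator measurableSet_Ici, intervalIntegral.integral_of_le ht.2]
      refine setIntegral_congr_set ?_
      have h3 : ∀ᵐ s : ℝ, s ≠ t := by simp [ae_iff, measure_singleton]
      filter_upwards [h3] with s hs
      refine propext ⟨fun h => ⟨lt_of_le_of_ne h.2 (Ne.symm hs), h.1.2⟩,
        fun h => ⟨⟨ht.1.trans_lt h.1, h.2⟩, h.1.le⟩⟩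
    have h4 : ∫ s in t..T, k * Real.exp (-k * s) = Real.exp (-k * t) - Real.exp (-k * T) := by
      have := ((ACDeriv.exp ht.2 (-k)).const_mul (-1)).integral_eq
      rw [show (∫ s in t..T, k * Real.exp (-k * s)) =
        ∫ s in t..T, -1 * (-k * Real.exp (-k * s)) from by
          refine intervalIntegral.integral_congr fun s _ => ?_
          ring, this]
      ring
    rw [h2, h4]; ring
  rw [setIntegral_congr_fun measurableSet_Icc h1]
  have hmeas : Measurable (Function.uncurry fun t s : ℝ =>
      (Ici t).indicator (fun s => k * Real.exp (-k * s)) s) := by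
    have : (Function.uncurry fun t s : ℝ => (Ici t).indicator (fun s => k * Real.exp (-k * s)) s) =
        {q : ℝ × ℝ | q.1 ≤ q.2}.indicator (fun q => k * Real.exp (-k * q.2)) := by
      ext ⟨t, s⟩
      simp [indicator, Function.uncurry]
    rw [this]
    exact Measurable.indicator (by fun_prop) (measurableSet_le measurable_fst measurable_snd)
  obtain ⟨C, hC⟩ := (isCompact_Icc (a := (0 : ℝ)) (b := T)).exists_bound_of_continuousOn
    (f := fun s => k * Real.exp (-k * s)) (by fun_prop)
  have hint : Integrable (Function.uncurry fun t s : ℝ =>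
      (Ici t).indicator (fun s => k * Real.exp (-k * s)) s)
      ((μ.restrict (Icc 0 T)).prod (volume.restrict (Ioc 0 T))) := by
    refine Integrable.of_bound hmeas.aestronglyMeasurable |C| ?_
    rw [← Measure.restrict_univ (μ := μ.restrict (Icc 0 T)), Measure.prod_restrict]
    refine (ae_restrict_iff' (MeasurableSet.univ.prod measurableSet_Ioc)).2
      (Eventually.of_forall fun q hq => ?_)
    simp only [Function.uncurry, indicator]
    split_ifs
    · exact (hC q.2 ⟨hq.2.1.le, hq.2.2⟩).trans (le_abs_self C)
    · simp
  have hleft : Integrable (fun t => ∫ s in Ioc 0 T,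
      (Ici t).indicator (fun s => k * Real.exp (-k * s)) s) (μ.restrict (Icc 0 T)) :=
    hint.integral_prod_left
  rw [integral_add (integrable_const _) hleft, integral_integral_swap hint,
    intervalIntegral.integral_of_le hT]
  congr 1
  · simp [Measure.real, mul_comm]
  · refine setIntegral_congr_fun measurableSet_Ioc fun s hs => ?_
    have : (fun t : ℝ => (Ici t).indicator (fun s => k * Real.exp (-k * s)) s) =
        (Iic s).indicator fun _ => k * Real.exp (-k * s) := by
      ext t; simp [indicator]
    simp only [this]
    rw [integral_indicator measurableSet_Iic, Measure.restrict_restrict measurableSet_Iic]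
    have h5 : Iic s ∩ Icc 0 T = Icc 0 s := by
      ext t
      simp only [mem_inter_iff, mem_Iic, mem_Icc]
      exact ⟨fun h => ⟨h.2.1, h.1⟩, fun h => ⟨h.2, h.1, h.2.trans hs.2⟩⟩
    rw [h5]
    simp [Measure.real, mul_comm]

namespace Fishery
variable {M : Fishery}

/-- The discounted cost of investment. -/
def capitalCost (M : Fishery) (μ : Measure ℝ) : ENNReal :=
  ∫⁻ t in Ici (0 : ℝ), ENNReal.ofReal (Real.exp (-M.δ * t) * M.r) ∂μ

/-- The positive part of the discounted running cost. -/
def expenses (M : Fishery) (x K u : ℝ → ℝ) : ENNReal :=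
  ∫⁻ t in Ici (0 : ℝ), ENNReal.ofReal (M.runningCost x K u t)

/-- The negative part of the discounted running cost. -/
def profits (M : Fishery) (x K u : ℝ → ℝ) : ENNReal :=
  ∫⁻ t in Ici (0 : ℝ), ENNReal.ofReal (-M.runningCost x K u t)

lemma cost_eq (x K u : ℝ → ℝ) (μ : Measure ℝ) : M.cost x K u μ =
    (M.capitalCost μ : EReal) + ((M.expenses x K u : EReal) - (M.profits x K u : EReal)) := rfl

namespace IsAdmissible
variable {x₀ K₀ : ℝ} {x K u : ℝ → ℝ} {μ : Measure ℝ}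

/-- The cost of investment up to time `T` in terms of the capital stock. -/
lemma capitalCost_eq (h : M.IsAdmissible x₀ K₀ x K u μ) {T : ℝ} (hT : 0 ≤ T) :
    ∫ t in Icc 0 T, Real.exp (-M.δ * t) ∂μ = Real.exp (-M.δ * T) * K T - K₀ +
      ∫ t in (0 : ℝ)..T, M.κ * (Real.exp (-M.δ * t) * K t) := by
  rw [integral_exp_eq μ M.δ T hT (h.μ_fin T)]
  -- `μ([0, t]) = K(t) + W(t)`, where `W` is absolutely continuous although `K` jumps, so
  -- integrating by parts is only needed for `W`.
  set W : ℝ → ℝ := fun t => (∫ s in (0 : ℝ)..t, M.γ * K s) - K₀ with hW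
  have hm : ∀ t, 0 ≤ t → (μ (Icc 0 t)).toReal = K t + W t := by
    intro t ht
    have := h.K_eq t ht
    simp only [hW]; linarith
  have hKint := h.K_int T hT
  have hWac : ACDeriv W (fun t => M.γ * K t) 0 T :=
    ACDeriv.of_integral hT (hKint.const_mul _) (k := -K₀) fun t _ => by simp only [hW]; ring
  have hprod := hWac.mul_exp (-M.δ)
  have hW0 : W 0 = -K₀ := by simp [hW]
  have e1 := hprod.integral_eq
  have i1 : IntervalIntegrable (fun t => M.κ * (Real.exp (-M.δ * t) * K t)) volume 0 T :=
    (hKint.continuousOn_mul (by fun_prop)).const_mul _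
  have e2 : ∫ s in (0 : ℝ)..T, M.δ * Real.exp (-M.δ * s) * (μ (Icc 0 s)).toReal =
      (∫ t in (0 : ℝ)..T, M.κ * (Real.exp (-M.δ * t) * K t)) -
        ∫ t in (0 : ℝ)..T, (M.γ * K t + -M.δ * W t) * Real.exp (-M.δ * t) := by
    rw [← intervalIntegral.integral_sub i1 hprod.intervalIntegrable]
    refine intervalIntegral.integral_congr fun t ht => ?_
    rw [uIcc_of_le hT] at ht
    simp only [hm t ht.1, κ]
    ring
  rw [e2, e1, hm T hT, hW0]
  simp
  ring

/-- The running cost up to time `T` in terms of the stock. -/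
lemma runningCost_integral (hM : M.Standing) (h : M.IsAdmissible x₀ K₀ x K u μ)
    (hx₀ : x₀ ∈ Ioo 0 M.xbar) {T : ℝ} (hT : 0 ≤ T) :
    IntervalIntegrable (fun t => Real.exp (-M.δ * t) * (M.HStar (x t) - M.r' * (u t * K t)))
      volume 0 T ∧
    ∫ t in (0 : ℝ)..T, M.runningCost x K u t =
      (∫ t in (0 : ℝ)..T, Real.exp (-M.δ * t) * (M.HStar (x t) - M.r' * (u t * K t))) +
        M.GStar x₀ - Real.exp (-M.δ * T) * M.GStar (x T) := by
  have hac := h.x_acDeriv hM le_rfl hT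
  have hpos : ∀ t ∈ Icc 0 T, 0 < x t := fun t ht => h.x_pos hM hx₀.1 ht.1
  have hne : (Icc 0 T).Nonempty := nonempty_Icc.2 hT
  obtain ⟨t₁, ht₁, hm₁⟩ := isCompact_Icc.exists_isMinOn hne hac.continuousOn
  obtain ⟨t₂, ht₂, hm₂⟩ := isCompact_Icc.exists_isMaxOn hne hac.continuousOn
  -- From `u K x = F - x'`, `(c - p x) u K = (c_*/x - p)(F - x') - r' u K`, and `(c_*/x - p) x'` is
  -- the derivative of `G(x)`.
  have hG : ACDeriv (fun t => M.GStar (x t)) (fun t => (M.cStar / x t - M.p) *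
      (M.F (x t) - u t * K t * x t)) 0 T := by
    refine hac.comp (G := M.GStar) (G' := fun y => M.cStar / y - M.p) (m := x t₁) (m' := x t₂)
      (fun t ht => ⟨hm₁ ht, hm₂ ht⟩) ?_ (fun t ht => hM.hasDerivAt_GStar (hpos t ht))
    have h1 : ContDiffOn ℝ 1 (fun y => Real.log (y / M.xStar)) (Icc (x t₁) (x t₂)) := by
      refine ContDiffOn.log (by fun_prop) fun y hy => ?_
      exact (div_pos ((hpos t₁ ht₁).trans_le hy.1) hM.xStar_pos).ne'
    unfold GStar
    fun_prop
  have hΓ := hG.mul_exp (-M.δ)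
  have hrc := h.runningCost_intervalIntegrable hT
  have hptw : ∀ t ∈ Icc 0 T, M.runningCost x K u t +
      ((M.cStar / x t - M.p) * (M.F (x t) - u t * K t * x t) + -M.δ * M.GStar (x t)) *
        Real.exp (-M.δ * t) =
      Real.exp (-M.δ * t) * (M.HStar (x t) - M.r' * (u t * K t)) := by
    intro t ht
    have := (hpos t ht).ne'
    simp only [runningCost, HStar, cStar]
    field_simp
    ring
  have hint := hrc.add hΓ.intervalIntegrable
  have hint' : IntervalIntegrable
      (fun t => Real.exp (-M.δ * t) * (M.HStar (x t) - M.r' * (u t * K t))) volume 0 T := by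
    refine hint.congr fun t ht => ?_
    rw [uIoc_of_le hT] at ht
    exact hptw t (Ioc_subset_Icc_self ht)
  refine ⟨hint', ?_⟩
  have e : ∫ t in (0 : ℝ)..T, Real.exp (-M.δ * t) * (M.HStar (x t) - M.r' * (u t * K t)) =
      (∫ t in (0 : ℝ)..T, M.runningCost x K u t) + ∫ t in (0 : ℝ)..T,
        ((M.cStar / x t - M.p) * (M.F (x t) - u t * K t * x t) + -M.δ * M.GStar (x t)) *
        Real.exp (-M.δ * t) := by
    rw [← intervalIntegral.integral_add hrc hΓ.intervalIntegrable]
    refine intervalIntegral.integral_congr fun t ht => ?_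
    rw [uIcc_of_le hT] at ht
    exact (hptw t ht).symm
  rw [e, hΓ.integral_eq, h.x_zero]
  simp
  ring

lemma expenses_ne_top_of_cost (hM : M.Standing) (h : M.IsAdmissible x₀ K₀ x K u μ)
    (hx₀ : x₀ ∈ Ioo 0 M.xbar) (hc : M.cost x K u μ ≠ ⊤) :
    M.capitalCost μ ≠ ⊤ ∧ M.expenses x K u ≠ ⊤ := by
  by_contra hcon
  refine hc ?_
  rw [cost_eq]
  refine EReal.coe_ennreal_add_sub_eq_top ?_ (h.lintegral_neg_lt_top hM hx₀).ne
  by_contra h'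
  push Not at h'
  exact hcon h'

lemma runningCost_integrable (h : M.IsAdmissible x₀ K₀ x K u μ)
    (h1 : M.expenses x K u ≠ ⊤) (h2 : M.profits x K u ≠ ⊤) :
    IntegrableOn (M.runningCost x K u) (Ici 0) := by
  refine ⟨h.runningCost_aemeasurable.aestronglyMeasurable, ?_⟩
  have h3 : ∀ t, ‖M.runningCost x K u t‖ₑ = ENNReal.ofReal (M.runningCost x K u t) +
      ENNReal.ofReal (-M.runningCost x K u t) := by
    intro t
    rw [Real.enorm_eq_ofReal_abs]
    rcases le_total 0 (M.runningCost x K u t) with h | h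
    · rw [abs_of_nonneg h, ENNReal.ofReal_of_nonpos (neg_nonpos.2 h), add_zero]
    · rw [abs_of_nonpos h, ENNReal.ofReal_of_nonpos h, zero_add]
  unfold HasFiniteIntegral
  simp_rw [h3]
  rw [lintegral_add_left' h.runningCost_aemeasurable.ennreal_ofReal]
  exact ENNReal.add_lt_top.2 ⟨h1.lt_top, h2.lt_top⟩

lemma capitalCost_ge (hM : M.Standing) (h1 : M.capitalCost μ ≠ ⊤) {T : ℝ} :
    M.r * ∫ t in Icc 0 T, Real.exp (-M.δ * t) ∂μ ≤ (M.capitalCost μ).toReal := by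
  have hr := hM.r_pos
  have e : M.r * ∫ t in Icc 0 T, Real.exp (-M.δ * t) ∂μ =
      ∫ t in Icc 0 T, Real.exp (-M.δ * t) * M.r ∂μ := by
    rw [integral_mul_const, mul_comm]
  rw [e, integral_eq_lintegral_of_nonneg_ae
    (Eventually.of_forall fun t => mul_nonneg (Real.exp_pos _).le hr.le)
    (by fun_prop)]
  exact ENNReal.toReal_mono h1 (lintegral_mono_set fun t ht => ht.1)

/-- An admissible process that starts in `x^*` and costs no more than keeping the stock there
forever keeps the stock there and uses all of its capital. -/
theorem eq_of_cost_le (hM : M.Standing) (h : M.IsAdmissible M.xStar K₀ x K u μ)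
    (hc : M.cost x K u μ ≤ ((-M.r * K₀ + M.HStar M.xStar / M.δ : ℝ) : EReal)) :
    ∀ t, 0 ≤ t → x t = M.xStar ∧ K t = M.KStar := by
  have hx₀ := hM.V4_xStar
  have hδ := hM.δ_pos
  obtain ⟨hA, hP⟩ := h.expenses_ne_top_of_cost hM hx₀
    (ne_top_of_le_ne_top (EReal.coe_ne_top _) hc)
  have hN : M.profits x K u ≠ ⊤ := (h.lintegral_neg_lt_top hM hx₀).ne
  have hint := h.runningCost_integrable hP hN
  have hJ : ∫ t in Ioi 0, M.runningCost x K u t =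
      (M.expenses x K u).toReal - (M.profits x K u).toReal := by
    rw [← integral_Ici_eq_integral_Ioi]
    exact integral_eq_lintegral_pos_part_sub_lintegral_neg_part hint
  rw [cost_eq, EReal.coe_ennreal_add_sub hA hP hN, EReal.coe_le_coe_iff, ← hJ] at hc
  -- The excess over the steady state: idle capital charged at `r'`, plus the excess of `H`. Both
  -- parts are nonnegative.
  set e : ℝ → ℝ := fun t => Real.exp (-M.δ * t) *
    (M.r' * (K t - u t * K t) + (M.HStar (x t) - M.HStar M.xStar)) with he
  set B := M.cStar * (M.xbar / M.xStar) + M.p * M.xStar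
  have hG0 : M.GStar M.xStar = 0 := by simp [GStar, div_self hM.xStar_pos.ne']
  -- Among the end terms, `r e^{-δT} K(T) ≥ 0` is dropped and `G(x(T))` is replaced by its bound
  -- `B`, which disappears in the limit.
  have heint : ∀ T, 0 ≤ T → IntervalIntegrable e volume 0 T ∧
      (∫ t in (0 : ℝ)..T, e t) ≤ (M.capitalCost μ).toReal +
        (∫ t in (0 : ℝ)..T, M.runningCost x K u t) + M.r * K₀ -
        M.HStar M.xStar / M.δ * (1 - Real.exp (-M.δ * T)) + Real.exp (-M.δ * T) * B := by
    intro T hT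
    obtain ⟨i1, e1⟩ := h.runningCost_integral hM hx₀ hT
    have i2 : IntervalIntegrable (fun t => M.κ * (Real.exp (-M.δ * t) * K t)) volume 0 T :=
      ((h.K_int T hT).continuousOn_mul (by fun_prop)).const_mul _
    have hexp := (ACDeriv.exp hT (-M.δ)).const_mul (M.HStar M.xStar / M.δ)
    have i3 := ((i2.const_mul M.r).add i1).add hexp.intervalIntegrable
    have hptw : ∀ t, e t = (M.r * (M.κ * (Real.exp (-M.δ * t) * K t)) +
        Real.exp (-M.δ * t) * (M.HStar (x t) - M.r' * (u t * K t))) +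
        M.HStar M.xStar / M.δ * (-M.δ * Real.exp (-M.δ * t)) := by
      intro t
      simp only [he, r']
      field_simp
      ring
    refine ⟨i3.congr fun t _ => (hptw t).symm, ?_⟩
    simp_rw [hptw]
    rw [intervalIntegral.integral_add ((i2.const_mul M.r).add i1) hexp.intervalIntegrable,
      intervalIntegral.integral_add (i2.const_mul M.r) i1, hexp.integral_eq,
      intervalIntegral.integral_const_mul]
    have h3 := capitalCost_ge (μ := μ) hM hA (T := T)
    rw [h.capitalCost_eq hT] at h3
    have h4 := hM.GStar_le (h.x_mem hM hx₀ hT)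
    have h5 : 0 ≤ M.r * (Real.exp (-M.δ * T) * K T) :=
      mul_nonneg hM.r_pos.le (mul_nonneg (Real.exp_pos _).le (h.K_nonneg T hT))
    have h6 := mul_le_mul_of_nonneg_left h4 (Real.exp_pos (-M.δ * T)).le
    rw [hG0] at e1
    simp only [mul_zero, Real.exp_zero]
    simp only [B]
    linarith
  have hnonneg : ∀ᵐ t : ℝ, 0 ≤ t → 0 ≤ e t ∧ (e t = 0 → x t = M.xStar ∧ u t * K t = K t) := by
    filter_upwards [h.v_le] with t hv ht
    have hx := h.x_mem hM hx₀ ht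
    have h1 : 0 ≤ M.r' * (K t - u t * K t) :=
      mul_nonneg hM.r'_pos.le (sub_nonneg.2 (hv ht))
    have h2 := sub_nonneg.2 (hM.HStar_le hx)
    refine ⟨mul_nonneg (Real.exp_pos _).le (add_nonneg h1 h2), fun h0 => ?_⟩
    have h3 := (mul_eq_zero.1 h0).resolve_left (Real.exp_pos _).ne'
    constructor
    · by_contra hne
      have := hM.HStar_lt hx hne
      linarith
    · have h4 : M.r' * (K t - u t * K t) = 0 := by linarith
      have := (mul_eq_zero.1 h4).resolve_left hM.r'_pos.ne'
      linarith
  -- As `e ≥ 0`, the integral up to `T` is at most those up to larger `n`, whose bounds tend to the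
  -- cost plus `r K₀ - H(x^*)/δ`, nonpositive by `hc`.
  have hzero : ∀ T, 0 ≤ T → ∫ t in (0 : ℝ)..T, e t ≤ 0 := by
    intro T hT
    have hexp : Tendsto (fun n : ℕ => Real.exp (-M.δ * n)) atTop (𝓝 0) := by
      refine Real.tendsto_exp_atBot.comp ?_
      exact tendsto_natCast_atTop_atTop.const_mul_atTop_of_neg (neg_lt_zero.2 hδ)
    have hrc := intervalIntegral_tendsto_integral_Ioi 0
      (hint.mono_set Ioi_subset_Ici_self) (tendsto_natCast_atTop_atTop (R := ℝ))
    have hlim := ((((hrc.const_add (M.capitalCost μ).toReal).add_const (M.r * K₀)).sub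
      ((hexp.const_sub 1).const_mul (M.HStar M.xStar / M.δ))).add (hexp.mul_const B))
    have hle := ge_of_tendsto hlim (b := ∫ t in (0 : ℝ)..T, e t) (by
      filter_upwards [eventually_ge_atTop ⌈T⌉₊] with n hn
      have hTn : T ≤ n := (Nat.le_ceil T).trans (Nat.cast_le.2 hn)
      obtain ⟨i1, e1⟩ := heint n (hT.trans hTn)
      refine le_trans ?_ e1
      refine intervalIntegral.integral_mono_interval le_rfl hT hTn ?_ i1
      refine (ae_restrict_iff' measurableSet_Ioc).2 ?_
      filter_upwards [hnonneg] with t ht ht'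
      exact (ht ht'.1.le).1)
    refine hle.trans ?_
    simp only [sub_zero, mul_one, zero_mul, add_zero]
    linarith
  have hae : ∀ T, 0 < T → ∀ᵐ t, t ∈ Ioo 0 T → x t = M.xStar ∧ u t * K t = K t := by
    intro T hT
    obtain ⟨i1, -⟩ := heint T hT.le
    have hE : ACDeriv (fun t => -∫ s in (0 : ℝ)..t, e s) (fun t => -e t) 0 T :=
      ACDeriv.of_integral hT.le i1.neg (k := 0) fun t _ => by simp
    have := hE.ae_eq_zero_of_nonpos (by
      filter_upwards [hnonneg] with t h1 ht
      have := (h1 ht.1.le).1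
      linarith) (by simpa using hzero T hT.le)
    filter_upwards [this, hnonneg] with t h1 h2 ht
    exact (h2 ht.1.le).2 (by simpa using h1 ht)
  have hx : ∀ t, 0 ≤ t → x t = M.xStar := by
    intro t ht
    have := ContinuousOn.eq_of_ae_eq_Ioo (f := x) (g := fun _ => M.xStar) (a := 0) (b := t + 1)
      (by linarith) (h.x_cont.mono fun s hs => hs.1) continuousOn_const
      (by filter_upwards [hae (t + 1) (by linarith)] with s h1 h2 using (h1 h2).1)
    exact this t ⟨ht, by linarith⟩
  -- A constant stock with all capital in use means `F(x^*) = K x^*` almost everywhere; right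
  -- continuity of `K` then removes the exceptional times.
  have hKae : ∀ T, 0 < T → ∀ᵐ t, t ∈ Ioo 0 T → K t = M.KStar := by
    intro T hT
    filter_upwards [hae T hT, (h.x_acDeriv hM le_rfl hT.le).deriv_ae] with t h1 h2 ht
    have h3 := h2 ht
    obtain ⟨h4, h5⟩ := h1 ht
    have h6 : HasDerivAt x 0 t := by
      refine (hasDerivAt_const t M.xStar).congr_of_eventuallyEq ?_
      filter_upwards [Ioo_mem_nhds ht.1 ht.2] with s hs using hx s hs.1.le
    have h7 := h3.unique h6
    rw [h4, h5] at h7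
    rw [KStar, eq_div_iff hM.xStar_pos.ne']
    linarith
  intro t ht
  refine ⟨hx t ht, ?_⟩
  -- right continuity of the capital stock
  have hright : Tendsto K (𝓝[>] t) (𝓝 (K t)) := by
    have h1 : Tendsto (fun s => (μ (Icc 0 s)).toReal) (𝓝[>] t) (𝓝 (μ (Icc 0 t)).toReal) := by
      refine (ENNReal.tendsto_toReal (h.μ_fin t).ne).comp ?_
      have h2 : Icc 0 t = ⋂ s > t, Icc 0 s := by
        ext q
        simp only [mem_iInter, mem_Icc]
        exact ⟨fun h s hs => ⟨h.1, h.2.trans (le_of_lt hs)⟩,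
          fun h => ⟨(h (t + 1) (by linarith)).1, le_of_forall_gt_imp_ge_of_dense
            fun s hs => (h s hs).2⟩⟩
      rw [h2]
      exact tendsto_measure_biInter_gt (fun s _ => measurableSet_Icc.nullMeasurableSet)
        (fun i j _ hij => Icc_subset_Icc le_rfl hij)
        ⟨t + 1, by linarith, (h.μ_fin (t + 1)).ne⟩
    have h3 : Tendsto (fun s => ∫ q in (0 : ℝ)..s, M.γ * K q) (𝓝[>] t)
        (𝓝 (∫ q in (0 : ℝ)..t, M.γ * K q)) := by
      have h4 : ContinuousOn (fun s => ∫ q in (0 : ℝ)..s, M.γ * K q) (Icc 0 (t + 1)) := by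
        have := intervalIntegral.continuousOn_primitive_interval'
          ((h.K_int (t + 1) (by linarith)).const_mul M.γ) left_mem_uIcc
        rwa [uIcc_of_le (by linarith)] at this
      refine (h4 t ⟨ht, by linarith⟩).mono_left ?_
      refine nhdsWithin_le_of_mem ?_
      filter_upwards [Ioo_mem_nhdsGT (show t < t + 1 by linarith)] with s hs
      exact ⟨ht.trans hs.1.le, hs.2.le⟩
    have h5 := (h3.const_sub K₀).add h1
    rw [← h.K_eq t ht] at h5
    refine h5.congr' ?_
    filter_upwards [self_mem_nhdsWithin] with s hs
    exact (h.K_eq s (ht.trans (le_of_lt hs))).symm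
  by_contra hne
  have hev := hright.eventually (isOpen_ne.mem_nhds hne)
  rw [eventually_nhdsWithin_iff, Metric.eventually_nhds_iff] at hev
  obtain ⟨ε, hε, hev⟩ := hev
  have hbad : ∀ᵐ s : ℝ, s ∉ Ioo t (t + ε) := by
    filter_upwards [hKae (t + ε) (by linarith)] with s h1 h2
    refine hev ?_ h2.1 (h1 ⟨ht.trans_lt h2.1, h2.2⟩)
    rw [Real.dist_eq, abs_of_pos (sub_pos.2 h2.1)]
    linarith [h2.2]
  rw [ae_iff] at hbad
  simp only [not_not] at hbad
  have h3 : volume (Ioo t (t + ε)) = 0 := hbad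
  rw [Real.volume_Ioo] at h3
  simp at h3
  linarith

end IsAdmissible
end Fishery

/-! ### Holding the stock at `x^*`, and optimal processes starting there -/

namespace Fishery
variable {M : Fishery}

lemma Standing.lintegral_exp (hM : M.Standing) {k : ℝ} (hk : 0 ≤ k) :
    ∫⁻ t in Ici (0 : ℝ), ENNReal.ofReal (Real.exp (-M.δ * t) * k) = ENNReal.ofReal (k / M.δ) := by
  have hδ := hM.δ_pos
  rw [← restrict_Ioi_eq_restrict_Ici, ← ofReal_integral_eq_lintegral_ofReal
    ((integrableOn_exp_mul_Ioi (neg_lt_zero.2 hδ) 0).mul_const k)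
    (Eventually.of_forall fun t => mul_nonneg (Real.exp_pos _).le hk),
    integral_mul_const, integral_exp_mul_Ioi (neg_lt_zero.2 hδ) 0]
  congr 1
  simp
  field_simp

/-- The capital stock that decays until time `θ` and is kept at the level `K^*` afterwards. -/
def holdCapital (M : Fishery) (K₀ θ t : ℝ) : ℝ :=
  if t < θ then K₀ * Real.exp (-M.γ * t) else M.KStar

/-- The investment that fills the capital stock up to `K^*` at time `0` and replaces
depreciation from time `θ` on. -/
def holdInvestment (M : Fishery) (K₀ θ : ℝ) : Measure ℝ :=
  ENNReal.ofReal (M.KStar - K₀) • Measure.dirac 0 +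
    ENNReal.ofReal (M.γ * M.KStar) • volume.restrict (Ici θ)

/-- The time `θ` at which the decaying capital stock falls to `K^*`, zero if it starts below. -/
def IsHoldTime (M : Fishery) (K₀ θ : ℝ) : Prop :=
  0 ≤ θ ∧ (K₀ ≤ M.KStar ∧ θ = 0 ∨ M.KStar ≤ K₀ ∧ K₀ * Real.exp (-M.γ * θ) = M.KStar)

lemma Standing.exists_isHoldTime (hM : M.Standing) (K₀ : ℝ) : ∃ θ, M.IsHoldTime K₀ θ := by
  rcases le_total K₀ M.KStar with h | h
  · exact ⟨0, le_rfl, Or.inl ⟨h, rfl⟩⟩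
  · have hK := hM.KStar_pos
    have hγ := hM.γ_pos
    have hK₀ := hK.trans_le h
    refine ⟨Real.log (K₀ / M.KStar) / M.γ,
      div_nonneg (Real.log_nonneg ((one_le_div hK).2 h)) hγ.le, Or.inr ⟨h, ?_⟩⟩
    rw [show -M.γ * (Real.log (K₀ / M.KStar) / M.γ) = -Real.log (K₀ / M.KStar) by field_simp,
      Real.exp_neg, Real.exp_log (div_pos hK₀ hK)]
    field_simp

/-- This keeps the effort `K^* / K`, which produces the catch rate `K^*`, in `[0, 1]`. -/
lemma holdCapital_ge (hM : M.Standing) {K₀ θ t : ℝ} (hθ : M.IsHoldTime K₀ θ) (ht : 0 ≤ t) :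
    M.KStar ≤ M.holdCapital K₀ θ t := by
  unfold holdCapital
  split_ifs with h
  · rcases hθ.2 with h1 | h1
    · linarith [h1.2]
    · rw [← h1.2]
      have : Real.exp (-M.γ * θ) ≤ Real.exp (-M.γ * t) := by
        apply Real.exp_le_exp.2
        nlinarith [hM.γ_pos]
      exact mul_le_mul_of_nonneg_left this (hM.KStar_pos.le.trans h1.1)
  · exact le_rfl

lemma holdInvestment_Icc (hM : M.Standing) {K₀ θ t : ℝ} (hθ : 0 ≤ θ) (ht : 0 ≤ t) :
    M.holdInvestment K₀ θ (Icc 0 t) = ENNReal.ofReal (M.KStar - K₀) +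
      ENNReal.ofReal (M.γ * M.KStar * (t - θ)) := by
  have h1 : Icc 0 t ∩ Ici θ = Icc θ t := by
    ext s
    simp only [mem_inter_iff, mem_Icc, mem_Ici]
    exact ⟨fun h => ⟨h.2, h.1.2⟩, fun h => ⟨⟨hθ.trans h.1, h.2⟩, h.1⟩⟩
  simp only [holdInvestment, Measure.add_apply, Measure.smul_apply, smul_eq_mul,
    Measure.restrict_apply measurableSet_Icc, h1, Real.volume_Icc]
  rw [Measure.dirac_apply_of_mem (show (0 : ℝ) ∈ Icc 0 t from ⟨le_rfl, ht⟩), mul_one,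
    ENNReal.ofReal_mul (mul_pos hM.γ_pos hM.KStar_pos).le]

lemma holdCapital_integral (hM : M.Standing) {K₀ θ t : ℝ} (hθ : M.IsHoldTime K₀ θ) (ht : 0 ≤ t) :
    IntervalIntegrable (M.holdCapital K₀ θ) volume 0 t ∧
    ∫ s in (0 : ℝ)..t, M.γ * M.holdCapital K₀ θ s =
      K₀ - M.holdCapital K₀ θ t + max (M.KStar - K₀) 0 + max (M.γ * M.KStar * (t - θ)) 0 := by
  have hγK := mul_pos hM.γ_pos hM.KStar_pos
  have hdecay : ∀ b, 0 ≤ b → b ≤ θ →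
      IntervalIntegrable (M.holdCapital K₀ θ) volume 0 b ∧
      ∫ s in (0 : ℝ)..b, M.γ * M.holdCapital K₀ θ s = K₀ - K₀ * Real.exp (-M.γ * b) := by
    intro b hb hbθ
    have hac := ((ACDeriv.exp hb (-M.γ)).const_mul (-K₀))
    have hae : ∀ᵐ s : ℝ, s ∈ uIoc 0 b → M.γ * M.holdCapital K₀ θ s =
        -K₀ * (-M.γ * Real.exp (-M.γ * s)) := by
      have h3 : ∀ᵐ s : ℝ, s ≠ b := by simp [ae_iff, measure_singleton]
      filter_upwards [h3] with s hs hs'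
      rw [uIoc_of_le hb] at hs'
      have : s < θ := (lt_of_le_of_ne hs'.2 hs).trans_le hbθ
      simp only [holdCapital, if_pos this]; ring
    have hi : IntervalIntegrable (fun s => M.γ * M.holdCapital K₀ θ s) volume 0 b :=
      hac.intervalIntegrable.congr_ae
        ((ae_restrict_iff' measurableSet_uIoc).2 (by
          filter_upwards [hae] with s h1 h2 using (h1 h2).symm))
    refine ⟨?_, ?_⟩
    · have := hi.const_mul M.γ⁻¹
      refine this.congr fun s _ => ?_
      have := hM.γ_pos.ne'
      field_simp
    · rw [intervalIntegral.integral_congr_ae hae, hac.integral_eq]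
      simp
      ring
  rcases lt_or_ge t θ with h | h
  · obtain ⟨i1, e1⟩ := hdecay t ht h.le
    refine ⟨i1, ?_⟩
    have h2 : K₀ ≥ M.KStar := by
      rcases hθ.2 with h1 | h1
      · linarith [h1.2]
      · exact h1.1
    rw [e1, max_eq_right (by linarith), max_eq_right (by nlinarith)]
    simp only [holdCapital, if_pos h]; ring
  · obtain ⟨i1, e1⟩ := hdecay θ hθ.1 le_rfl
    have hc : ∀ s ∈ uIcc θ t, M.holdCapital K₀ θ s = M.KStar := by
      intro s hs
      rw [uIcc_of_le h] at hs
      simp only [holdCapital, if_neg (not_lt.2 hs.1)]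
    have i2 : IntervalIntegrable (M.holdCapital K₀ θ) volume θ t := by
      refine (intervalIntegrable_const (c := M.KStar)).congr fun s hs => ?_
      exact (hc s (uIoc_subset_uIcc hs)).symm
    have e2 : ∫ s in θ..t, M.γ * M.holdCapital K₀ θ s = M.γ * M.KStar * (t - θ) := by
      rw [intervalIntegral.integral_congr (g := fun _ => M.γ * M.KStar)
        fun s hs => by simp only [hc s hs]]
      simp
      ring
    refine ⟨i1.trans i2, ?_⟩
    rw [← intervalIntegral.integral_add_adjacent_intervals (i1.const_mul _) (i2.const_mul _),
      e1, e2, hc t right_mem_uIcc, max_eq_left (mul_nonneg hγK.le (sub_nonneg.2 h))]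
    rcases hθ.2 with h1 | h1
    · rw [max_eq_left (by linarith [h1.1]), h1.2]; simp
    · rw [max_eq_right (by linarith [h1.1]), h1.2]; ring

lemma hold_isAdmissible (hM : M.Standing) {K₀ θ : ℝ} (hθ : M.IsHoldTime K₀ θ) :
    M.IsAdmissible M.xStar K₀ (fun _ => M.xStar) (M.holdCapital K₀ θ)
      (fun t => M.KStar / M.holdCapital K₀ θ t) (M.holdInvestment K₀ θ) where
  u_meas := by
    have : Measurable (M.holdCapital K₀ θ) :=
      Measurable.ite measurableSet_Iio (by fun_prop) (by fun_prop)
    exact (this.const_div _).aemeasurable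
  u_mem := by
    refine (ae_restrict_iff' measurableSet_Ici).2 (Eventually.of_forall fun t ht => ?_)
    have h1 := holdCapital_ge hM hθ ht
    have h2 := hM.KStar_pos
    exact ⟨div_nonneg h2.le (h2.trans_le h1).le, (div_le_one (h2.trans_le h1)).2 h1⟩
  μ_supp := by
    have h1 : Iio (0 : ℝ) ∩ Ici θ = ∅ := by
      ext s
      simp only [mem_inter_iff, mem_Iio, mem_Ici, mem_empty_iff_false, iff_false, not_and, not_le]
      exact fun h => h.trans_le hθ.1
    simp [holdInvestment, Measure.restrict_apply measurableSet_Iio, h1]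
  μ_fin t := by
    rcases lt_or_ge t 0 with h | h
    · simp [Icc_eq_empty (not_le.2 h)]
    · rw [holdInvestment_Icc hM hθ.1 h]
      exact ENNReal.add_lt_top.2 ⟨ENNReal.ofReal_lt_top, ENNReal.ofReal_lt_top⟩
  K_int t ht := (holdCapital_integral hM hθ ht).1
  K_eq t ht := by
    rw [(holdCapital_integral hM hθ ht).2, holdInvestment_Icc hM hθ.1 ht,
      ENNReal.toReal_add ENNReal.ofReal_ne_top ENNReal.ofReal_ne_top, ENNReal.toReal_ofReal',
      ENNReal.toReal_ofReal']
    ring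
  x_cont := continuousOn_const
  x_eq t ht := by
    have h1 : ∫ s in (0 : ℝ)..t, (M.F M.xStar - M.KStar / M.holdCapital K₀ θ s *
        M.holdCapital K₀ θ s * M.xStar) = ∫ s in (0 : ℝ)..t, (0 : ℝ) := by
      refine intervalIntegral.integral_congr fun s hs => ?_
      rw [uIcc_of_le ht] at hs
      have h2 := (hM.KStar_pos.trans_le (holdCapital_ge hM hθ hs.1)).ne'
      have h3 := hM.xStar_pos.ne'
      simp only [div_mul_cancel₀ _ h2, KStar]
      field_simp
      ring
    simp only [h1, intervalIntegral.integral_zero, add_zero]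
  x_nonneg _ _ := hM.xStar_pos.le
  K_nonneg t ht := hM.KStar_pos.le.trans (holdCapital_ge hM hθ ht)

/-- Replacement investment is charged from time `0` instead of `θ`. The bound is exact when `K₀ ≤
K^*`; above `K^*` only the sign of the bound is used. -/
lemma hold_cost_le (hM : M.Standing) {K₀ θ : ℝ} (hθ : M.IsHoldTime K₀ θ) :
    M.cost (fun _ => M.xStar) (M.holdCapital K₀ θ) (fun t => M.KStar / M.holdCapital K₀ θ t)
      (M.holdInvestment K₀ θ) ≤
    ((max (M.KStar - K₀) 0 * M.r + M.KStar * (M.γ * M.r + M.c - M.p * M.xStar) / M.δ : ℝ) :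
      EReal) := by
  have hK := hM.KStar_pos
  have hr := hM.r_pos
  have hδ := hM.δ_pos
  have hγ := hM.γ_pos
  have hc : 0 < M.p * M.xStar - M.c := by
    have h1 := hM.cStar_lt
    have h2 := hM.r'_pos
    simp only [cStar] at h1
    linarith
  have hA : M.capitalCost (M.holdInvestment K₀ θ) ≤
      ENNReal.ofReal (max (M.KStar - K₀) 0 * M.r + M.γ * M.KStar * (M.r / M.δ)) := by
    unfold capitalCost
    refine (setLIntegral_le_lintegral _ _).trans ?_
    rw [holdInvestment, lintegral_add_measure, lintegral_smul_measure, lintegral_smul_measure,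
      lintegral_dirac' _ (by fun_prop), ENNReal.ofReal_add (by positivity) (by positivity),
      ENNReal.ofReal_mul (p := max (M.KStar - K₀) 0) (by positivity),
      ENNReal.ofReal_mul (p := M.γ * M.KStar) (by positivity), smul_eq_mul, smul_eq_mul, mul_zero,
      Real.exp_zero, one_mul]
    refine add_le_add (le_of_eq ?_) (mul_le_mul_right ?_ _)
    · congr 1
      rcases le_total (M.KStar - K₀) 0 with h | h
      · rw [ENNReal.ofReal_of_nonpos h, max_eq_right h, ENNReal.ofReal_zero]
      · rw [max_eq_left h]
    · rw [← hM.lintegral_exp hr.le]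
      exact lintegral_mono_set fun t ht => hθ.1.trans ht
  have hrc : ∀ t ∈ Ici (0 : ℝ), M.runningCost (fun _ => M.xStar) (M.holdCapital K₀ θ)
      (fun t => M.KStar / M.holdCapital K₀ θ t) t =
      -(Real.exp (-M.δ * t) * ((M.p * M.xStar - M.c) * M.KStar)) := by
    intro t ht
    have h2 := (hK.trans_le (holdCapital_ge hM hθ ht)).ne'
    simp only [runningCost, div_mul_cancel₀ _ h2]
    ring
  have hP : M.expenses (fun _ => M.xStar) (M.holdCapital K₀ θ)
      (fun t => M.KStar / M.holdCapital K₀ θ t) = 0 := by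
    unfold expenses
    rw [setLIntegral_congr_fun (g := fun _ => 0) measurableSet_Ici fun t ht => ?_]
    · simp
    · rw [hrc t ht]
      exact ENNReal.ofReal_of_nonpos (neg_nonpos.2
        (mul_nonneg (Real.exp_pos _).le (mul_nonneg hc.le hK.le)))
  have hN : M.profits (fun _ => M.xStar) (M.holdCapital K₀ θ)
      (fun t => M.KStar / M.holdCapital K₀ θ t) =
      ENNReal.ofReal ((M.p * M.xStar - M.c) * M.KStar / M.δ) := by
    unfold profits
    rw [← hM.lintegral_exp (mul_nonneg hc.le hK.le)]
    refine setLIntegral_congr_fun measurableSet_Ici fun t ht => ?_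
    simp only [hrc t ht, neg_neg]
  rw [cost_eq, hP, hN, EReal.coe_ennreal_add_sub (ne_top_of_le_ne_top ENNReal.ofReal_ne_top hA)
    ENNReal.zero_ne_top ENNReal.ofReal_ne_top, EReal.coe_le_coe_iff]
  have h1 := ENNReal.toReal_mono ENNReal.ofReal_ne_top hA
  rw [ENNReal.toReal_ofReal (by positivity)] at h1
  rw [ENNReal.toReal_ofReal (div_nonneg (mul_nonneg hc.le hK.le) hδ.le), ENNReal.toReal_zero]
  refine (add_le_add_left h1 _).trans (le_of_eq ?_)
  field_simp
  ring

namespace IsOptimal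
variable {K₀ : ℝ} {x K u z lam : ℝ → ℝ} {μ : Measure ℝ}

/-- An optimal process that starts in `x^*` with capital below `K^*` stays in `(x^*, K^*)`. -/
theorem eq_xStar (hM : M.Standing) (h : M.IsOptimal M.xStar K₀ x K u μ) (hK₀ : K₀ ≤ M.KStar) :
    ∀ t, 0 ≤ t → x t = M.xStar ∧ K t = M.KStar := by
  obtain ⟨θ, hθ⟩ := hM.exists_isHoldTime K₀
  refine h.1.eq_of_cost_le hM ((h.2 _ _ _ _ (hold_isAdmissible hM hθ)).trans
    ((hold_cost_le hM hθ).trans (le_of_eq ?_)))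
  rw [max_eq_left (sub_nonneg.2 hK₀), hM.HStar_xStar]
  congr 1
  have := hM.δ_pos.ne'
  simp only [cStar, r', κ]
  field_simp
  ring

lemma u_eq_one (hM : M.Standing) (h : M.IsOptimal M.xStar K₀ x K u μ) (hK₀ : K₀ ≤ M.KStar) :
    ∀ᵐ t : ℝ, 0 < t → u t = 1 := by
  have hx := h.eq_xStar hM hK₀
  have hn : ∀ n : ℕ, ∀ᵐ t : ℝ, t ∈ Ioo (0 : ℝ) n → u t = 1 := by
    intro n
    filter_upwards [(h.1.x_acDeriv hM le_rfl (Nat.cast_nonneg n)).deriv_ae] with t h1 ht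
    have h6 : HasDerivAt x 0 t := by
      refine (hasDerivAt_const t M.xStar).congr_of_eventuallyEq ?_
      filter_upwards [Ioo_mem_nhds ht.1 ht.2] with s hs using (hx s hs.1.le).1
    have h7 := (h1 ht).unique h6
    obtain ⟨e1, e2⟩ := hx t ht.1.le
    have hK := hM.KStar_pos
    have h8 : M.F M.xStar = M.KStar * M.xStar := by
      rw [KStar, div_mul_cancel₀ _ hM.xStar_pos.ne']
    rw [e1, e2, h8] at h7
    have h9 : (1 - u t) * (M.KStar * M.xStar) = 0 := by linarith
    have := (mul_eq_zero.1 h9).resolve_right (mul_pos hK hM.xStar_pos).ne'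
    linarith
  filter_upwards [ae_all_iff.2 hn] with t h1 ht
  obtain ⟨n, hn⟩ := exists_nat_gt t
  exact h1 n ⟨ht, hn⟩

lemma measure_Icc (hM : M.Standing) (h : M.IsOptimal M.xStar K₀ x K u μ) (hK₀ : K₀ ≤ M.KStar)
    {t : ℝ} (ht : 0 ≤ t) :
    μ (Icc 0 t) = ENNReal.ofReal (M.KStar - K₀) + ENNReal.ofReal (M.γ * M.KStar * t) := by
  have hx := h.eq_xStar hM hK₀
  have h1 := h.1.K_eq t ht
  have h2 : ∫ s in (0 : ℝ)..t, M.γ * K s = M.γ * M.KStar * t := by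
    rw [intervalIntegral.integral_congr (g := fun _ => M.γ * M.KStar) fun s hs => ?_]
    · simp; ring
    · rw [uIcc_of_le ht] at hs
      simp only [(hx s hs.1).2]
  rw [(hx t ht).2, h2] at h1
  have hγK := mul_pos hM.γ_pos hM.KStar_pos
  rw [← ENNReal.ofReal_toReal (h.1.μ_fin t).ne, ← ENNReal.ofReal_add (sub_nonneg.2 hK₀)
    (mul_nonneg hγK.le ht)]
  congr 1
  linarith

/-- With `K ≡ K^*` the capital equation prescribes `μ([0, t])` for all `t`, and these values
determine `μ`. -/
lemma measure_eq (hM : M.Standing) (h : M.IsOptimal M.xStar K₀ x K u μ) (hK₀ : K₀ ≤ M.KStar) :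
    μ = ENNReal.ofReal (M.KStar - K₀) • Measure.dirac 0 +
      ENNReal.ofReal (M.γ * M.KStar) • volume.restrict (Ici 0) := by
  have hadm := hold_isAdmissible hM (K₀ := K₀) (θ := 0) ⟨le_rfl, Or.inl ⟨hK₀, rfl⟩⟩
  change μ = M.holdInvestment K₀ 0
  have hIic : ∀ t, μ (Iic t) = M.holdInvestment K₀ 0 (Iic t) ∧ μ (Iic t) < ⊤ := by
    intro t
    rcases lt_or_ge t 0 with ht | ht
    · have e1 : μ (Iic t) = 0 := measure_mono_null (Iic_subset_Iio.2 ht) h.1.μ_supp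
      have e2 : M.holdInvestment K₀ 0 (Iic t) = 0 :=
        measure_mono_null (Iic_subset_Iio.2 ht) hadm.μ_supp
      rw [e1, e2]
      exact ⟨rfl, ENNReal.zero_lt_top⟩
    · have hsplit : Iic t = Iio 0 ∪ Icc 0 t := by
        ext s
        simp only [mem_Iic, mem_union, mem_Iio, mem_Icc]
        constructor
        · intro hs
          rcases lt_or_ge s 0 with h | h
          · exact Or.inl h
          · exact Or.inr ⟨h, hs⟩
        · rintro (h | h)
          · exact h.le.trans ht
          · exact h.2
      have hdisj : Disjoint (Iio (0 : ℝ)) (Icc 0 t) :=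
        Set.disjoint_left.2 fun s h1 h2 => absurd h1 (not_lt.2 h2.1)
      rw [hsplit, measure_union hdisj measurableSet_Icc, measure_union hdisj measurableSet_Icc,
        h.1.μ_supp, hadm.μ_supp, h.measure_Icc hM hK₀ ht, holdInvestment_Icc hM le_rfl ht,
        sub_zero]
      exact ⟨rfl, by simp⟩
  have hIoc : ∀ a b : ℝ, Ioc a b = Iic b \ Iic a := fun a b => by
    ext s; simp only [mem_Ioc, Set.mem_sdiff, mem_Iic, not_le]; exact and_comm
  refine Measure.ext_of_Ioc' μ _ (fun a b _ => ?_) fun a b hab => ?_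
  · rw [hIoc]
    exact ne_top_of_le_ne_top (hIic b).2.ne (measure_mono sdiff_subset)
  · rw [hIoc, measure_sdiff (Iic_subset_Iic.2 hab.le) measurableSet_Iic.nullMeasurableSet
      (hIic a).2.ne, measure_sdiff (Iic_subset_Iic.2 hab.le) measurableSet_Iic.nullMeasurableSet
      (by rw [← (hIic a).1]; exact (hIic a).2.ne), (hIic a).1, (hIic b).1]

/-- `μ` contains a positive multiple of Lebesgue measure, so `λ = r` almost everywhere and, by
continuity, everywhere. The equation for `λ` with `λ' = 0` and `u = 1` then leaves `z = r'`. -/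
lemma adjoint_eq (hM : M.Standing) (h : M.IsOptimal M.xStar K₀ x K u μ) (hK₀ : K₀ ≤ M.KStar)
    (hadj : M.IsAdjoint x K u μ z lam) : z 0 = M.r' ∧ ∀ t, 0 ≤ t → lam t = M.r := by
  have hγK := mul_pos hM.γ_pos hM.KStar_pos
  have hae : ∀ᵐ t : ℝ, 0 ≤ t → lam t = M.r := by
    have h1 := hadj.lam_eq_r
    rw [h.measure_eq hM hK₀, ae_add_measure_iff] at h1
    have h2 := h1.2
    rw [Measure.ae_ennreal_smul_measure_eq (by simpa using hγK)] at h2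
    exact (ae_restrict_iff' measurableSet_Ici).1 h2
  have hlam : ∀ t, 0 ≤ t → lam t = M.r := by
    intro t ht
    have := ContinuousOn.eq_of_ae_eq_Ioo (f := lam) (g := fun _ => M.r) (a := 0) (b := t + 1)
      (by linarith) (hadj.lam_cont.mono fun s hs => hs.1) continuousOn_const
      (by filter_upwards [hae] with s h1 h2 using h1 h2.1.le)
    exact this t ⟨ht, by linarith⟩
  refine ⟨?_, hlam⟩
  have hi : IntervalIntegrable (fun s => M.r' - z s) volume 0 1 := by
    refine ContinuousOn.intervalIntegrable ?_
    rw [uIcc_of_le zero_le_one]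
    exact continuousOn_const.sub (hadj.z_cont.mono fun s hs => hs.1)
  have hac : ACDeriv lam (fun s => M.r' - z s) 0 1 := by
    refine ACDeriv.of_integral zero_le_one hi (k := lam 0) fun t ht => ?_
    rw [hadj.lam_eq t ht.1]
    congr 1
    refine intervalIntegral.integral_congr_ae ?_
    filter_upwards [h.u_eq_one hM hK₀] with s hs hs'
    rw [uIoc_of_le ht.1] at hs'
    rw [hs hs'.1, hlam s hs'.1.le]
    ring
  have := ContinuousOn.eq_of_ae_eq_Ioo (f := z) (g := fun _ => M.r') (a := 0) (b := 1)
    zero_lt_one (hadj.z_cont.mono fun s hs => hs.1) continuousOn_const (by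
      filter_upwards [hac.deriv_ae] with t h1 ht
      have h6 : HasDerivAt lam 0 t := by
        refine (hasDerivAt_const t M.r).congr_of_eventuallyEq ?_
        filter_upwards [Ioo_mem_nhds ht.1 ht.2] with s hs using hlam s hs.1.le
      have := (h1 ht).unique h6
      linarith)
  exact this 0 ⟨le_rfl, zero_le_one⟩

end IsOptimal
end Fishery


/-! ### Shifting and concatenating processes; dynamic programming -/

/-- The measure on `[τ, ∞)`, with the origin of time moved to `τ`. -/
def tailMeasure (μ : Measure ℝ) (τ : ℝ) : Measure ℝ := (μ.restrict (Ici τ)).map fun t => t - τ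

lemma tailMeasure_apply (μ : Measure ℝ) (τ : ℝ) {s : Set ℝ} (hs : MeasurableSet s) :
    tailMeasure μ τ s = μ ((fun t => t - τ) ⁻¹' s ∩ Ici τ) := by
  have hm : Measurable fun t : ℝ => t - τ := by fun_prop
  rw [tailMeasure, Measure.map_apply hm hs, Measure.restrict_apply (hm hs)]

lemma tailMeasure_Icc (μ : Measure ℝ) (τ t : ℝ) :
    tailMeasure μ τ (Icc 0 t) = μ (Icc τ (t + τ)) := by
  rw [tailMeasure_apply μ τ measurableSet_Icc]
  congr 1
  ext s
  simp only [mem_inter_iff, mem_preimage, mem_Icc, mem_Ici]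
  constructor
  · rintro ⟨⟨h1, h2⟩, h3⟩; exact ⟨h3, by linarith⟩
  · rintro ⟨h1, h2⟩; exact ⟨⟨by linarith, by linarith⟩, h1⟩

lemma measurePreserving_shift_Ici (τ : ℝ) :
    MeasurePreserving (fun t : ℝ => t + τ) (volume.restrict (Ici 0)) (volume.restrict (Ici τ)) := by
  have h := (measurePreserving_add_right (volume : Measure ℝ) τ).restrict_preimage
    (s := Ici τ) measurableSet_Ici
  have e : (fun t : ℝ => t + τ) ⁻¹' Ici τ = Ici 0 := by
    ext t; simp
  rwa [e] at h

lemma ae_shift {p : ℝ → Prop} {τ : ℝ} (hτ : 0 ≤ τ)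
    (h : ∀ᵐ t ∂(volume.restrict (Ici (0 : ℝ))), p t) :
    ∀ᵐ t ∂(volume.restrict (Ici (0 : ℝ))), p (t + τ) :=
  (measurePreserving_shift_Ici τ).quasiMeasurePreserving.ae
    (ae_mono (Measure.restrict_mono (Ici_subset_Ici.2 hτ) le_rfl) h)

namespace Fishery
variable {M : Fishery}

lemma capitalCost_split (μ : Measure ℝ) {τ : ℝ} (hτ : 0 ≤ τ) : M.capitalCost μ =
    (∫⁻ t in Ico 0 τ, ENNReal.ofReal (Real.exp (-M.δ * t) * M.r) ∂μ) +
      ENNReal.ofReal (Real.exp (-M.δ * τ)) * M.capitalCost (tailMeasure μ τ) := by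
  have h1 : M.capitalCost (tailMeasure μ τ) =
      ∫⁻ t in Ici τ, ENNReal.ofReal (Real.exp (-M.δ * (t - τ)) * M.r) ∂μ := by
    unfold capitalCost
    have hm : Measurable fun t : ℝ => t - τ := by fun_prop
    have e : (fun t => t - τ) ⁻¹' Ici (0 : ℝ) ∩ Ici τ = Ici τ := by
      ext s; simp
    rw [tailMeasure, Measure.restrict_map hm measurableSet_Ici,
      Measure.restrict_restrict (hm measurableSet_Ici), e, lintegral_map (by fun_prop) hm]
  rw [h1, ← lintegral_const_mul _ (by fun_prop)]
  have h2 : ∀ t, ENNReal.ofReal (Real.exp (-M.δ * τ)) *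
      ENNReal.ofReal (Real.exp (-M.δ * (t - τ)) * M.r) =
      ENNReal.ofReal (Real.exp (-M.δ * t) * M.r) := by
    intro t
    rw [← ENNReal.ofReal_mul (Real.exp_pos _).le, ← mul_assoc, ← Real.exp_add]
    congr 3
    ring
  simp_rw [h2]
  rw [capitalCost, ← Ico_union_Ici_eq_Ici hτ, lintegral_union measurableSet_Ici]
  exact Set.disjoint_left.2 fun s h1 h2 => absurd h1.2 (not_lt.2 h2)

lemma lintegral_runningCost_split (k : ℝ) (x K u : ℝ → ℝ) {τ : ℝ} (hτ : 0 ≤ τ) :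
    ∫⁻ t in Ici (0 : ℝ), ENNReal.ofReal (k * M.runningCost x K u t) =
    (∫⁻ t in Ico 0 τ, ENNReal.ofReal (k * M.runningCost x K u t)) +
      ENNReal.ofReal (Real.exp (-M.δ * τ)) * ∫⁻ t in Ici (0 : ℝ), ENNReal.ofReal
        (k * M.runningCost (fun t => x (t + τ)) (fun t => K (t + τ)) (fun t => u (t + τ)) t) := by
  have h1 : ∀ t, k * M.runningCost x K u (t + τ) = Real.exp (-M.δ * τ) *
      (k * M.runningCost (fun t => x (t + τ)) (fun t => K (t + τ)) (fun t => u (t + τ)) t) := by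
    intro t
    simp only [runningCost]
    rw [show -M.δ * (t + τ) = -M.δ * τ + -M.δ * t by ring, Real.exp_add]
    ring
  rw [← lintegral_const_mul' _ _ ENNReal.ofReal_ne_top]
  simp_rw [← ENNReal.ofReal_mul (Real.exp_pos (-M.δ * τ)).le, ← h1]
  have h2 := (measurePreserving_shift_Ici τ).lintegral_comp_emb
    (MeasurableEquiv.addRight τ).measurableEmbedding
    (fun t => ENNReal.ofReal (k * M.runningCost x K u t))
  rw [h2, ← Ico_union_Ici_eq_Ici hτ, lintegral_union measurableSet_Ici]
  exact Set.disjoint_left.2 fun s h1 h2 => absurd h1.2 (not_lt.2 h2)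

lemma expenses_split (x K u : ℝ → ℝ) {τ : ℝ} (hτ : 0 ≤ τ) : M.expenses x K u =
    (∫⁻ t in Ico 0 τ, ENNReal.ofReal (M.runningCost x K u t)) +
      ENNReal.ofReal (Real.exp (-M.δ * τ)) *
        M.expenses (fun t => x (t + τ)) (fun t => K (t + τ)) (fun t => u (t + τ)) := by
  simpa [expenses] using lintegral_runningCost_split (M := M) 1 x K u hτ

lemma profits_split (x K u : ℝ → ℝ) {τ : ℝ} (hτ : 0 ≤ τ) : M.profits x K u =
    (∫⁻ t in Ico 0 τ, ENNReal.ofReal (-M.runningCost x K u t)) +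
      ENNReal.ofReal (Real.exp (-M.δ * τ)) *
        M.profits (fun t => x (t + τ)) (fun t => K (t + τ)) (fun t => u (t + τ)) := by
  simpa [profits] using lintegral_runningCost_split (M := M) (-1) x K u hτ

/-- The function that agrees with `f` before `τ` and continues with `f₁` from `τ` on. -/
def concat (τ : ℝ) (f f₁ : ℝ → ℝ) (t : ℝ) : ℝ := if t < τ then f t else f₁ (t - τ)

lemma concat_of_lt {τ t : ℝ} (f f₁ : ℝ → ℝ) (h : t < τ) : concat τ f f₁ t = f t := if_pos h

lemma concat_of_le {τ t : ℝ} (f f₁ : ℝ → ℝ) (h : τ ≤ t) : concat τ f f₁ t = f₁ (t - τ) :=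
  if_neg (not_lt.2 h)

lemma concat_add {τ t : ℝ} (f f₁ : ℝ → ℝ) (h : 0 ≤ t) : concat τ f f₁ (t + τ) = f₁ t := by
  rw [concat_of_le f f₁ (by linarith), add_sub_cancel_right]

/-- The measure that agrees with `μ` before `τ` and continues with `μ₁` from `τ` on. -/
def concatMeasure (τ : ℝ) (μ μ₁ : Measure ℝ) : Measure ℝ :=
  μ.restrict (Iio τ) + μ₁.map fun t => t + τ

lemma concatMeasure_apply (τ : ℝ) (μ μ₁ : Measure ℝ) {s : Set ℝ} (hs : MeasurableSet s) :
    concatMeasure τ μ μ₁ s = μ (s ∩ Iio τ) + μ₁ ((fun t => t + τ) ⁻¹' s) := by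
  have hm : Measurable fun t : ℝ => t + τ := by fun_prop
  rw [concatMeasure, Measure.add_apply, Measure.restrict_apply hs, Measure.map_apply hm hs]

lemma tailMeasure_concatMeasure (τ : ℝ) (μ μ₁ : Measure ℝ) (h : μ₁ (Iio 0) = 0) :
    tailMeasure (concatMeasure τ μ μ₁) τ = μ₁ := by
  ext s hs
  have hm : Measurable fun t : ℝ => t - τ := by fun_prop
  rw [tailMeasure_apply _ _ hs, concatMeasure_apply _ _ _ ((hm hs).inter measurableSet_Ici)]
  have e1 : (fun t => t - τ) ⁻¹' s ∩ Ici τ ∩ Iio τ = ∅ := by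
    ext t
    simp only [mem_inter_iff, mem_Ici, mem_Iio, mem_empty_iff_false, iff_false, not_and, not_lt]
    exact fun h => h.2
  have e2 : (fun t => t + τ) ⁻¹' ((fun t => t - τ) ⁻¹' s ∩ Ici τ) = s ∩ Ici 0 := by
    ext t
    simp
  rw [e1, e2, measure_empty, zero_add]
  refine measure_inter_conull ?_
  exact measure_mono_null (fun t (ht : ¬ (0 : ℝ) ≤ t) => not_le.1 ht) h

namespace IsAdmissible
variable {x₀ K₀ : ℝ} {x K u : ℝ → ℝ} {μ : Measure ℝ}

/-- The capital stock just before time `τ`. -/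
lemma K_left_eq (h : M.IsAdmissible x₀ K₀ x K u μ) {τ : ℝ} (hτ : 0 ≤ τ) :
    K τ - (μ {τ}).toReal =
      K₀ - (∫ s in (0 : ℝ)..τ, M.γ * K s) + (μ (Ico 0 τ)).toReal := by
  have h1 : μ (Icc 0 τ) = μ (Ico 0 τ) + μ {τ} := by
    rw [← Ico_union_right hτ, measure_union _ (measurableSet_singleton τ)]
    exact Set.disjoint_left.2 fun s h1 h2 => absurd h1.2 (by rw [mem_singleton_iff.1 h2]; exact lt_irrefl _)
  have h2 : μ (Ico 0 τ) ≠ ⊤ := ne_top_of_le_ne_top (h.μ_fin τ).ne (measure_mono Ico_subset_Icc_self)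
  have h3 : μ {τ} ≠ ⊤ := ne_top_of_le_ne_top (h.μ_fin τ).ne
    (measure_mono (singleton_subset_iff.2 ⟨hτ, le_rfl⟩))
  rw [h.K_eq τ hτ, h1, ENNReal.toReal_add h2 h3]
  ring

lemma x_sub (hM : M.Standing) (h : M.IsAdmissible x₀ K₀ x K u μ) {a b : ℝ} (ha : 0 ≤ a)
    (hab : a ≤ b) : x b = x a + ∫ s in a..b, (M.F (x s) - u s * K s * x s) := by
  rw [(h.x_acDeriv hM ha hab).integral_eq]
  ring

/-- The initial capital of the tail is the left limit `K(τ) - μ({τ})`: an atom at `τ` becomes the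
initial jump of the tail. -/
lemma tail (hM : M.Standing) (h : M.IsAdmissible x₀ K₀ x K u μ) {τ : ℝ} (hτ : 0 ≤ τ) :
    M.IsAdmissible (x τ) (K τ - (μ {τ}).toReal) (fun t => x (t + τ)) (fun t => K (t + τ))
      (fun t => u (t + τ)) (tailMeasure μ τ) where
  u_meas := (h.u_meas.mono_measure (Measure.restrict_mono (Ici_subset_Ici.2 hτ)
    le_rfl)).comp_quasiMeasurePreserving (measurePreserving_shift_Ici τ).quasiMeasurePreserving
  u_mem := ae_shift hτ h.u_mem
  μ_supp := by
    rw [tailMeasure_apply μ τ measurableSet_Iio]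
    have : (fun t => t - τ) ⁻¹' Iio 0 ∩ Ici τ = ∅ := by
      ext t
      simp only [mem_inter_iff, mem_preimage, mem_Iio, mem_Ici, mem_empty_iff_false, iff_false,
        not_and, not_le]
      exact fun h => by linarith
    rw [this, measure_empty]
  μ_fin t := by
    rw [tailMeasure_Icc]
    exact lt_of_le_of_lt (measure_mono (Icc_subset_Icc hτ le_rfl)) (h.μ_fin (t + τ))
  K_int t ht := by
    have := (h.K_intervalIntegrable hτ (show 0 ≤ t + τ by linarith)).comp_add_right τ
    simpa using this
  K_eq t ht := by
    have h1 := h.K_sub hτ (show τ ≤ t + τ by linarith)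
    have h2 : μ (Icc τ (t + τ)) = μ {τ} + μ (Ioc τ (t + τ)) := by
      rw [← Ioc_union_left (show τ ≤ t + τ by linarith), union_comm,
        measure_union _ measurableSet_Ioc]
      exact Set.disjoint_left.2 fun s h1 h2 => absurd h2.1 (by rw [mem_singleton_iff.1 h1]; exact lt_irrefl _)
    have h3 : μ (Icc τ (t + τ)) ≠ ⊤ := ne_top_of_le_ne_top (h.μ_fin (t + τ)).ne
      (measure_mono (Icc_subset_Icc hτ le_rfl))
    rw [tailMeasure_Icc, h2, ENNReal.toReal_add
      (ne_top_of_le_ne_top h3 (by rw [h2]; exact le_self_add))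
      (ne_top_of_le_ne_top h3 (by rw [h2]; exact le_add_self)), h1,
      intervalIntegral.integral_const_mul,
      intervalIntegral.integral_comp_add_right (fun s => K s) τ, zero_add]
    ring
  x_cont := h.x_cont.comp (by fun_prop) fun t ht => by
    have : 0 ≤ t := ht
    simp only [mem_Ici]; linarith
  x_eq t ht := by
    rw [h.x_sub hM hτ (show τ ≤ t + τ by linarith), intervalIntegral.integral_comp_add_right
      (fun s => M.F (x s) - u s * K s * x s) τ, zero_add]
  x_nonneg t ht := h.x_nonneg _ (by linarith)
  K_nonneg t ht := h.K_nonneg _ (by linarith)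

variable {x₁ K₁ u₁ : ℝ → ℝ} {μ₁ : Measure ℝ}

lemma concat_intervalIntegral {f f₁ : ℝ → ℝ} {τ t : ℝ} (hτ : 0 ≤ τ) (ht : τ ≤ t)
    (hf : IntervalIntegrable f volume 0 τ) (hf₁ : IntervalIntegrable f₁ volume 0 (t - τ)) :
    IntervalIntegrable (concat τ f f₁) volume 0 t ∧
    ∫ s in (0 : ℝ)..t, concat τ f f₁ s =
      (∫ s in (0 : ℝ)..τ, f s) + ∫ s in (0 : ℝ)..(t - τ), f₁ s := by
  have hae : ∀ᵐ s : ℝ, s ∈ uIoc 0 τ → f s = concat τ f f₁ s := by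
    have h3 : ∀ᵐ s : ℝ, s ≠ τ := by simp [ae_iff, measure_singleton]
    filter_upwards [h3] with s h1 h2
    rw [uIoc_of_le hτ] at h2
    exact (concat_of_lt f f₁ (lt_of_le_of_ne h2.2 h1)).symm
  have i1 := hf.congr_ae ((ae_restrict_iff' measurableSet_uIoc).2 hae)
  have heq : ∀ s ∈ uIcc τ t, f₁ (s - τ) = concat τ f f₁ s := fun s hs => by
    rw [uIcc_of_le ht] at hs
    exact (concat_of_le f f₁ hs.1).symm
  have i2 : IntervalIntegrable (fun s => f₁ (s - τ)) volume τ t := by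
    have := hf₁.comp_sub_right τ
    simpa using this
  have i2' := i2.congr fun s hs => heq s (uIoc_subset_uIcc hs)
  refine ⟨i1.trans i2', ?_⟩
  rw [← intervalIntegral.integral_add_adjacent_intervals i1 i2',
    ← intervalIntegral.integral_congr_ae hae, ← intervalIntegral.integral_congr heq,
    intervalIntegral.integral_comp_sub_right (fun s => f₁ s) τ, sub_self]

lemma concat_intervalIntegral_of_lt {f f₁ : ℝ → ℝ} {τ t : ℝ} (ht0 : 0 ≤ t) (ht : t < τ) :
    ∫ s in (0 : ℝ)..t, concat τ f f₁ s = ∫ s in (0 : ℝ)..t, f s := by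
  refine intervalIntegral.integral_congr fun s hs => ?_
  rw [uIcc_of_le ht0] at hs
  exact concat_of_lt f f₁ (hs.2.trans_lt ht)

lemma concat (hM : M.Standing) (h : M.IsAdmissible x₀ K₀ x K u μ) {τ : ℝ} (hτ : 0 ≤ τ)
    (h₁ : M.IsAdmissible (x τ) (K τ - (μ {τ}).toReal) x₁ K₁ u₁ μ₁) :
    M.IsAdmissible x₀ K₀ (concat τ x x₁) (concat τ K K₁) (concat τ u u₁)
      (concatMeasure τ μ μ₁) where
  u_meas := by
    have hm : AEMeasurable (fun t => u₁ (t - τ)) (volume.restrict (Ici τ)) := by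
      have h2 : MeasurePreserving (fun t : ℝ => t - τ) (volume.restrict (Ici τ))
          (volume.restrict (Ici 0)) := by
        have h := (measurePreserving_sub_right (volume : Measure ℝ) τ).restrict_preimage
          (s := Ici 0) measurableSet_Ici
        have e : (fun t : ℝ => t - τ) ⁻¹' Ici 0 = Ici τ := by
          ext t; simp
        rwa [e] at h
      exact h₁.u_meas.comp_quasiMeasurePreserving h2.quasiMeasurePreserving
    rw [← Ico_union_Ici_eq_Ici hτ, aemeasurable_union_iff]
    constructor
    · refine (h.u_meas.mono_measure (Measure.restrict_mono (fun t ht => ht.1) le_rfl)).congr ?_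
      refine (ae_restrict_iff' measurableSet_Ico).2 (Eventually.of_forall fun t ht => ?_)
      exact (concat_of_lt u u₁ ht.2).symm
    · refine hm.congr ?_
      refine (ae_restrict_iff' measurableSet_Ici).2 (Eventually.of_forall fun t ht => ?_)
      exact (concat_of_le u u₁ ht).symm
  u_mem := by
    have h2 : ∀ᵐ t : ℝ, 0 ≤ t - τ → u₁ (t - τ) ∈ Icc (0 : ℝ) 1 :=
      (measurePreserving_sub_right (volume : Measure ℝ) τ).quasiMeasurePreserving.ae h₁.u_mem'
    refine (ae_restrict_iff' measurableSet_Ici).2 ?_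
    filter_upwards [h.u_mem', h2] with t h3 h4 ht
    rcases lt_or_ge t τ with h5 | h5
    · rw [concat_of_lt _ _ h5]; exact h3 ht
    · rw [concat_of_le _ _ h5]; exact h4 (sub_nonneg.2 h5)
  μ_supp := by
    rw [concatMeasure_apply _ _ _ measurableSet_Iio]
    have e1 : μ (Iio 0 ∩ Iio τ) = 0 := measure_mono_null inter_subset_left h.μ_supp
    have e2 : μ₁ ((fun t => t + τ) ⁻¹' Iio 0) = 0 :=
      measure_mono_null (fun t (ht : t + τ < 0) => (by linarith : t < 0)) h₁.μ_supp
    rw [e1, e2, zero_add]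
  μ_fin t := by
    rw [concatMeasure_apply _ _ _ measurableSet_Icc]
    refine ENNReal.add_lt_top.2 ⟨lt_of_le_of_lt (measure_mono inter_subset_left) (h.μ_fin t), ?_⟩
    have : (fun s => s + τ) ⁻¹' Icc 0 t ⊆ Iio 0 ∪ Icc 0 (t - τ) := fun s hs => by
      rcases lt_or_ge s 0 with h1 | h1
      · exact Or.inl h1
      · have := hs.2
        exact Or.inr ⟨h1, by simp only at this; linarith⟩
    refine lt_of_le_of_lt (measure_mono this) ((measure_union_le _ _).trans_lt ?_)
    rw [h₁.μ_supp, zero_add]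
    exact h₁.μ_fin _
  K_int t ht := by
    rcases lt_or_ge t τ with h1 | h1
    · refine (h.K_int t ht).congr fun s hs => ?_
      rw [uIoc_of_le ht] at hs
      exact (concat_of_lt K K₁ (hs.2.trans_lt h1)).symm
    · exact (concat_intervalIntegral hτ h1 (h.K_int τ hτ) (h₁.K_int _ (sub_nonneg.2 h1))).1
  K_eq t ht := by
    rw [concatMeasure_apply _ _ _ measurableSet_Icc, intervalIntegral.integral_const_mul]
    rcases lt_or_ge t τ with h1 | h1
    · have e1 : Icc 0 t ∩ Iio τ = Icc 0 t := inter_eq_left.2 fun s hs => hs.2.trans_lt h1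
      have e2 : μ₁ ((fun s => s + τ) ⁻¹' Icc 0 t) = 0 := by
        refine measure_mono_null (fun s hs => ?_) h₁.μ_supp
        have := hs.2
        simp only at this
        simp only [mem_Iio]; linarith
      rw [e1, e2, add_zero, concat_of_lt _ _ h1, concat_intervalIntegral_of_lt ht h1, h.K_eq t ht,
        intervalIntegral.integral_const_mul]
    · have e1 : Icc 0 t ∩ Iio τ = Ico 0 τ := by
        ext s
        simp only [mem_inter_iff, mem_Icc, mem_Iio, mem_Ico]
        exact ⟨fun h => ⟨h.1.1, h.2⟩, fun h => ⟨⟨h.1, h.2.le.trans h1⟩, h.2⟩⟩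
      have e2 : μ₁ ((fun s => s + τ) ⁻¹' Icc 0 t) = μ₁ (Icc 0 (t - τ)) := by
        refine le_antisymm ?_ (measure_mono fun s hs => ⟨by linarith [hs.1], by linarith [hs.2]⟩)
        have : (fun s => s + τ) ⁻¹' Icc 0 t ⊆ Iio 0 ∪ Icc 0 (t - τ) := fun s hs => by
          rcases lt_or_ge s 0 with h1 | h1
          · exact Or.inl h1
          · have := hs.2
            exact Or.inr ⟨h1, by simp only at this; linarith⟩
        refine (measure_mono this).trans ((measure_union_le _ _).trans ?_)
        rw [h₁.μ_supp, zero_add]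
      have h2 : μ (Ico 0 τ) ≠ ⊤ :=
        ne_top_of_le_ne_top (h.μ_fin τ).ne (measure_mono Ico_subset_Icc_self)
      have h3 := h.K_left_eq hτ
      rw [intervalIntegral.integral_const_mul] at h3
      rw [e1, e2, concat_of_le _ _ h1, h₁.K_eq _ (sub_nonneg.2 h1),
        ENNReal.toReal_add h2 (h₁.μ_fin _).ne, (concat_intervalIntegral hτ h1 (h.K_int τ hτ)
        (h₁.K_int _ (sub_nonneg.2 h1))).2, h3, intervalIntegral.integral_const_mul]
      ring
  x_cont := by
    intro t ht
    rcases lt_or_ge t τ with h1 | h1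
    · refine (h.x_cont t ht).congr_of_eventuallyEq ?_ (concat_of_lt x x₁ h1)
      filter_upwards [nhdsWithin_le_nhds (Iio_mem_nhds h1)] with s hs
      exact concat_of_lt x x₁ hs
    · have hl : ContinuousWithinAt (Fishery.concat τ x x₁) (Ici τ) t := by
        have : ContinuousOn (fun s => x₁ (s - τ)) (Ici τ) :=
          h₁.x_cont.comp (by fun_prop) fun s hs => mem_Ici.2 (sub_nonneg.2 hs)
        exact (this t h1).congr (fun s hs => concat_of_le x x₁ hs) (concat_of_le x x₁ h1)
      rcases h1.eq_or_lt with rfl | h1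
      · have hl' : ContinuousWithinAt (Fishery.concat τ x x₁) (Ico 0 τ) τ := by
          refine ((h.x_cont τ ht).mono fun s hs => hs.1).congr
            (fun s hs => concat_of_lt x x₁ hs.2) ?_
          rw [concat_of_le x x₁ le_rfl, sub_self, h₁.x_zero]
        have := hl'.union hl
        rwa [Ico_union_Ici_eq_Ici hτ] at this
      · exact (hl.continuousAt (Ici_mem_nhds h1)).continuousWithinAt
  x_eq t ht := by
    have e : ∀ s, M.F (Fishery.concat τ x x₁ s) - Fishery.concat τ u u₁ s *
        Fishery.concat τ K K₁ s * Fishery.concat τ x x₁ s =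
        Fishery.concat τ (fun s => M.F (x s) - u s * K s * x s)
          (fun s => M.F (x₁ s) - u₁ s * K₁ s * x₁ s) s := by
      intro s
      simp only [Fishery.concat]
      split_ifs <;> rfl
    simp_rw [e]
    rcases lt_or_ge t τ with h1 | h1
    · rw [concat_of_lt _ _ h1, concat_intervalIntegral_of_lt ht h1, h.x_eq t ht]
    · rw [concat_of_le _ _ h1, (concat_intervalIntegral hτ h1
        (h.x_acDeriv hM le_rfl hτ).intervalIntegrable
        (h₁.x_acDeriv hM le_rfl (sub_nonneg.2 h1)).intervalIntegrable).2,
        h₁.x_eq _ (sub_nonneg.2 h1), h.x_eq τ hτ]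
      ring
  x_nonneg t ht := by
    rcases lt_or_ge t τ with h1 | h1
    · rw [concat_of_lt _ _ h1]; exact h.x_nonneg t ht
    · rw [concat_of_le _ _ h1]; exact h₁.x_nonneg _ (sub_nonneg.2 h1)
  K_nonneg t ht := by
    rcases lt_or_ge t τ with h1 | h1
    · rw [concat_of_lt _ _ h1]; exact h.K_nonneg t ht
    · rw [concat_of_le _ _ h1]; exact h₁.K_nonneg _ (sub_nonneg.2 h1)

end IsAdmissible

/-- Bellman's principle. A competitor of the tail, attached to the original process at `τ`, gives a
competitor of the whole; the common cost before `τ` cancels and the rest carries the factor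
`e^{-δτ}`. -/
lemma IsOptimal.tail (hM : M.Standing) {x₀ K₀ : ℝ} {x K u : ℝ → ℝ} {μ : Measure ℝ}
    (hx₀ : x₀ ∈ Ioo 0 M.xbar) (h : M.IsOptimal x₀ K₀ x K u μ) {τ : ℝ} (hτ : 0 ≤ τ) :
    M.IsOptimal (x τ) (K τ - (μ {τ}).toReal) (fun t => x (t + τ)) (fun t => K (t + τ))
      (fun t => u (t + τ)) (tailMeasure μ τ) := by
  have hτ' := h.1.tail hM hτ
  refine ⟨hτ', fun x₁ K₁ u₁ μ₁ h₁ => ?_⟩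
  have hadm := h.1.concat hM hτ h₁
  have hle := h.2 _ _ _ _ hadm
  have hxτ := h.1.x_mem hM hx₀ hτ
  have hN : M.profits x K u ≠ ⊤ := (h.1.lintegral_neg_lt_top hM hx₀).ne
  have hN₁ : M.profits x₁ K₁ u₁ ≠ ⊤ := (h₁.lintegral_neg_lt_top hM hxτ).ne
  have hN' : M.profits (fun t => x (t + τ)) (fun t => K (t + τ)) (fun t => u (t + τ)) ≠ ⊤ :=
    (hτ'.lintegral_neg_lt_top hM hxτ).ne
  -- Cancelling requires finite terms. A competitor of infinite cost is harmless; one of finite cost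
  -- makes the concatenation, and hence the optimal process, finite.
  by_cases hfin : M.capitalCost μ₁ = ⊤ ∨ M.expenses x₁ K₁ u₁ = ⊤
  · rw [cost_eq x₁, EReal.coe_ennreal_add_sub_eq_top hfin hN₁]
    exact le_top
  push Not at hfin
  -- the costs incurred before time `τ`
  have ha : ∫⁻ t in Ico 0 τ, ENNReal.ofReal (Real.exp (-M.δ * t) * M.r) ∂μ ≠ ⊤ := by
    refine ne_top_of_le_ne_top (ENNReal.mul_ne_top (ENNReal.ofReal_ne_top (r := M.r))
      (h.1.μ_fin τ).ne) ?_
    calc ∫⁻ t in Ico 0 τ, ENNReal.ofReal (Real.exp (-M.δ * t) * M.r) ∂μ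
        ≤ ∫⁻ t in Ico 0 τ, ENNReal.ofReal M.r ∂μ := by
          refine setLIntegral_mono' measurableSet_Ico fun t ht => ENNReal.ofReal_le_ofReal ?_
          refine mul_le_of_le_one_left hM.r_pos.le (Real.exp_le_one_iff.2 ?_)
          nlinarith [hM.δ_pos, ht.1]
      _ ≤ ENNReal.ofReal M.r * μ (Icc 0 τ) := by
          rw [setLIntegral_const]
          gcongr
          exact Ico_subset_Icc_self
  have hrc : IntegrableOn (M.runningCost x K u) (Ico 0 τ) := by
    have := h.1.runningCost_intervalIntegrable hτ
    rw [intervalIntegrable_iff_integrableOn_Ioc_of_le hτ] at this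
    rwa [IntegrableOn, Measure.restrict_congr_set Ico_ae_eq_Ioc]
  have hb : ∫⁻ t in Ico 0 τ, ENNReal.ofReal (M.runningCost x K u t) ≠ ⊤ :=
    hrc.lintegral_lt_top.ne
  have hc : ∫⁻ t in Ico 0 τ, ENNReal.ofReal (-M.runningCost x K u t) ≠ ⊤ :=
    hrc.neg.lintegral_lt_top.ne
  have he0 : ENNReal.ofReal (Real.exp (-M.δ * τ)) ≠ 0 := by simpa using Real.exp_pos _
  have het : ENNReal.ofReal (Real.exp (-M.δ * τ)) ≠ ⊤ := ENNReal.ofReal_ne_top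
  have hetr : 0 < (ENNReal.ofReal (Real.exp (-M.δ * τ))).toReal := ENNReal.toReal_pos he0 het
  have hcongr : ∀ k : ℝ, ∫⁻ t in Ico 0 τ, ENNReal.ofReal (k * M.runningCost (concat τ x x₁)
      (concat τ K K₁) (concat τ u u₁) t) =
      ∫⁻ t in Ico 0 τ, ENNReal.ofReal (k * M.runningCost x K u t) := by
    intro k
    refine setLIntegral_congr_fun measurableSet_Ico fun t ht => ?_
    simp only [runningCost, concat_of_lt _ _ ht.2]
  have hcongr' : ∀ k : ℝ, ∫⁻ t in Ici (0 : ℝ), ENNReal.ofReal (k * M.runningCost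
      (fun t => concat τ x x₁ (t + τ)) (fun t => concat τ K K₁ (t + τ))
      (fun t => concat τ u u₁ (t + τ)) t) =
      ∫⁻ t in Ici (0 : ℝ), ENNReal.ofReal (k * M.runningCost x₁ K₁ u₁ t) := by
    intro k
    refine setLIntegral_congr_fun measurableSet_Ici fun t ht => ?_
    simp only [runningCost, concat_add _ _ (mem_Ici.1 ht)]
  have eA : M.capitalCost (concatMeasure τ μ μ₁) =
      (∫⁻ t in Ico 0 τ, ENNReal.ofReal (Real.exp (-M.δ * t) * M.r) ∂μ) +
        ENNReal.ofReal (Real.exp (-M.δ * τ)) * M.capitalCost μ₁ := by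
    rw [capitalCost_split _ hτ, tailMeasure_concatMeasure τ μ μ₁ h₁.μ_supp]
    congr 1
    have e1 : (concatMeasure τ μ μ₁).restrict (Ico 0 τ) = μ.restrict (Ico 0 τ) := by
      ext s hs
      rw [Measure.restrict_apply hs, Measure.restrict_apply hs,
        concatMeasure_apply _ _ _ (hs.inter measurableSet_Ico)]
      have k1 : s ∩ Ico 0 τ ∩ Iio τ = s ∩ Ico 0 τ := inter_eq_left.2 fun t ht => ht.2.2
      have k2 : μ₁ ((fun t => t + τ) ⁻¹' (s ∩ Ico 0 τ)) = 0 := by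
        refine measure_mono_null (fun t ht => ?_) h₁.μ_supp
        have := ht.2.2
        simp only [mem_Iio]; linarith
      rw [k1, k2, add_zero]
    rw [e1]
  have eP : M.expenses (concat τ x x₁) (concat τ K K₁) (concat τ u u₁) =
      (∫⁻ t in Ico 0 τ, ENNReal.ofReal (M.runningCost x K u t)) +
        ENNReal.ofReal (Real.exp (-M.δ * τ)) * M.expenses x₁ K₁ u₁ := by
    have := lintegral_runningCost_split (M := M) 1 (concat τ x x₁) (concat τ K K₁)
      (concat τ u u₁) hτ
    rw [hcongr, hcongr'] at this
    simpa [expenses] using this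
  have eN : M.profits (concat τ x x₁) (concat τ K K₁) (concat τ u u₁) =
      (∫⁻ t in Ico 0 τ, ENNReal.ofReal (-M.runningCost x K u t)) +
        ENNReal.ofReal (Real.exp (-M.δ * τ)) * M.profits x₁ K₁ u₁ := by
    have := lintegral_runningCost_split (M := M) (-1) (concat τ x x₁) (concat τ K K₁)
      (concat τ u u₁) hτ
    rw [hcongr, hcongr'] at this
    simpa [profits] using this
  have hA2 : M.capitalCost (concatMeasure τ μ μ₁) ≠ ⊤ := by
    rw [eA]; exact ENNReal.add_ne_top.2 ⟨ha, ENNReal.mul_ne_top het hfin.1⟩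
  have hP2 : M.expenses (concat τ x x₁) (concat τ K K₁) (concat τ u u₁) ≠ ⊤ := by
    rw [eP]; exact ENNReal.add_ne_top.2 ⟨hb, ENNReal.mul_ne_top het hfin.2⟩
  have hN2 : M.profits (concat τ x x₁) (concat τ K K₁) (concat τ u u₁) ≠ ⊤ := by
    rw [eN]; exact ENNReal.add_ne_top.2 ⟨hc, ENNReal.mul_ne_top het hN₁⟩
  rw [cost_eq (concat τ x x₁), EReal.coe_ennreal_add_sub hA2 hP2 hN2] at hle
  obtain ⟨hA, hP⟩ := h.1.expenses_ne_top_of_cost hM hx₀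
    (ne_top_of_le_ne_top (EReal.coe_ne_top _) hle)
  have sA := capitalCost_split (M := M) μ hτ
  have sP := expenses_split (M := M) x K u hτ
  have sN := profits_split (M := M) x K u hτ
  have hA' : M.capitalCost (tailMeasure μ τ) ≠ ⊤ := by
    intro h0
    rw [h0, ENNReal.mul_top he0, add_top] at sA
    exact hA sA
  have hP' : M.expenses (fun t => x (t + τ)) (fun t => K (t + τ)) (fun t => u (t + τ)) ≠ ⊤ := by
    intro h0
    rw [h0, ENNReal.mul_top he0, add_top] at sP
    exact hP sP
  rw [cost_eq x, EReal.coe_ennreal_add_sub hA hP hN, EReal.coe_le_coe_iff, sA, sP, sN, eA, eP, eN,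
    ENNReal.toReal_add ha (ENNReal.mul_ne_top het hA'),
    ENNReal.toReal_add hb (ENNReal.mul_ne_top het hP'),
    ENNReal.toReal_add hc (ENNReal.mul_ne_top het hN'),
    ENNReal.toReal_add ha (ENNReal.mul_ne_top het hfin.1),
    ENNReal.toReal_add hb (ENNReal.mul_ne_top het hfin.2),
    ENNReal.toReal_add hc (ENNReal.mul_ne_top het hN₁)] at hle
  simp only [ENNReal.toReal_mul] at hle
  rw [cost_eq, cost_eq, EReal.coe_ennreal_add_sub hA' hP' hN',
    EReal.coe_ennreal_add_sub hfin.1 hfin.2 hN₁, EReal.coe_le_coe_iff]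
  refine le_of_mul_le_mul_left ?_ hetr
  linarith

lemma IsAdjoint.tail {x K u z lam : ℝ → ℝ} {μ : Measure ℝ} (hadj : M.IsAdjoint x K u μ z lam)
    {τ : ℝ} (hτ : 0 ≤ τ)
    (hz : ∀ t, 0 ≤ t → IntervalIntegrable (fun s => z s * M.g (x s) - M.ψ (x s)) volume 0 t)
    (hlam : ∀ t, 0 ≤ t → IntervalIntegrable
      (fun s => (lam s - M.r) * M.κ - z s * u s + M.r') volume 0 t) :
    M.IsAdjoint (fun t => x (t + τ)) (fun t => K (t + τ)) (fun t => u (t + τ))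
      (tailMeasure μ τ) (fun t => z (t + τ)) (fun t => lam (t + τ)) where
  z_cont := hadj.z_cont.comp (by fun_prop) fun t (ht : 0 ≤ t) => by
    simp only [mem_Ici]; linarith
  z_eq t ht := by
    have h1 : 0 ≤ t + τ := by linarith
    have e := intervalIntegral.integral_comp_add_right (a := 0) (b := t)
      (fun s => z s * M.g (x s) - M.ψ (x s)) τ
    rw [zero_add] at *
    rw [e, hadj.z_eq _ h1, hadj.z_eq τ hτ, ← intervalIntegral.integral_add_adjacent_intervals
      (hz τ hτ) ((hz τ hτ).symm.trans (hz _ h1))]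
    ring
  lam_cont := hadj.lam_cont.comp (by fun_prop) fun t (ht : 0 ≤ t) => by
    simp only [mem_Ici]; linarith
  lam_eq t ht := by
    have h1 : 0 ≤ t + τ := by linarith
    have e := intervalIntegral.integral_comp_add_right (a := 0) (b := t)
      (fun s => (lam s - M.r) * M.κ - z s * u s + M.r') τ
    rw [zero_add] at *
    rw [e, hadj.lam_eq _ h1, hadj.lam_eq τ hτ, ← intervalIntegral.integral_add_adjacent_intervals
      (hlam τ hτ) ((hlam τ hτ).symm.trans (hlam _ h1))]
    ring
  lam_le t ht := hadj.lam_le _ (by linarith)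
  lam_eq_r := by
    have hemb : MeasurableEmbedding fun t : ℝ => t - τ :=
      (MeasurableEquiv.subRight τ).measurableEmbedding
    rw [tailMeasure, hemb.ae_map_iff]
    simp only [sub_add_cancel]
    exact ae_mono Measure.restrict_le_self hadj.lam_eq_r
  max_cond := ae_shift hτ hadj.max_cond

end Fishery


/-! ### Optimal processes to the left of `x^*` -/

lemma ContinuousOn.exists_forall_Icc_lt_left {P : ℝ → ℝ} {a b k : ℝ} (hab : a < b)
    (hc : ContinuousOn P (Icc a b)) (h : P b < k) : ∃ s ∈ Ico a b, ∀ t ∈ Icc s b, P t < k := by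
  have h1 := (hc b ⟨hab.le, le_rfl⟩).eventually (gt_mem_nhds h)
  rw [nhdsWithin_Icc_eq_nhdsLE hab] at h1
  obtain ⟨l, hl, hs⟩ := mem_nhdsLE_iff_exists_Icc_subset.1 h1
  exact ⟨max a l, ⟨le_max_left _ _, max_lt hab hl⟩,
    fun t ht => hs ⟨(le_max_right _ _).trans ht.1, ht.2⟩⟩

lemma ContinuousOn.exists_forall_Icc_lt_right {P : ℝ → ℝ} {a b k : ℝ} (hab : a < b)
    (hc : ContinuousOn P (Icc a b)) (h : P a < k) : ∃ s ∈ Ioc a b, ∀ t ∈ Icc a s, P t < k := by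
  have h1 := (hc a ⟨le_rfl, hab.le⟩).eventually (gt_mem_nhds h)
  rw [nhdsWithin_Icc_eq_nhdsGE hab] at h1
  obtain ⟨l, hl, hs⟩ := mem_nhdsGE_iff_exists_Icc_subset.1 h1
  exact ⟨min b l, ⟨lt_min hab hl, min_le_left _ _⟩,
    fun t ht => hs ⟨ht.1, ht.2.trans (min_le_right _ _)⟩⟩

namespace Fishery
variable {M : Fishery} {x₀ K₀ : ℝ} {x K u z lam : ℝ → ℝ} {μ : Measure ℝ}

/-- A stock that rises to `x^*` does so with a catch rate that is not bounded below by a constant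
greater than `K^*`. -/
lemma Standing.le_KStar_of_arrival (hM : M.Standing) {v : ℝ → ℝ} {a τ k : ℝ} (haτ : a < τ)
    (hx : ACDeriv x (fun t => M.F (x t) - v t * x t) a τ)
    (hlt : ∀ t ∈ Ico a τ, x t ∈ Ioo 0 M.xStar) (hend : x τ = M.xStar)
    (hv : ∀ᵐ t, t ∈ Ioo a τ → k ≤ v t) : k ≤ M.KStar := by
  by_contra hcon
  push Not at hcon
  have hpos : ∀ t ∈ Icc a τ, 0 < x t := fun t ht => by
    rcases ht.2.eq_or_lt with rfl | h1
    · rw [hend]; exact hM.xStar_pos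
    · exact (hlt t ⟨ht.1, h1⟩).1
  have hc : ContinuousOn (fun t => M.rate (x t)) (Icc a τ) :=
    hM.continuousOn_rate.comp hx.continuousOn hpos
  -- Near arrival the growth rate is close to `K^* < k`, so the logarithm of the stock would
  -- decrease towards `log x^*` from above.
  obtain ⟨s, hs, hsk⟩ := hc.exists_forall_Icc_lt_left haτ (k := k) (by
    rw [hend]; exact hcon)
  have h1 := ((acDeriv_log hx hpos).mono hs.1 hs.2.le le_rfl).lt_of_neg hs.2 (by
    filter_upwards [hv] with t h1 ht
    have := hsk t (Ioo_subset_Icc_self ht)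
    have := h1 ⟨hs.1.trans_lt ht.1, ht.2⟩
    linarith)
  rw [hend] at h1
  exact absurd (Real.log_lt_log (hlt s hs).1 (hlt s hs).2) h1.not_gt

namespace IsAdmissible

lemma K_eq_exp (h : M.IsAdmissible x₀ K₀ x K u μ) {a b : ℝ} (ha : 0 ≤ a) (hab : a ≤ b)
    (hμ : μ (Ioc a b) = 0) : K b = K a * Real.exp (-M.γ * (b - a)) := by
  have h1 : ACDeriv K (fun t => -M.γ * K t) a b := by
    refine ACDeriv.of_integral hab ((h.K_intervalIntegrable ha (ha.trans hab)).const_mul _)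
      (k := K a) fun t ht => ?_
    rw [h.K_sub ha ht.1, measure_mono_null (Ioc_subset_Ioc le_rfl ht.2) hμ,
      intervalIntegral.integral_const_mul]
    simp
    ring
  have h2 := (h1.mul_exp M.γ).eq_of_zero (Eventually.of_forall fun t _ => by ring)
  have h3 : K b = K b * Real.exp (M.γ * b) * Real.exp (-(M.γ * b)) := by
    rw [mul_assoc, ← Real.exp_add]; simp
  rw [h3, h2, mul_assoc, ← Real.exp_add]
  congr 2
  ring

lemma K_zero (h : M.IsAdmissible x₀ K₀ x K u μ) : K 0 = K₀ + (μ {0}).toReal := by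
  simpa using h.K_eq 0 le_rfl

/-- If `K(t) = 0`, then `K(a) ≤ γ ∫ₐᵗ K` for earlier `a`, and Gronwall backwards from `t` gives `∫₀ᵗ
K = 0`. The capital equation then leaves neither initial capital nor investment. -/
lemma K_pos (h : M.IsAdmissible x₀ K₀ x K u μ) (hK₀ : 0 ≤ K₀) (hM : M.Standing) {t : ℝ}
    (ht : 0 ≤ t) (h0 : 0 < K₀ ∨ μ (Icc 0 t) ≠ 0) : 0 < K t := by
  refine lt_of_le_of_ne (h.K_nonneg t ht) fun hK => ?_
  have hint := h.K_intervalIntegrable le_rfl ht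
  have h1 : ACDeriv (fun a => ∫ s in (0 : ℝ)..a, K s) K 0 t :=
    ACDeriv.of_integral ht hint (k := 0) fun a _ => by simp
  have h2 := (((ACDeriv.const ht (∫ s in (0 : ℝ)..t, K s)).sub h1).mul_exp M.γ).le_of_nonneg (by
    refine Eventually.of_forall fun a ha => mul_nonneg ?_ (Real.exp_pos _).le
    have h3 := h.K_sub ha.1.le ha.2.le
    have h4 := intervalIntegral.integral_add_adjacent_intervals
      (h.K_intervalIntegrable le_rfl ha.1.le) (h.K_intervalIntegrable ha.1.le ht)
    have h5 : 0 ≤ (μ (Ioc a t)).toReal := ENNReal.toReal_nonneg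
    rw [← h4]
    have := hM.γ_pos
    nlinarith)
  simp only [intervalIntegral.integral_same, sub_self, zero_mul, mul_zero, Real.exp_zero,
    sub_zero, mul_one] at h2
  have h3 := h.K_eq t ht
  have h4 : 0 ≤ ∫ s in (0 : ℝ)..t, K s :=
    intervalIntegral.integral_nonneg ht fun s hs => h.K_nonneg s hs.1
  rw [intervalIntegral.integral_const_mul, le_antisymm h2 h4, ← hK] at h3
  have h5 : 0 ≤ (μ (Icc 0 t)).toReal := ENNReal.toReal_nonneg
  rcases h0 with h0 | h0
  · linarith
  · have := ENNReal.toReal_pos h0 (h.μ_fin t).ne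
    linarith

/-- Without investment the capital stock decays so that the stock grows up to `x^*`. -/
lemma exists_xStar_le (hM : M.Standing) (h : M.IsAdmissible x₀ K₀ x K u μ) (hx₀ : 0 < x₀)
    {a : ℝ} (ha : 0 ≤ a) (hμ : ∀ t, a ≤ t → (∀ s ∈ Icc a t, x s < M.xStar) → μ (Ioc a t) = 0) :
    ∃ t, a ≤ t ∧ M.xStar ≤ x t := by
  by_contra hcon
  push Not at hcon
  have hK := hM.KStar_pos
  have hγ := hM.γ_pos
  have hKa := h.K_nonneg a ha
  -- To the left of `x^*` the growth rate is at least `K^*`, while the decaying capital lowers `log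
  -- x` by at most `K(a)/γ` in total. `T` is chosen so that `K^* (T - a)` makes up for this and for
  -- the distance to `log x^*`.
  set T := a + |Real.log M.xStar - Real.log (x a)| / M.KStar + K a / M.γ / M.KStar
  have hT : a ≤ T := by
    have : 0 ≤ |Real.log M.xStar - Real.log (x a)| / M.KStar := by positivity
    have : 0 ≤ K a / M.γ / M.KStar := by positivity
    simp only [T]; linarith
  have hpos : ∀ t ∈ Icc a T, 0 < x t := fun t ht => h.x_pos hM hx₀ (ha.trans ht.1)
  have h1 : ACDeriv (fun t => M.KStar * t - K a / M.γ * Real.exp (-M.γ * (t - a)) * (-1))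
      (fun t => M.KStar - K a * Real.exp (-M.γ * (t - a))) a T := by
    refine ACDeriv.of_contDiffOn hT (by fun_prop) fun t _ => ?_
    have e := ((((hasDerivAt_id t).sub_const a).const_mul (-M.γ)).exp.const_mul
      (K a / M.γ)).mul_const (-1)
    have e2 := ((hasDerivAt_id t).const_mul M.KStar).sub e
    refine e2.congr_deriv ?_
    simp only [id]
    field_simp
  have h2 := ((acDeriv_log (h.x_acDeriv hM ha hT) hpos).sub h1).le_of_nonneg (by
    filter_upwards [h.v_le] with t h3 ht
    have h4 := h.K_eq_exp ha ht.1.le (hμ t ht.1.le fun s hs => hcon s hs.1)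
    have h5 := h3 (ha.trans ht.1.le)
    have h6 := hM.strictAntiOn_rate.antitoneOn
      (⟨hpos t (Ioo_subset_Icc_self ht), (hcon t ht.1.le).le.trans hM.V4_xStar.2.le⟩ :
        x t ∈ Ioc 0 M.xbar) ⟨hM.xStar_pos, hM.V4_xStar.2.le⟩ (hcon t ht.1.le).le
    rw [← Standing.KStar_eq] at h6
    rw [← h4]
    linarith)
  have h3 := Real.log_lt_log (hpos T ⟨hT, le_rfl⟩) (hcon T hT)
  have h4 : 0 ≤ K a / M.γ * Real.exp (-M.γ * (T - a)) := by positivity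
  have h5 : M.KStar * T = M.KStar * a + |Real.log M.xStar - Real.log (x a)| + K a / M.γ := by
    simp only [T]; field_simp
  have h6 := le_abs_self (Real.log M.xStar - Real.log (x a))
  simp only [sub_self, mul_zero, Real.exp_zero] at h2
  linarith

end IsAdmissible

namespace IsAdjoint

lemma z_integrable (hM : M.Standing) (h : M.IsAdmissible x₀ K₀ x K u μ)
    (hx₀ : x₀ ∈ Ioo 0 M.xbar) (hadj : M.IsAdjoint x K u μ z lam) {t : ℝ} (ht : 0 ≤ t) :
    IntervalIntegrable (fun s => z s * M.g (x s) - M.ψ (x s)) volume 0 t := by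
  have hx : ContinuousOn x (Icc 0 t) := h.x_cont.mono fun s hs => hs.1
  have hz : ContinuousOn z (Icc 0 t) := hadj.z_cont.mono fun s hs => hs.1
  refine ContinuousOn.intervalIntegrable ?_
  rw [uIcc_of_le ht]
  exact (hz.mul (hM.continuousOn_g.comp hx fun s hs => h.x_pos hM hx₀.1 hs.1)).sub
    (hM.continuousOn_ψ.comp hx fun s hs => h.x_pos hM hx₀.1 hs.1)

lemma lam_integrable (h : M.IsAdmissible x₀ K₀ x K u μ) (hadj : M.IsAdjoint x K u μ z lam)
    {t : ℝ} (ht : 0 ≤ t) :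
    IntervalIntegrable (fun s => (lam s - M.r) * M.κ - z s * u s + M.r') volume 0 t := by
  have hlam : ContinuousOn lam (uIcc 0 t) := by
    rw [uIcc_of_le ht]; exact hadj.lam_cont.mono fun s hs => hs.1
  have hz : ContinuousOn z (uIcc 0 t) := by
    rw [uIcc_of_le ht]; exact hadj.z_cont.mono fun s hs => hs.1
  have hu : IntervalIntegrable u volume 0 t := by
    rw [intervalIntegrable_iff_integrableOn_Ioc_of_le ht]
    have hsub : Ioc 0 t ⊆ Ici 0 := fun s hs => hs.1.le
    refine Integrable.mono' (g := fun _ => (1 : ℝ)) (integrableOn_const (by simp))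
      (h.u_meas.mono_measure (Measure.restrict_mono hsub le_rfl)).aestronglyMeasurable ?_
    filter_upwards [ae_mono (Measure.restrict_mono hsub le_rfl) h.u_mem] with s hs
    rw [Real.norm_eq_abs, abs_of_nonneg hs.1]
    exact hs.2
  exact ((ContinuousOn.intervalIntegrable (by fun_prop)).sub (hu.continuousOn_mul hz)).add
    intervalIntegrable_const

lemma z_acDeriv (hM : M.Standing) (h : M.IsAdmissible x₀ K₀ x K u μ) (hx₀ : x₀ ∈ Ioo 0 M.xbar)
    (hadj : M.IsAdjoint x K u μ z lam) {a b : ℝ} (ha : 0 ≤ a) (hab : a ≤ b) :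
    ACDeriv z (fun t => z t * M.g (x t) - M.ψ (x t)) a b :=
  (ACDeriv.of_integral (ha.trans hab) (hadj.z_integrable hM h hx₀ (ha.trans hab))
    (k := z 0) fun t ht => hadj.z_eq t ht.1).mono ha hab le_rfl

lemma lam_acDeriv (h : M.IsAdmissible x₀ K₀ x K u μ) (hadj : M.IsAdjoint x K u μ z lam)
    {a b : ℝ} (ha : 0 ≤ a) (hab : a ≤ b) :
    ACDeriv lam (fun t => (lam t - M.r) * M.κ - z t * u t + M.r') a b :=
  (ACDeriv.of_integral (ha.trans hab) (hadj.lam_integrable h (ha.trans hab))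
    (k := lam 0) fun t ht => hadj.lam_eq t ht.1).mono ha hab le_rfl

/-- The integrating factor removes the term in `λ`, so the sign of `z u - r'` alone decides whether
the gap `r - λ` can open or must close. -/
lemma gap_acDeriv (h : M.IsAdmissible x₀ K₀ x K u μ) (hadj : M.IsAdjoint x K u μ z lam)
    {a b : ℝ} (ha : 0 ≤ a) (hab : a ≤ b) :
    ACDeriv (fun t => (M.r - lam t) * Real.exp (-M.κ * t))
      (fun t => (z t * u t - M.r') * Real.exp (-M.κ * t)) a b :=
  (((ACDeriv.const hab M.r).sub (hadj.lam_acDeriv h ha hab)).mul_exp (-M.κ)).congr_ae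
    (Eventually.of_forall fun t _ => by ring)

/-- With `z < r'` one has `z u < r'`, so a vanishing gap `r - λ` would become negative immediately
afterwards. -/
lemma r'_le_z (hM : M.Standing) (h : M.IsAdmissible x₀ K₀ x K u μ)
    (hadj : M.IsAdjoint x K u μ z lam) {s : ℝ} (hs : 0 ≤ s) (hl : lam s = M.r) :
    M.r' ≤ z s := by
  by_contra hcon
  push Not at hcon
  obtain ⟨b, hb, hzb⟩ := ContinuousOn.exists_forall_Icc_lt_right (lt_add_one s)
    (hadj.z_cont.mono fun t ht => hs.trans ht.1) hcon
  have h1 := (hadj.gap_acDeriv h hs hb.1.le).lt_of_neg hb.1 (by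
    filter_upwards [h.u_mem'] with t h1 ht
    have h2 := h1 (hs.trans ht.1.le)
    have h3 := hzb t (Ioo_subset_Icc_self ht)
    have h4 := hM.r'_pos
    refine mul_neg_of_neg_of_pos ?_ (Real.exp_pos _)
    rcases le_total (z t) 0 with h5 | h5
    · nlinarith [h2.1]
    · nlinarith [h2.2])
  rw [hl, sub_self, zero_mul] at h1
  have := hadj.lam_le b (hs.trans hb.1.le)
  exact absurd (mul_nonneg (sub_nonneg.2 this) (Real.exp_pos (-M.κ * b)).le) h1.not_ge

lemma measure_eq_zero (hadj : M.IsAdjoint x K u μ z lam) {s : Set ℝ}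
    (hs : ∀ t ∈ s, lam t < M.r) : μ s = 0 :=
  measure_mono_null (fun t ht => (hs t ht).ne) (ae_iff.1 hadj.lam_eq_r)

/-- A time of investment satisfies the jump condition. -/
lemma exists_lam_eq (hadj : M.IsAdjoint x K u μ z lam) {τ : ℝ} (hμ : μ (Ico 0 τ) ≠ 0) :
    ∃ s ∈ Ico 0 τ, lam s = M.r ∧ ∀ t, s < t → μ (Icc 0 t) ≠ 0 := by
  obtain ⟨s, hs, hpos⟩ := exists_mem_forall_mem_nhdsWithin_pos_measure hμ
  refine ⟨s, hs, ?_, fun t ht => ?_⟩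
  · by_contra hne
    have h1 : lam s < M.r := lt_of_le_of_ne (hadj.lam_le s hs.1) hne
    have h2 : {t | lam t < M.r} ∈ 𝓝[Ico 0 τ] s :=
      ((hadj.lam_cont s hs.1).mono fun t ht => ht.1).eventually (gt_mem_nhds h1)
    exact (hpos _ h2).ne' (hadj.measure_eq_zero fun t ht => ht)
  · have h2 : Icc 0 t ∈ 𝓝[Ico 0 τ] s := by
      filter_upwards [self_mem_nhdsWithin, nhdsWithin_le_nhds (Iio_mem_nhds ht)] with q h1 h2
      exact ⟨h1.1, le_of_lt h2⟩
    exact (hpos _ h2).ne'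

lemma u_eq_one (h : M.IsAdmissible x₀ K₀ x K u μ) (hadj : M.IsAdjoint x K u μ z lam) :
    ∀ᵐ t : ℝ, 0 ≤ t → 0 < K t → 0 < z t → u t = 1 := by
  filter_upwards [h.u_mem', (ae_restrict_iff' measurableSet_Ici).1 hadj.max_cond] with t h1 h2 ht
    hK hz
  have h3 := h2 ht 1 ⟨zero_le_one, le_rfl⟩
  exact le_antisymm (h1 ht).2 (le_of_mul_le_mul_left h3 (mul_pos hz hK))

lemma v_eq_zero (h : M.IsAdmissible x₀ K₀ x K u μ) (hadj : M.IsAdjoint x K u μ z lam) :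
    ∀ᵐ t : ℝ, 0 ≤ t → z t < 0 → u t * K t = 0 := by
  filter_upwards [h.v_nonneg, (ae_restrict_iff' measurableSet_Ici).1 hadj.max_cond] with t h1 h2 ht
    hz
  have h3 := h2 ht 0 ⟨le_rfl, zero_le_one⟩
  have h4 := h1 ht
  nlinarith

end IsAdjoint

namespace IsOptimal

/-- To the left of `x^*` the jump condition fails, as long as there is capital afterwards. -/
lemma lam_ne (hM : M.Standing) (h : M.IsOptimal x₀ K₀ x K u μ) (hx₀ : x₀ ∈ Ioo 0 M.xbar)
    (hadj : M.IsAdjoint x K u μ z lam) {s : ℝ} (hs : 0 ≤ s) (hx : x s < M.xStar)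
    (hK : ∀ t, s < t → 0 < K t) : lam s ≠ M.r := by
  intro hl
  have hz := hadj.r'_le_z hM h.1 hs hl
  have hxpos : ∀ t, 0 ≤ t → 0 < x t := fun t ht => h.1.x_pos hM hx₀.1 ht
  -- as long as the stock stays to the left of `x^*`
  have hz' : ∀ t, s < t → (∀ q ∈ Ico s t, x q < M.xStar) → M.r' < z t := fun t ht hxt =>
    hM.r'_lt_of_le ht (hadj.z_acDeriv hM h.1 hx₀ hs ht.le)
      (fun q hq => ⟨hxpos q (hs.trans hq.1), hxt q hq⟩) hz
  have hl' : ∀ t, s < t → (∀ q ∈ Ico s t, x q < M.xStar) → lam t < M.r := fun t ht hxt => by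
    have h1 := (hadj.gap_acDeriv h.1 hs ht.le).lt_of_pos ht (by
      filter_upwards [hadj.u_eq_one h.1] with q h1 hq
      have h2 := hz' q hq.1 fun w hw => hxt w ⟨hw.1, hw.2.trans hq.2⟩
      rw [h1 (hs.trans hq.1.le) (hK q hq.1) (hM.r'_pos.trans h2), mul_one]
      exact mul_pos (sub_pos.2 h2) (Real.exp_pos _))
    rw [hl, sub_self, zero_mul] at h1
    by_contra hcon
    exact absurd (mul_nonpos_of_nonpos_of_nonneg (sub_nonpos.2 (not_lt.1 hcon))
      (Real.exp_pos (-M.κ * t)).le) h1.not_ge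
  have hμ : ∀ t, s ≤ t → (∀ q ∈ Ico s t, x q < M.xStar) → μ (Ioc s t) = 0 := fun t ht hxt =>
    hadj.measure_eq_zero fun q hq => hl' q hq.1 fun w hw => hxt w ⟨hw.1, hw.2.trans_le hq.2⟩
  obtain ⟨t, ht, hxt⟩ := h.1.exists_xStar_le hM hx₀.1 hs fun t ht hxt =>
    hμ t ht fun q hq => hxt q (Ico_subset_Icc_self hq)
  obtain ⟨ρ, hρ, hxρ, hlt⟩ := exists_first_hit ht
    (h.1.x_cont.mono fun q hq => hs.trans hq.1) hx hxt
  have hρ0 := hs.trans hρ.1.le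
  have hμρ := hμ ρ hρ.1.le hlt
  -- Full use of a decaying capital stock means a catch rate of at least `K(ρ)` up to the arrival.
  have hKρ : K ρ ≤ M.KStar := by
    refine hM.le_KStar_of_arrival hρ.1 (h.1.x_acDeriv hM hs hρ.1.le)
      (fun q hq => ⟨hxpos q (hs.trans hq.1), hlt q hq⟩) hxρ ?_
    filter_upwards [hadj.u_eq_one h.1] with q h1 hq
    have h2 := hz' q hq.1 fun w hw => hlt w ⟨hw.1, hw.2.trans hq.2⟩
    rw [h1 (hs.trans hq.1.le) (hK q hq.1) (hM.r'_pos.trans h2), one_mul,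
      h.1.K_eq_exp (hs.trans hq.1.le) hq.2.le
        (measure_mono_null (Ioc_subset_Ioc hq.1.le le_rfl) hμρ)]
    refine mul_le_of_le_one_right (hK q hq.1).le (Real.exp_le_one_iff.2 ?_)
    nlinarith [hM.γ_pos, hq.2]
  have hμ0 : μ {ρ} = 0 := measure_mono_null
    (singleton_subset_iff.2 (show ρ ∈ Ioc s ρ from ⟨hρ.1, le_rfl⟩)) hμρ
  -- The tail is optimal from `x^*` with capital at most `K^*`, so `z(ρ) = r'`, against `z > r'`
  -- after `s`.
  have h1 := h.tail hM hx₀ hρ0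
  rw [hxρ, hμ0, ENNReal.toReal_zero, sub_zero] at h1
  have h2 := (h1.adjoint_eq hM hKρ (hadj.tail hρ0 (fun t ht => hadj.z_integrable hM h.1 hx₀ ht)
    fun t ht => hadj.lam_integrable h.1 ht)).1
  rw [zero_add] at h2
  exact (hz' ρ hρ.1 hlt).ne' h2

/-- There is no investment before the stock reaches `x^*`. -/
lemma measure_Ico_eq_zero (hM : M.Standing) (h : M.IsOptimal x₀ K₀ x K u μ)
    (hx₀ : x₀ ∈ Ioo 0 M.xbar) (hK₀ : 0 ≤ K₀) (hadj : M.IsAdjoint x K u μ z lam) {τ : ℝ}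
    (hx : ∀ t ∈ Ico 0 τ, x t < M.xStar) : μ (Ico 0 τ) = 0 := by
  by_contra hμ
  obtain ⟨s, hs, hl, hpos⟩ := hadj.exists_lam_eq hμ
  exact h.lam_ne hM hx₀ hadj hs.1 (hx s hs)
    (fun t ht => h.1.K_pos hK₀ hM (hs.1.trans ht.le) (Or.inr (hpos t ht))) hl

/-- At a time at which the stock is at `x^*` and the capital stock exceeds `K^*` the switch
variable is positive. -/
lemma z_pos_of_KStar_lt (hM : M.Standing) (h : M.IsOptimal x₀ K₀ x K u μ)
    (hx₀ : x₀ ∈ Ioo 0 M.xbar) (hadj : M.IsAdjoint x K u μ z lam) {τ : ℝ} (hτ : 0 ≤ τ)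
    (hx : x τ = M.xStar) (hK : M.KStar < K τ - (μ {τ}).toReal) : 0 < z τ := by
  by_contra hz
  push Not at hz
  have hlt := hM.xTilde_lt_xStar
  have hcx : ∀ b, ContinuousOn x (Icc τ b) := fun b => h.1.x_cont.mono fun q hq => hτ.trans hq.1
  have hcz : ∀ b, ContinuousOn z (Icc τ b) := fun b => hadj.z_cont.mono fun q hq => hτ.trans hq.1
  have hmem : ∀ t, 0 ≤ t → x t ∈ Ioo 0 M.xbar := fun t ht => h.1.x_mem hM hx₀ ht
  -- fishing stops as long as the stock is to the right of `x~`
  have hneg : ∀ b, τ < b → (∀ t ∈ Ico τ b, M.xTilde < x t) → z b < 0 := by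
    intro b hb hxb
    obtain ⟨t₁, ht₁, hmax⟩ := isCompact_Icc.exists_isMaxOn (nonempty_Icc.2 hb.le)
      (hM.continuousOn_g.comp (hcx b) fun t ht => (hmem t (hτ.trans ht.1)).1)
    have hzac := hadj.z_acDeriv hM h.1 hx₀ hτ hb.le
    have hψ : ∀ t ∈ Ioo τ b, 0 < M.ψ (x t) := fun t ht =>
      hM.V4_ψ_pos _ ⟨hxb t (Ioo_subset_Ico_self ht), (hmem t (hτ.trans ht.1.le)).2⟩
    have h1 := hzac.nonpos_of_deriv_le (M := M.g (x t₁)) (by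
      refine Eventually.of_forall fun t ht hpos => ?_
      have := hψ t ht
      have h2 := hmax (Ioo_subset_Icc_self ht)
      simp only [Function.comp] at h2
      have := mul_le_mul_of_nonneg_left h2 hpos.le
      linarith) hz
    refine (hzac.lt_of_neg hb (Eventually.of_forall fun t ht => ?_)).trans_le hz
    have h2 := h1 t (Ioo_subset_Icc_self ht)
    have h3 := hmem t (hτ.trans ht.1.le)
    have h4 := hM.g_pos ⟨h3.1, h3.2.le⟩
    have := hψ t ht
    nlinarith
  -- Without fishing the stock does not decrease, so the condition under which fishing stops
  -- persists forever.
  have hxτ : ∀ b, τ ≤ b → M.xTilde < x b := by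
    intro b hb
    by_contra hcon
    push Not at hcon
    obtain ⟨ρ, hρ, hxρ, hρ'⟩ := exists_first_hit (P := fun t => -x t) (k := -M.xTilde) hb
      (hcx b).neg (by linarith) (by linarith)
    have h1 := (h.1.x_acDeriv hM hτ hρ.1.le).le_of_nonneg (by
      filter_upwards [hadj.v_eq_zero h.1] with t h1 ht
      rw [h1 (hτ.trans ht.1.le) (hneg t ht.1 fun q hq => neg_lt_neg_iff.1
        (hρ' q ⟨hq.1, hq.2.trans ht.2⟩)), zero_mul, sub_zero]
      exact (hM.V1_pos _ (hmem t (hτ.trans ht.1.le))).le)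
    linarith
  have hz' : ∀ t, τ ≤ t → z t ≤ 0 := fun t ht => by
    rcases ht.eq_or_lt with rfl | ht
    · exact hz
    · exact (hneg t ht fun q hq => hxτ q hq.1).le
  have hμ : μ (Ici τ) = 0 := hadj.measure_eq_zero fun t ht =>
    lt_of_le_of_ne (hadj.lam_le t (hτ.trans ht)) fun hl => by
      have := hadj.r'_le_z hM h.1 (hτ.trans ht) hl
      linarith [hz' t ht, hM.r'_pos]
  have hμτ : tailMeasure μ τ = 0 := by
    rw [tailMeasure, Measure.restrict_eq_zero.2 hμ, Measure.map_zero]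
  have h1 := h.tail hM hx₀ hτ
  -- Neither fishing nor investing after `τ` costs exactly zero, whereas holding, which needs no
  -- initial purchase above `K^*`, has negative cost.
  have hcost : M.cost (fun t => x (t + τ)) (fun t => K (t + τ)) (fun t => u (t + τ))
      (tailMeasure μ τ) = 0 := by
    have hv : ∀ᵐ t ∂(volume.restrict (Ici (0 : ℝ))), 0 < t → u (t + τ) * K (t + τ) = 0 := by
      rw [ae_restrict_iff' measurableSet_Ici]
      have h2 := (measurePreserving_add_right (volume : Measure ℝ) τ).quasiMeasurePreserving.ae
        (hadj.v_eq_zero h.1)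
      filter_upwards [h2] with t h2 _ ht
      exact h2 (by linarith) (hneg _ (by linarith) fun q hq => hxτ q hq.1)
    have hrc : ∀ᵐ t ∂(volume.restrict (Ici (0 : ℝ))), M.runningCost (fun t => x (t + τ))
        (fun t => K (t + τ)) (fun t => u (t + τ)) t = 0 := by
      rw [← restrict_Ioi_eq_restrict_Ici] at hv ⊢
      filter_upwards [hv, ae_restrict_mem measurableSet_Ioi] with t h2 ht
      rw [runningCost, h2 ht, mul_zero, mul_zero]
    have e1 : ∫⁻ t in Ici (0 : ℝ), ENNReal.ofReal (M.runningCost (fun t => x (t + τ))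
        (fun t => K (t + τ)) (fun t => u (t + τ)) t) = 0 := by
      rw [lintegral_congr_ae (g := fun _ => 0) (by filter_upwards [hrc] with t h2; simp [h2])]
      simp
    have e2 : ∫⁻ t in Ici (0 : ℝ), ENNReal.ofReal (-M.runningCost (fun t => x (t + τ))
        (fun t => K (t + τ)) (fun t => u (t + τ)) t) = 0 := by
      rw [lintegral_congr_ae (g := fun _ => 0) (by filter_upwards [hrc] with t h2; simp [h2])]
      simp
    rw [cost, e1, e2, hμτ]
    simp
  rw [hx] at h1
  obtain ⟨θ, hθ⟩ := hM.exists_isHoldTime (K τ - (μ {τ}).toReal)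
  have h2 := (h1.2 _ _ _ _ (hold_isAdmissible hM hθ)).trans (hold_cost_le hM hθ)
  rw [hcost, max_eq_right (by linarith), zero_mul, zero_add] at h2
  have h3 : (0 : ℝ) ≤ M.KStar * (M.γ * M.r + M.c - M.p * M.xStar) / M.δ := by exact_mod_cast h2
  refine absurd h3 (not_le.2 (div_neg_of_neg_of_pos (mul_neg_of_pos_of_neg hM.KStar_pos ?_)
    hM.δ_pos))
  have h4 := hM.cStar_lt
  have h5 : M.cStar = M.c + M.r * M.δ + M.γ * M.r := by simp only [cStar, r', κ]; ring
  have := mul_pos hM.r_pos hM.δ_pos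
  linarith

/-- An optimal process that starts to the left of `x^*` is an extremal arc without investment until
it reaches `(x^*, K^*)`. -/
theorem exists_arc (hM : M.Standing) (h : M.IsOptimal x₀ K₀ x K u μ)
    (hx₀ : x₀ ∈ Ioo 0 M.xStar) (hK₀ : 0 ≤ K₀) (hadj : M.IsAdjoint x K u μ z lam) :
    ∃ τ, M.Arc K₀ τ x z (fun t => u t * K t) ∧ μ (Ico 0 τ) = 0 ∧ K τ = M.KStar ∧
      (∀ t ∈ Ico 0 τ, K t = K₀ * Real.exp (-M.γ * t)) ∧ lam 0 < M.r := by
  have hx₀' : x₀ ∈ Ioo 0 M.xbar := ⟨hx₀.1, hx₀.2.trans hM.V4_xStar.2⟩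
  have hmem : ∀ t, 0 ≤ t → x t ∈ Ioo 0 M.xbar := fun t ht => h.1.x_mem hM hx₀' ht
  obtain ⟨t, ht, hxt⟩ := h.1.exists_xStar_le hM hx₀.1 le_rfl fun t ht hxt => by
    -- A little room beyond `t` is needed: the absence of investment is known on half-open intervals
    -- `[0, b)`, and `t` itself must be covered.
    have hc : ∃ b, t < b ∧ ∀ s ∈ Icc t b, x s < M.xStar := by
      obtain ⟨b, hb, hb'⟩ := ContinuousOn.exists_forall_Icc_lt_right (lt_add_one t)
        (h.1.x_cont.mono fun s hs => ht.trans hs.1) (hxt t ⟨ht, le_rfl⟩)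
      exact ⟨b, hb.1, hb'⟩
    obtain ⟨b, hb, hb'⟩ := hc
    refine measure_mono_null
      (show Ioc 0 t ⊆ Ico 0 b from fun s hs => ⟨hs.1.le, hs.2.trans_lt hb⟩)
      (h.measure_Ico_eq_zero hM hx₀' hK₀ hadj (τ := b) fun s hs => ?_)
    rcases le_total s t with h1 | h1
    · exact hxt s ⟨hs.1, h1⟩
    · exact hb' s ⟨h1, hs.2.le⟩
  obtain ⟨τ, hτ, hxτ, hlt⟩ := exists_first_hit ht (h.1.x_cont.mono fun s hs => hs.1)
    (by rw [h.1.x_zero]; exact hx₀.2) hxt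
  have hτ0 := hτ.1.le
  have hxmem : ∀ t ∈ Ico 0 τ, x t ∈ Ioo 0 M.xStar := fun t ht => ⟨(hmem t ht.1).1, hlt t ht⟩
  have hμ := h.measure_Ico_eq_zero hM hx₀' hK₀ hadj hlt
  have hK0 : K 0 = K₀ := by
    rw [h.1.K_zero, measure_mono_null
      (singleton_subset_iff.2 (show (0 : ℝ) ∈ Ico 0 τ from ⟨le_rfl, hτ.1⟩)) hμ]
    simp
  have hK : ∀ t ∈ Ico 0 τ, K t = K₀ * Real.exp (-M.γ * t) := fun t ht => by
    rw [h.1.K_eq_exp le_rfl ht.1 (measure_mono_null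
      (show Ioc 0 t ⊆ Ico 0 τ from fun s hs => ⟨hs.1.le, hs.2.trans_lt ht.2⟩) hμ), hK0, sub_zero]
  have hKτ : K τ - (μ {τ}).toReal = K₀ * Real.exp (-M.γ * τ) := by
    rw [h.1.K_left_eq hτ0, hμ]
    have e1 : ∫ s in (0 : ℝ)..τ, M.γ * K s =
        ∫ s in (0 : ℝ)..τ, -(K₀ * (-M.γ * Real.exp (-M.γ * s))) := by
      refine intervalIntegral.integral_congr_ae ?_
      have hne : ∀ᵐ s : ℝ, s ≠ τ := by simp [ae_iff, measure_singleton]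
      filter_upwards [hne] with s h1 hs
      rw [uIoc_of_le hτ0] at hs
      rw [hK s ⟨hs.1.le, lt_of_le_of_ne hs.2 h1⟩]
      ring
    rw [e1, intervalIntegral.integral_neg, intervalIntegral.integral_const_mul,
      (ACDeriv.exp hτ0 (-M.γ)).integral_eq]
    simp
    ring
  -- Otherwise `z(τ) > 0`, so all capital is used shortly before `τ` at a catch rate above `K^*`,
  -- which does not let the stock rise to `x^*`.
  have hle : K τ - (μ {τ}).toReal ≤ M.KStar := by
    by_contra hcon
    push Not at hcon
    have hz := h.z_pos_of_KStar_lt hM hx₀' hadj hτ0 hxτ hcon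
    have hKp : 0 < K₀ := by
      refine lt_of_le_of_ne hK₀ fun h0 => ?_
      rw [hKτ, ← h0, zero_mul] at hcon
      exact absurd hM.KStar_pos hcon.not_gt
    obtain ⟨s, hs, hs'⟩ := ContinuousOn.exists_forall_Icc_lt_left (P := fun t => -z t) (k := 0)
      hτ.1 (hadj.z_cont.mono fun t ht => ht.1).neg (by linarith)
    refine absurd (hM.le_KStar_of_arrival hs.2 (h.1.x_acDeriv hM hs.1 hs.2.le)
      (fun q hq => hxmem q ⟨hs.1.trans hq.1, hq.2⟩) hxτ ?_) hcon.not_ge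
    filter_upwards [hadj.u_eq_one h.1] with q h1 hq
    have hq0 := hs.1.trans hq.1.le
    have h2 := hs' q (Ioo_subset_Icc_self hq)
    rw [h1 hq0 (h.1.K_pos hK₀ hM hq0 (Or.inl hKp)) (by linarith), one_mul, hK q ⟨hq0, hq.2⟩, hKτ]
    refine mul_le_mul_of_nonneg_left (Real.exp_le_exp.2 ?_) hK₀
    nlinarith [hM.γ_pos, hq.2]
  have h1 := h.tail hM hx₀' hτ0
  rw [hxτ] at h1
  -- Part (a) applied to the optimal tail supplies the end condition of the arc and the jump to
  -- `K^*`.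
  have hzτ : z τ = M.r' := by
    have := (h1.adjoint_eq hM hle (hadj.tail hτ0 (fun t ht => hadj.z_integrable hM h.1 hx₀' ht)
      fun t ht => hadj.lam_integrable h.1 ht)).1
    rwa [zero_add] at this
  have hKτ' : K τ = M.KStar := by
    have := (h1.eq_xStar hM hle 0 le_rfl).2
    rwa [zero_add] at this
  have harc : M.Arc K₀ τ x z (fun t => u t * K t) := by
    refine ⟨hτ.1, h.1.x_acDeriv hM le_rfl hτ0, hadj.z_acDeriv hM h.1 hx₀' le_rfl hτ0, hxmem, hxτ,
      hzτ, ?_⟩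
    filter_upwards [h.1.v_nonneg, h.1.v_le, (ae_restrict_iff' measurableSet_Ici).1 hadj.max_cond]
      with t h2 h3 h4 ht
    rw [← hK t (Ioo_subset_Ico_self ht)]
    refine ⟨⟨h2 ht.1.le, h3 ht.1.le⟩, fun w hw => ?_⟩
    rcases (h.1.K_nonneg t ht.1.le).eq_or_lt with h5 | h5
    · rw [← h5] at hw ⊢
      rw [le_antisymm hw.2 hw.1, mul_zero, mul_zero, mul_zero]
    · have h6 := h4 ht.1.le (w / K t) ⟨div_nonneg hw.1 h5.le, (div_le_one h5).2 hw.2⟩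
      rw [mul_assoc, mul_div_cancel₀ _ h5.ne'] at h6
      linarith
  refine ⟨τ, harc, hμ, hKτ', hK, lt_of_le_of_ne (hadj.lam_le 0 le_rfl) fun hl => ?_⟩
  exact absurd (hadj.r'_le_z hM h.1 le_rfl hl) (not_le.2 (harc.z_lt hM ⟨le_rfl, hτ.1⟩))

end IsOptimal
end Fishery


/-! ### The time-reversed flow -/

lemma ACDeriv.of_hasDerivWithinAt {φ φ' : ℝ → ℝ} {a b : ℝ} (hab : a ≤ b)
    (h : ∀ t ∈ Icc a b, HasDerivWithinAt φ (φ' t) (Icc a b) t) (hc : ContinuousOn φ' (Icc a b)) :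
    ACDeriv φ φ' a b := by
  have hi : IntervalIntegrable φ' volume a b :=
    ContinuousOn.intervalIntegrable (by rwa [uIcc_of_le hab])
  refine ACDeriv.of_integral hab hi (k := φ a) fun t ht => ?_
  rw [intervalIntegral.integral_eq_sub_of_hasDerivAt_of_le ht.1
    (fun s hs => (h s ⟨hs.1, hs.2.trans ht.2⟩).continuousWithinAt.mono
      (Icc_subset_Icc le_rfl ht.2))
    (fun s hs => (h s ⟨hs.1.le, hs.2.le.trans ht.2⟩).hasDerivAt
      (Icc_mem_nhds hs.1 (hs.2.trans_le ht.2)))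
    (hi.mono_set (by rw [uIcc_of_le ht.1, uIcc_of_le hab]; exact Icc_subset_Icc le_rfl ht.2))]
  ring

/-- A bounded Lipschitz scalar equation with a linear parameter has a flow that is jointly
continuous in the parameter and time. -/
lemma exists_continuousOn_flow {f : ℝ → ℝ} {L : NNReal} {B : ℝ} (hf : LipschitzWith L f)
    (hB : ∀ y, |f y| ≤ B) {γ : ℝ} (hγ : 0 ≤ γ) (y₀ : ℝ) {kmax T : ℝ} (hk : 0 ≤ kmax)
    (hT : 0 ≤ T) :
    ∃ Y : ℝ × ℝ → ℝ, ContinuousOn Y (Icc 0 kmax ×ˢ Icc 0 T) ∧ ∀ k ∈ Icc 0 kmax, Y (k, 0) = y₀ ∧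
      ∀ t ∈ Icc 0 T, HasDerivWithinAt (fun s => Y (k, s))
        (-f (Y (k, t)) + k * Real.exp (γ * t)) (Icc 0 T) t := by
  have hB0 : 0 ≤ B := (abs_nonneg _).trans (hB 0)
  set e := Real.exp (γ * T)
  have he : 0 < e := Real.exp_pos _
  have hexp : ∀ t ∈ Icc 0 T, Real.exp (γ * t) ≤ e := fun t ht =>
    Real.exp_le_exp.2 (mul_le_mul_of_nonneg_left ht.2 hγ)
  set q : ℝ → ℝ := fun k => projIcc 0 kmax hk k
  have hq : ∀ k, q k ∈ Icc 0 kmax := fun k => (projIcc 0 kmax hk k).2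
  have hqk : ∀ k ∈ Icc 0 kmax, q k = k := fun k hk' => by
    simp only [q, projIcc_of_mem hk hk']
  have hqL : ∀ a b, |q a - q b| ≤ |a - b| := fun a b => by
    have := (LipschitzWith.projIcc hk).dist_le_mul a b
    simpa [Subtype.dist_eq, Real.dist_eq] using this
  -- The parameter becomes a second, constant component of the state, so continuity in the initial
  -- value yields continuity in `k`. Clamping by `q` keeps the field bounded.
  set V : ℝ → ℝ × ℝ → ℝ × ℝ := fun t P => (-f P.1 + q P.2 * Real.exp (γ * t), 0)
  have hpl : IsPicardLindelof V (tmin := 0) (tmax := T) ⟨0, le_rfl, hT⟩ (y₀, 0)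
      (((B + kmax * e) * T + kmax).toNNReal) kmax.toNNReal (B + kmax * e).toNNReal
      (L + e.toNNReal) := by
    refine ⟨fun t ht => LipschitzWith.lipschitzOnWith (LipschitzWith.of_dist_le_mul fun P Q => ?_),
      fun P _ => by fun_prop, fun t ht P _ => ?_, ?_⟩
    · have e1 := hf.dist_le_mul P.1 Q.1
      have e2 := hqL P.2 Q.2
      have e3 : dist P.1 Q.1 ≤ dist P Q := le_max_left _ _
      have e4 : dist P.2 Q.2 ≤ dist P Q := le_max_right _ _
      rw [Prod.dist_eq]
      simp only [V, dist_self]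
      refine max_le ?_ (by positivity)
      rw [Real.dist_eq] at *
      have e5 : -f P.1 + q P.2 * Real.exp (γ * t) - (-f Q.1 + q Q.2 * Real.exp (γ * t)) =
          -(f P.1 - f Q.1) + (q P.2 - q Q.2) * Real.exp (γ * t) := by ring
      rw [e5]
      refine (abs_add_le _ _).trans ?_
      rw [abs_neg, abs_mul, abs_of_pos (Real.exp_pos (γ * t)), NNReal.coe_add, add_mul,
        Real.coe_toNNReal _ he.le]
      refine add_le_add (e1.trans (mul_le_mul_of_nonneg_left e3 L.2)) ?_
      rw [mul_comm]
      exact mul_le_mul (hexp t ht) (e2.trans e4) (abs_nonneg _) he.le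
    · rw [Prod.norm_def, Real.coe_toNNReal _ (by positivity)]
      simp only [V, norm_zero]
      refine max_le ((norm_add_le _ _).trans (add_le_add ?_ ?_)) (by positivity)
      · rw [norm_neg]; exact hB _
      · rw [Real.norm_eq_abs, abs_of_nonneg (mul_nonneg (hq _).1 (Real.exp_pos _).le)]
        exact mul_le_mul (hq _).2 (hexp t ht) (Real.exp_pos _).le hk
    · rw [Real.coe_toNNReal _ (by positivity), Real.coe_toNNReal _ (by positivity),
        Real.coe_toNNReal _ hk]
      simp [hT]
  obtain ⟨α, hα, hαc⟩ := hpl.exists_forall_mem_closedBall_eq_hasDerivWithinAt_continuousOn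
  have hball : ∀ k ∈ Icc 0 kmax, ((y₀, k) : ℝ × ℝ) ∈
      Metric.closedBall ((y₀, 0) : ℝ × ℝ) (kmax.toNNReal : ℝ) := fun k hk' => by
    rw [Metric.mem_closedBall, Prod.dist_eq, Real.coe_toNNReal _ hk]
    simp only [dist_self, Real.dist_eq, sub_zero]
    exact max_le hk (by rw [abs_of_nonneg hk'.1]; exact hk'.2)
  have hsnd : ∀ k ∈ Icc 0 kmax, ∀ t ∈ Icc 0 T, (α ((y₀, k), t)).2 = k := fun k hk' t ht => by
    obtain ⟨h0, hd⟩ := hα _ (hball k hk')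
    have h1 : ACDeriv (fun s => (α ((y₀, k), s)).2) (fun _ => 0) 0 T :=
      ACDeriv.of_hasDerivWithinAt hT (fun s hs => by
        exact (hasFDerivAt_snd (𝕜 := ℝ) (p := α ((y₀, k), s))).comp_hasDerivWithinAt s (hd s hs))
        continuousOn_const
    have h2 := (h1.mono le_rfl ht.1 ht.2).eq_of_zero (Eventually.of_forall fun _ _ => rfl)
    rw [h2]
    exact congrArg Prod.snd h0
  refine ⟨fun P => (α ((y₀, P.1), P.2)).1, ?_, fun k hk' => ?_⟩
  · refine continuous_fst.comp_continuousOn (hαc.comp (by fun_prop) fun P hP => ?_)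
    exact ⟨hball _ hP.1, hP.2⟩
  · obtain ⟨h0, hd⟩ := hα _ (hball k hk')
    refine ⟨congrArg Prod.fst h0, fun t ht => ?_⟩
    have h1 := (hasFDerivAt_fst (𝕜 := ℝ) (p := α ((y₀, k), t))).comp_hasDerivWithinAt t (hd t ht)
    refine HasDerivWithinAt.congr_deriv h1 ?_
    simp [V, hsnd k hk' t ht, hqk k hk']

namespace Fishery
variable {M : Fishery}

/-- The relative growth rate as a function of the logarithm of the stock, frozen to the right of
`x^*`. -/
def growth (M : Fishery) (y : ℝ) : ℝ := M.rate (Real.exp (min y (Real.log M.xStar)))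

namespace Standing
variable (hM : M.Standing)
include hM

lemma exp_min_mem (y : ℝ) : Real.exp (min y (Real.log M.xStar)) ∈ Ioc 0 M.xStar := by
  refine ⟨Real.exp_pos _, ?_⟩
  calc Real.exp (min y (Real.log M.xStar)) ≤ Real.exp (Real.log M.xStar) :=
        Real.exp_le_exp.2 (min_le_right _ _)
    _ = M.xStar := Real.exp_log hM.xStar_pos

omit hM in
lemma growth_of_le {y : ℝ} (hy : y ≤ Real.log M.xStar) : M.growth y = M.rate (Real.exp y) := by
  rw [growth, min_eq_left hy]

omit hM in
lemma growth_log {y : ℝ} (hy : y ∈ Ioc 0 M.xStar) : M.growth (Real.log y) = M.rate y := by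
  rw [growth_of_le (Real.log_le_log hy.1 hy.2), Real.exp_log hy.1]

lemma growth_of_ge {y : ℝ} (hy : Real.log M.xStar ≤ y) : M.growth y = M.KStar := by
  rw [growth, min_eq_right hy, Real.exp_log hM.xStar_pos]; rfl

lemma growth_antitone : Antitone M.growth := fun y₁ y₂ h => by
  have h1 := hM.exp_min_mem y₁
  have h2 := hM.exp_min_mem y₂
  have h3 := hM.V4_xStar.2.le
  exact hM.strictAntiOn_rate.antitoneOn ⟨h1.1, h1.2.trans h3⟩ ⟨h2.1, h2.2.trans h3⟩
    (Real.exp_le_exp.2 (min_le_min_right _ h))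

lemma KStar_le_growth (y : ℝ) : M.KStar ≤ M.growth y := by
  rw [← hM.growth_of_ge (le_max_right y _)]
  exact hM.growth_antitone (le_max_left _ _)

lemma rate_lt_δ {y : ℝ} (hy : y ∈ Ioc 0 M.xbar) : M.rate y < M.δ := by
  obtain ⟨ξ, hξ, h⟩ := exists_deriv_eq_slope M.F hy.1
    (hM.continuousOn_F.mono fun t ht => ht.1)
    (fun t ht => (hM.hasDerivAt ht.1).differentiableAt.differentiableWithinAt)
  rw [hM.V1_zero, sub_zero, sub_zero] at h
  rw [rate, ← h]
  exact hM.deriv_lt_δ ⟨hξ.1, hξ.2.le.trans hy.2⟩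

lemma growth_lt_δ (y : ℝ) : M.growth y < M.δ :=
  hM.rate_lt_δ ⟨(hM.exp_min_mem y).1, (hM.exp_min_mem y).2.trans hM.V4_xStar.2.le⟩

/-- In the logarithmic variable the derivative of the rate is `F' - F/x`, which stays bounded as the
stock tends to zero because `F/x < δ` and `F' ≥ F'(x^*)`. -/
lemma exists_growth_lipschitz : ∃ L : NNReal, LipschitzWith L M.growth := by
  have h0 : 0 ≤ M.δ - deriv M.F M.xStar :=
    sub_nonneg.2 (hM.deriv_lt_δ ⟨hM.xStar_pos, hM.V4_xStar.2.le⟩).le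
  have h1 : ∀ y ∈ Iic (Real.log M.xStar), HasDerivWithinAt (fun y => M.rate (Real.exp y))
      (deriv M.F (Real.exp y) - M.rate (Real.exp y)) (Iic (Real.log M.xStar)) y := fun y _ => by
    have := ((hM.hasDerivAt_rate (Real.exp_pos y)).comp y (Real.hasDerivAt_exp y)).hasDerivWithinAt
      (s := Iic (Real.log M.xStar))
    refine this.congr_deriv ?_
    rw [div_mul_cancel₀ _ (Real.exp_pos y).ne']
  have h2 : ∀ y ∈ Iic (Real.log M.xStar),
      ‖deriv M.F (Real.exp y) - M.rate (Real.exp y)‖ ≤ M.δ - deriv M.F M.xStar := fun y hy => by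
    have e1 : Real.exp y ∈ Ioc 0 M.xStar := by
      have := hM.exp_min_mem y
      rwa [min_eq_left (mem_Iic.1 hy)] at this
    have e2 : Real.exp y ∈ Ioc 0 M.xbar := ⟨e1.1, e1.2.trans hM.V4_xStar.2.le⟩
    have e3 := hM.rate_lt_δ e2
    have e4 := hM.deriv_lt_rate e2
    have e5 := hM.strictAntiOn_deriv.antitoneOn e2 ⟨hM.xStar_pos, hM.V4_xStar.2.le⟩ e1.2
    rw [Real.norm_eq_abs, abs_of_neg (by linarith)]
    linarith
  refine ⟨(M.δ - deriv M.F M.xStar).toNNReal, LipschitzWith.of_dist_le_mul fun a b => ?_⟩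
  have h3 := Convex.norm_image_sub_le_of_norm_hasDerivWithin_le h1 h2 (convex_Iic _)
    (x := min b (Real.log M.xStar)) (y := min a (Real.log M.xStar))
    (mem_Iic.2 (min_le_right _ _)) (mem_Iic.2 (min_le_right _ _))
  rw [Real.dist_eq, Real.dist_eq, Real.coe_toNNReal _ h0]
  refine h3.trans (mul_le_mul_of_nonneg_left ?_ h0)
  have := abs_min_sub_min_le_max a (Real.log M.xStar) b (Real.log M.xStar)
  simpa using this

end Standing

/-- The time-reversed system with `u ≡ 1`, `μ ≡ 0` in terms of the logarithm `y` of the stock, on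
`[0, τ]`. -/
structure RevTraj (M : Fishery) (k τ : ℝ) (y z : ℝ → ℝ) : Prop where
  y_zero : y 0 = Real.log M.xStar
  z_zero : z 0 = M.r'
  y_ac : ACDeriv y (fun t => -M.growth (y t) + k * Real.exp (M.γ * t)) 0 τ
  z_ac : ACDeriv z (fun t => M.ψ (Real.exp (y t)) - z t * M.g (Real.exp (y t))) 0 τ

namespace RevTraj
variable {k τ τ' a b : ℝ} {y z y' z' : ℝ → ℝ}

lemma nonneg (h : M.RevTraj k τ y z) : 0 ≤ τ := h.y_ac.le

lemma mono (h : M.RevTraj k τ y z) (h0 : 0 ≤ τ') (h1 : τ' ≤ τ) : M.RevTraj k τ' y z :=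
  ⟨h.y_zero, h.z_zero, h.y_ac.mono le_rfl h0 h1, h.z_ac.mono le_rfl h0 h1⟩

lemma y_cont (h : M.RevTraj k τ y z) (ha : 0 ≤ a) (hb : b ≤ τ) : ContinuousOn y (Icc a b) :=
  h.y_ac.continuousOn.mono (Icc_subset_Icc ha hb)

lemma z_cont (h : M.RevTraj k τ y z) (ha : 0 ≤ a) (hb : b ≤ τ) : ContinuousOn z (Icc a b) :=
  h.z_ac.continuousOn.mono (Icc_subset_Icc ha hb)

lemma exists_g_bound (hM : M.Standing) (h : M.RevTraj k τ y z) (ha : 0 ≤ a) (hb : b ≤ τ) :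
    ∃ C, ∀ t ∈ Icc a b, |M.g (Real.exp (y t))| ≤ C := by
  have := isCompact_Icc.exists_bound_of_continuousOn (hM.continuousOn_g.comp
    (Real.continuous_exp.comp_continuousOn (h.y_cont ha hb)) fun t _ => Real.exp_pos (y t))
  simpa using this

/-- Reversed capital `k e^{γt}` never decreases, so once it matches the growth rate the stock cannot
fall below its present level. A dip would raise the growth rate and feed itself; the Lipschitz bound
and Gronwall rule this out. -/
lemma le_of_growth_le (hM : M.Standing) (h : M.RevTraj k τ y z) (hk : 0 ≤ k) (ha : 0 ≤ a)
    (hab : a ≤ b) (hb : b ≤ τ) (hg : M.growth (y a) ≤ k * Real.exp (M.γ * a)) : y a ≤ y b := by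
  obtain ⟨L, hL⟩ := hM.exists_growth_lipschitz
  have h1 := ((ACDeriv.const hab (y a)).sub (h.y_ac.mono ha hab hb)).nonpos_of_deriv_le (M := L) (by
    refine Eventually.of_forall fun t ht hpos => ?_
    have e1 := hL.dist_le_mul (y t) (y a)
    rw [Real.dist_eq, Real.dist_eq, abs_sub_comm (y t) (y a), abs_of_pos hpos] at e1
    have e2 := le_abs_self (M.growth (y t) - M.growth (y a))
    have e3 : Real.exp (M.γ * a) ≤ Real.exp (M.γ * t) :=
      Real.exp_le_exp.2 (mul_le_mul_of_nonneg_left ht.1.le hM.γ_pos.le)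
    have e4 := mul_le_mul_of_nonneg_left e3 hk
    linarith) (by simp)
  have := h1 b ⟨hab, le_rfl⟩
  linarith

lemma lt_of_growth_lt (hM : M.Standing) (h : M.RevTraj k τ y z) (hk : 0 ≤ k) (ha : 0 ≤ a)
    (hab : a < b) (hb : b ≤ τ) (hg : M.growth (y a) < k * Real.exp (M.γ * a)) : y a < y b := by
  refine (h.y_ac.mono ha hab.le hb).lt_of_pos hab (Eventually.of_forall fun t ht => ?_)
  have e1 := hM.growth_antitone (h.le_of_growth_le hM hk ha ht.1.le (ht.2.le.trans hb) hg.le)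
  have e3 : Real.exp (M.γ * a) ≤ Real.exp (M.γ * t) :=
    Real.exp_le_exp.2 (mul_le_mul_of_nonneg_left ht.1.le hM.γ_pos.le)
  have e4 := mul_le_mul_of_nonneg_left e3 hk
  linarith

/-- If growth still balances capital at `b`, it did so whenever the stock was smaller, since capital
was smaller too. So the stock could not have risen to its level at `b`. -/
lemma le_of_le_growth (hM : M.Standing) (h : M.RevTraj k τ y z) (hk : 0 ≤ k) (ha : 0 ≤ a)
    (hab : a ≤ b) (hb : b ≤ τ) (hg : k * Real.exp (M.γ * b) ≤ M.growth (y b)) : y b ≤ y a := by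
  by_contra hcon
  push Not at hcon
  obtain ⟨s, hs, hsy, hlt⟩ := exists_first_hit hab (h.y_cont ha hb) hcon le_rfl
  have h1 := (h.y_ac.mono ha hs.1.le (hs.2.trans hb)).le_of_nonpos (by
    refine Eventually.of_forall fun t ht => ?_
    have e1 := hM.growth_antitone (hlt t ⟨ht.1.le, ht.2⟩).le
    have e3 : Real.exp (M.γ * t) ≤ Real.exp (M.γ * b) :=
      Real.exp_le_exp.2 (mul_le_mul_of_nonneg_left (ht.2.le.trans hs.2) hM.γ_pos.le)
    have e4 := mul_le_mul_of_nonneg_left e3 hk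
    linarith)
  linarith

/-- At a point at or above `log x^*` the growth is `K^*`. If the capital is at least that, the
trajectory never comes back; if less, it has been descending strictly from `log x^*` all the time.
-/
lemma lt_log_xStar (hM : M.Standing) (h : M.RevTraj k τ y z) (hk : 0 ≤ k)
    (hy : y τ < Real.log M.xStar) {t : ℝ} (ht : t ∈ Ioc 0 τ) : y t < Real.log M.xStar := by
  by_contra hcon
  push Not at hcon
  rcases le_or_gt (M.growth (y t)) (k * Real.exp (M.γ * t)) with hg | hg
  · have := h.le_of_growth_le hM hk ht.1.le ht.2 le_rfl hg
    linarith
  · have h1 := (h.y_ac.mono le_rfl ht.1.le ht.2).lt_of_neg ht.1 (by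
      refine Eventually.of_forall fun s hs => ?_
      have e1 := hM.KStar_le_growth (y s)
      rw [hM.growth_of_ge hcon] at hg
      have e3 : Real.exp (M.γ * s) ≤ Real.exp (M.γ * t) :=
        Real.exp_le_exp.2 (mul_le_mul_of_nonneg_left hs.2.le hM.γ_pos.le)
      have e4 := mul_le_mul_of_nonneg_left e3 hk
      linarith)
    rw [h.y_zero] at h1
    linarith

lemma le_log_xStar (hM : M.Standing) (h : M.RevTraj k τ y z) (hk : 0 ≤ k)
    (hy : y τ < Real.log M.xStar) {t : ℝ} (ht : t ∈ Icc 0 τ) : y t ≤ Real.log M.xStar := by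
  rcases ht.1.eq_or_lt with rfl | h0
  · exact h.y_zero.le
  · exact (h.lt_log_xStar hM hk hy ⟨h0, ht.2⟩).le

lemma lt_KStar (hM : M.Standing) (h : M.RevTraj k τ y z) (hk : 0 ≤ k)
    (hy : y τ < Real.log M.xStar) : k < M.KStar := by
  by_contra hcon
  push Not at hcon
  have := h.le_of_growth_le hM hk le_rfl h.nonneg le_rfl (by
    rw [h.y_zero, hM.growth_of_ge le_rfl, mul_zero, Real.exp_zero, mul_one]; exact hcon)
  rw [h.y_zero] at this
  linarith

/-- `ψ ≥ 0` between `x~` and `x^*`, so `z' ≥ -C z` there, and a positive `z` stays positive. -/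
lemma z_pos (hM : M.Standing) (h : M.RevTraj k τ y z) (ha : 0 ≤ a) (hab : a ≤ b) (hb : b ≤ τ)
    (hz : 0 < z a) (hy : ∀ t ∈ Icc a b, Real.log M.xTilde ≤ y t ∧ y t ≤ Real.log M.xStar) :
    0 < z b := by
  by_contra hcon
  push Not at hcon
  obtain ⟨s, hs, hsz, hpos⟩ := exists_first_hit (P := fun t => -z t) (k := 0) hab
    (h.z_cont ha hb).neg (by linarith) (by linarith)
  obtain ⟨C, hC⟩ := h.exists_g_bound hM ha hb
  have h1 := ((h.z_ac.mono ha hs.1.le (hs.2.trans hb)).mul_exp C).le_of_nonneg (by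
    refine Eventually.of_forall fun t ht => mul_nonneg ?_ (Real.exp_pos _).le
    have htb : t ∈ Icc a b := ⟨ht.1.le, ht.2.le.trans hs.2⟩
    have e1 := (abs_le.1 (hC t htb)).2
    have e2 := hpos t ⟨ht.1.le, ht.2⟩
    have e3 : 0 ≤ M.ψ (Real.exp (y t)) := by
      have f1 : M.xTilde ≤ Real.exp (y t) := (Real.log_le_iff_le_exp hM.xTilde_pos).1 (hy t htb).1
      have f2 : Real.exp (y t) ≤ M.xStar := by
        rw [← Real.exp_log hM.xStar_pos]; exact Real.exp_le_exp.2 (hy t htb).2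
      rcases f1.eq_or_lt with f3 | f3
      · rw [← f3, hM.V4_ψ_zero]
      · exact (hM.V4_ψ_pos _ ⟨f3, f2.trans_lt hM.V4_xStar.2⟩).le
    nlinarith)
  have h2 : z s = 0 := by linarith
  simp only [h2, zero_mul] at h1
  exact absurd (mul_pos hz (Real.exp_pos (C * a))) h1.not_gt

lemma unique (hM : M.Standing) (h : M.RevTraj k τ y z) (h' : M.RevTraj k τ y' z') :
    ∀ t ∈ Icc 0 τ, y t = y' t ∧ z t = z' t := by
  obtain ⟨L, hL⟩ := hM.exists_growth_lipschitz
  have hy : ∀ t ∈ Icc 0 τ, y t = y' t := by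
    have hD := h.y_ac.sub h'.y_ac
    have h1 := (hD.mul hD).nonpos_of_deriv_le (M := 2 * L) (by
      refine Eventually.of_forall fun t ht _ => ?_
      have e1 := hL.dist_le_mul (y t) (y' t)
      rw [Real.dist_eq, Real.dist_eq] at e1
      have e2 := mul_le_mul_of_nonneg_left e1 (abs_nonneg (y t - y' t))
      have e3 := neg_abs_le ((y t - y' t) * (M.growth (y t) - M.growth (y' t)))
      rw [abs_mul] at e3
      have e4 := abs_mul_abs_self (y t - y' t)
      nlinarith) (by simp [h.y_zero, h'.y_zero])
    intro t ht
    have := mul_self_eq_zero.1 (le_antisymm (h1 t ht) (mul_self_nonneg _))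
    linarith
  obtain ⟨C, hC⟩ := h.exists_g_bound hM le_rfl le_rfl
  have hD := h.z_ac.sub h'.z_ac
  have h1 := (hD.mul hD).nonpos_of_deriv_le (M := 2 * C) (by
    refine Eventually.of_forall fun t ht _ => ?_
    have e1 := (abs_le.1 (hC t (Ioo_subset_Icc_self ht))).1
    have e2 := mul_self_nonneg (z t - z' t)
    rw [← hy t (Ioo_subset_Icc_self ht)]
    nlinarith) (by simp [h.z_zero, h'.z_zero])
  intro t ht
  refine ⟨hy t ht, ?_⟩
  have := mul_self_eq_zero.1 (le_antisymm (h1 t ht) (mul_self_nonneg _))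
  linarith

end RevTraj

/-- The reversed trajectories form a jointly continuous family. -/
lemma Standing.exists_revTraj (hM : M.Standing) {kmax T : ℝ} (hk : 0 ≤ kmax) (hT : 0 ≤ T) :
    ∃ Y Z : ℝ × ℝ → ℝ, Continuous Y ∧ Continuous Z ∧ ∀ k ∈ Icc 0 kmax,
      M.RevTraj k T (fun t => Y (k, t)) (fun t => Z (k, t)) ∧ ∀ t ∈ Icc 0 T,
        HasDerivWithinAt (fun t => Y (k, t))
          (-M.growth (Y (k, t)) + k * Real.exp (M.γ * t)) (Icc 0 T) t ∧
        HasDerivWithinAt (fun t => Z (k, t)) (M.ψ (Real.exp (Y (k, t))) -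
          Z (k, t) * M.g (Real.exp (Y (k, t)))) (Icc 0 T) t := by
  obtain ⟨L, hL⟩ := hM.exists_growth_lipschitz
  obtain ⟨Y₀, hc₀, hY₀⟩ := exists_continuousOn_flow hL (B := M.δ) (fun y => by
    rw [abs_of_pos (hM.KStar_pos.trans_le (hM.KStar_le_growth y))]
    exact (hM.growth_lt_δ y).le) hM.γ_pos.le (Real.log M.xStar) hk hT
  set Y : ℝ × ℝ → ℝ := fun P => Y₀ (projIcc 0 kmax hk P.1, projIcc 0 T hT P.2)
  have hY : Continuous Y := hc₀.comp_continuous (by fun_prop) fun P =>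
    ⟨(projIcc 0 kmax hk P.1).2, (projIcc 0 T hT P.2).2⟩
  have hYe : ∀ k ∈ Icc 0 kmax, ∀ t ∈ Icc 0 T, Y (k, t) = Y₀ (k, t) := fun k hk' t ht => by
    simp only [Y, projIcc_of_mem hk hk', projIcc_of_mem hT ht]
  have hg : Continuous fun P => M.g (Real.exp (Y P)) :=
    hM.continuousOn_g.comp_continuous (Real.continuous_exp.comp hY) fun P => Real.exp_pos _
  have hψ : Continuous fun P => M.ψ (Real.exp (Y P)) :=
    hM.continuousOn_ψ.comp_continuous (Real.continuous_exp.comp hY) fun P => Real.exp_pos _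
  set G : ℝ × ℝ → ℝ := fun P => ∫ t in (0 : ℝ)..P.2, M.g (Real.exp (Y (P.1, t)))
  have hG : Continuous G := intervalIntegral.continuous_parametric_primitive_of_continuous
    (f := fun k t => M.g (Real.exp (Y (k, t)))) hg
  have hE : Continuous fun P => Real.exp (G P) * M.ψ (Real.exp (Y P)) :=
    (Real.continuous_exp.comp hG).mul hψ
  set I : ℝ × ℝ → ℝ := fun P =>
    ∫ t in (0 : ℝ)..P.2, Real.exp (G (P.1, t)) * M.ψ (Real.exp (Y (P.1, t)))
  have hI : Continuous I := intervalIntegral.continuous_parametric_primitive_of_continuous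
    (f := fun k t => Real.exp (G (k, t)) * M.ψ (Real.exp (Y (k, t)))) hE
  -- Variation of constants for the linear equation of `z`, so joint continuity is inherited from
  -- `Y`.
  set Z : ℝ × ℝ → ℝ := fun P => Real.exp (-G P) * (M.r' + I P)
  have hZ : Continuous Z := by fun_prop
  have hZd : ∀ k t, HasDerivAt (fun t => Z (k, t)) (M.ψ (Real.exp (Y (k, t))) -
      Z (k, t) * M.g (Real.exp (Y (k, t)))) t := fun k t => by
    have d1 : HasDerivAt (fun t => G (k, t)) (M.g (Real.exp (Y (k, t)))) t :=
      ((hg.comp (Continuous.prodMk_right k)).integral_hasStrictDerivAt 0 t).hasDerivAt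
    have d2 : HasDerivAt (fun t => I (k, t)) (Real.exp (G (k, t)) * M.ψ (Real.exp (Y (k, t)))) t :=
      ((hE.comp (Continuous.prodMk_right k)).integral_hasStrictDerivAt 0 t).hasDerivAt
    refine (d1.neg.exp.mul (d2.const_add M.r')).congr_deriv ?_
    have e1 : Real.exp (-G (k, t)) * (Real.exp (G (k, t)) * M.ψ (Real.exp (Y (k, t)))) =
        M.ψ (Real.exp (Y (k, t))) := by
      rw [← mul_assoc, ← Real.exp_add]; simp
    simp only [Pi.neg_apply]
    rw [e1]
    simp only [Z]
    ring
  have hYd : ∀ k ∈ Icc 0 kmax, ∀ t ∈ Icc 0 T, HasDerivWithinAt (fun t => Y (k, t))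
      (-M.growth (Y (k, t)) + k * Real.exp (M.γ * t)) (Icc 0 T) t := fun k hk' t ht => by
    rw [hYe k hk' t ht]
    exact ((hY₀ k hk').2 t ht).congr (fun s hs => hYe k hk' s hs) (hYe k hk' t ht)
  refine ⟨Y, Z, hY, hZ, fun k hk' => ⟨⟨?_, by simp [Z, G, I], ?_, ?_⟩, fun t ht =>
    ⟨hYd k hk' t ht, (hZd k t).hasDerivWithinAt⟩⟩⟩
  · rw [hYe k hk' 0 ⟨le_rfl, hT⟩, (hY₀ k hk').1]
  · refine ACDeriv.of_hasDerivWithinAt hT (hYd k hk') (Continuous.continuousOn ?_)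
    have : Continuous fun t => M.growth (Y (k, t)) :=
      hL.continuous.comp (hY.comp (Continuous.prodMk_right k))
    fun_prop
  · refine ACDeriv.of_hasDerivWithinAt hT (fun t _ => (hZd k t).hasDerivWithinAt)
      (Continuous.continuousOn ?_)
    exact (hψ.comp (Continuous.prodMk_right k)).sub ((hZ.comp (Continuous.prodMk_right k)).mul
      (hg.comp (Continuous.prodMk_right k)))

end Fishery

/-! ### Crossings and the critical parameter -/

namespace Fishery
variable {M : Fishery} {k τ : ℝ} {x y z : ℝ → ℝ}

/-- The reversed trajectory has the stock at or to the left of `x~` and a nonpositive switch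
variable at time `τ`. -/
structure Crossing (M : Fishery) (k τ : ℝ) (y z : ℝ → ℝ) : Prop extends M.RevTraj k τ y z where
  y_le : y τ ≤ Real.log M.xTilde
  z_le : z τ ≤ 0

lemma Standing.log_lt_log (hM : M.Standing) : Real.log M.xTilde < Real.log M.xStar :=
  Real.log_lt_log hM.xTilde_pos hM.xTilde_lt_xStar

lemma Standing.ψ_exp_neg (hM : M.Standing) {y : ℝ} (hy : y < Real.log M.xTilde) :
    M.ψ (Real.exp y) < 0 :=
  hM.V4_ψ_neg _ ⟨Real.exp_pos y, (Real.lt_log_iff_exp_lt hM.xTilde_pos).1 hy⟩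

lemma Standing.exp_mem (hM : M.Standing) {y : ℝ} (hy : y ≤ Real.log M.xStar) :
    Real.exp y ∈ Ioc 0 M.xbar :=
  ⟨Real.exp_pos y, ((Real.le_log_iff_exp_le hM.xStar_pos).1 hy).trans hM.V4_xStar.2.le⟩

namespace RevTraj

/-- A strict crossing persists for slightly larger parameters. -/
lemma exists_crossing_gt (hM : M.Standing) (h : M.RevTraj k τ y z) (hk : 0 ≤ k)
    (hy : y τ < Real.log M.xTilde) (hz : z τ < 0) :
    ∃ k', k < k' ∧ ∃ y' z', M.Crossing k' τ y' z' := by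
  obtain ⟨Y, Z, hY, hZ, H⟩ := hM.exists_revTraj (kmax := k + 1) (by linarith) h.nonneg
  have hkm : k ∈ Icc 0 (k + 1) := ⟨hk, by linarith⟩
  obtain ⟨e1, e2⟩ := h.unique hM (H k hkm).1 τ ⟨h.nonneg, le_rfl⟩
  rw [e1] at hy
  rw [e2] at hz
  have c1 := (hY.comp (Continuous.prodMk_left τ)).tendsto k |>.eventually (gt_mem_nhds hy)
  have c2 := (hZ.comp (Continuous.prodMk_left τ)).tendsto k |>.eventually (gt_mem_nhds hz)
  have c3 : ∀ᶠ k' in 𝓝[>] k, Y (k', τ) < Real.log M.xTilde ∧ Z (k', τ) < 0 ∧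
      k' ∈ Ioo k (k + 1) := by
    filter_upwards [nhdsWithin_le_nhds c1, nhdsWithin_le_nhds c2,
      Ioo_mem_nhdsGT (show k < k + 1 by linarith)] with k' h1 h2 h3 using ⟨h1, h2, h3⟩
  obtain ⟨k', h1, h2, h3⟩ := c3.exists
  exact ⟨k', h3.1, _, _, (H k' ⟨hk.trans h3.1.le, h3.2.le⟩).1, h1.le, h2.le⟩

lemma z_pos_of_le (hM : M.Standing) (h : M.RevTraj k τ y z)
    (hy : ∀ t ∈ Icc 0 τ, Real.log M.xTilde ≤ y t ∧ y t ≤ Real.log M.xStar) : 0 < z τ :=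
  h.z_pos hM le_rfl h.nonneg le_rfl (by rw [h.z_zero]; exact hM.r'_pos) hy

/-- The switch variable becomes zero for the first time at or to the left of `x~`. -/
lemma y_le_of_first_zero (hM : M.Standing) (h : M.RevTraj k τ y z) (hτ : 0 < τ)
    (hy : ∀ t ∈ Icc 0 τ, y t ≤ Real.log M.xStar) (hz : ∀ t ∈ Ico 0 τ, 0 < z t) (hzτ : z τ = 0) :
    y τ ≤ Real.log M.xTilde := by
  by_contra hcon
  push Not at hcon
  obtain ⟨s, hs, hs'⟩ := ContinuousOn.exists_forall_Icc_lt_left (P := fun t => -y t)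
    (k := -Real.log M.xTilde) hτ (h.y_cont le_rfl le_rfl).neg (neg_lt_neg hcon)
  exact (h.z_pos hM hs.1 hs.2.le le_rfl (hz s hs) fun t ht =>
    ⟨(neg_lt_neg_iff.1 (hs' t ht)).le, hy t ⟨hs.1.trans ht.1, ht.2⟩⟩).ne' hzτ

end RevTraj

namespace Crossing

lemma y_lt (hM : M.Standing) (h : M.Crossing k τ y z) : y τ < Real.log M.xStar :=
  h.y_le.trans_lt hM.log_lt_log

lemma pos (hM : M.Standing) (h : M.Crossing k τ y z) : 0 < τ := by
  refine lt_of_le_of_ne h.nonneg fun h0 => ?_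
  have := h.y_lt hM
  rw [← h0, h.y_zero] at this
  exact lt_irrefl _ this

/-- Otherwise the stock would have stayed at or to the right of `x~` throughout, and `z` would still
be positive. -/
lemma growth_lt (hM : M.Standing) (h : M.Crossing k τ y z) (hk : 0 ≤ k)
    (hy : y τ = Real.log M.xTilde) : M.growth (y τ) < k * Real.exp (M.γ * τ) := by
  by_contra hcon
  push Not at hcon
  refine absurd h.z_le (not_le.2 (h.z_pos_of_le hM fun t ht => ⟨?_, ?_⟩))
  · rw [← hy]; exact h.le_of_le_growth hM hk ht.1 ht.2 le_rfl hcon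
  · exact h.le_log_xStar hM hk (h.y_lt hM) ht

/-- At the largest parameter with a crossing, the crossing takes place in `x~`. -/
lemma eq_of_forall_le (hM : M.Standing) (h : M.Crossing k τ y z) (hk : 0 ≤ k)
    (hmax : ∀ k' τ' y' z', M.Crossing k' τ' y' z' → k' ≤ k) :
    y τ = Real.log M.xTilde ∧ z τ = 0 := by
  -- A strict crossing would persist for a larger parameter, against maximality.
  have hno : ∀ τ' y' z', M.RevTraj k τ' y' z' → y' τ' < Real.log M.xTilde → 0 ≤ z' τ' := by
    intro τ' y' z' h' hy'
    by_contra hcon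
    obtain ⟨k', hk', y'', z'', h''⟩ := h'.exists_crossing_gt hM hk hy' (not_le.1 hcon)
    exact absurd (hmax _ _ _ _ h'') (not_le.2 hk')
  have hτ := h.pos hM
  have hyτ : y τ = Real.log M.xTilde := by
    -- If the stock were strictly left of `x~`, then just after `τ` it still is, so `z ≥ 0` by
    -- `hno`, while `ψ < 0` makes `z` fall strictly below `z(τ) ≤ 0`.
    by_contra hne
    have hy := lt_of_le_of_ne h.y_le hne
    obtain ⟨Y, Z, hY, hZ, H⟩ := hM.exists_revTraj (T := τ + 1) hk (by linarith)
    have H1 := (H k ⟨hk, le_rfl⟩).1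
    obtain ⟨e1, e2⟩ := h.unique hM (H1.mono hτ.le (by linarith)) τ ⟨hτ.le, le_rfl⟩
    rw [e1] at hy
    obtain ⟨s, hs, hs'⟩ := ContinuousOn.exists_forall_Icc_lt_right (lt_add_one τ)
      (H1.y_cont hτ.le le_rfl) hy
    have h1 := (H1.z_ac.mono hτ.le hs.1.le hs.2).lt_of_neg hs.1 (by
      refine Eventually.of_forall fun t ht => ?_
      have f1 := hs' t (Ioo_subset_Icc_self ht)
      have f2 := hno t _ _ (H1.mono (hτ.le.trans ht.1.le) (ht.2.le.trans hs.2)) f1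
      have f3 := hM.ψ_exp_neg f1
      have f4 := hM.g_pos (hM.exp_mem (f1.trans hM.log_lt_log).le)
      have := mul_nonneg f2 f4.le
      linarith)
    have h2 := hno s _ _ (H1.mono (hτ.le.trans hs.1.le) hs.2) (hs' s ⟨hs.1.le, le_rfl⟩)
    have h3 := h.z_le
    linarith
  refine ⟨hyτ, le_antisymm h.z_le ?_⟩
  by_contra hcon
  push Not at hcon
  -- The stock reaches `x~` increasing, so just before `τ` it is strictly to the left of `x~`; with
  -- `z(τ) < 0` this would be a strict crossing.
  have hg := h.growth_lt hM hk hyτ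
  obtain ⟨L, hL⟩ := hM.exists_growth_lipschitz
  have hgc : ContinuousOn (fun t => M.growth (y t) - k * Real.exp (M.γ * t)) (Icc 0 τ) :=
    (hL.continuous.comp_continuousOn (h.y_cont le_rfl le_rfl)).sub
      (Continuous.continuousOn (by fun_prop))
  obtain ⟨s₁, hs₁, h₁⟩ := hgc.exists_forall_Icc_lt_left hτ (k := 0) (by linarith)
  obtain ⟨s₂, hs₂, h₂⟩ := (h.z_cont le_rfl le_rfl).exists_forall_Icc_lt_left hτ hcon
  have hs : max s₁ s₂ < τ := max_lt hs₁.2 hs₂.2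
  have hs0 : 0 ≤ max s₁ s₂ := hs₁.1.trans (le_max_left _ _)
  have h1 := h.lt_of_growth_lt hM hk hs0 hs le_rfl
    (by have := h₁ _ ⟨le_max_left s₁ s₂, hs.le⟩; linarith)
  have h2 := hno _ y z (h.toRevTraj.mono hs0 hs.le) (by rw [← hyτ]; exact h1)
  exact absurd (h₂ _ ⟨le_max_right s₁ s₂, hs.le⟩) h2.not_gt

end Crossing

namespace IsFirstZero

lemma revTraj (hM : M.Standing) (h : M.IsFirstZero k τ x z) :
    M.RevTraj k τ (fun t => Real.log (x t)) z := by
  have hmem : ∀ t ∈ Icc 0 τ, x t ∈ Ioc 0 M.xStar := fun t ht => by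
    rcases ht.1.eq_or_lt with rfl | h0
    · rw [h.x_zero]; exact ⟨hM.xStar_pos, le_rfl⟩
    · exact ⟨(h.x_mem t ⟨h0, ht.2⟩).1, (h.x_mem t ⟨h0, ht.2⟩).2.le⟩
  have hxc : ContinuousOn x (Icc 0 τ) := fun t ht => (h.x_ode t ht).continuousWithinAt
  have hzc : ContinuousOn z (Icc 0 τ) := fun t ht => (h.z_ode t ht).continuousWithinAt
  have hpos : MapsTo x (Icc 0 τ) (Ioi 0) := fun t ht => (hmem t ht).1
  have hexp : ∀ t ∈ Icc 0 τ, Real.exp (Real.log (x t)) = x t := fun t ht =>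
    Real.exp_log (hmem t ht).1
  refine ⟨by simp only [h.x_zero], h.z_zero, ACDeriv.of_hasDerivWithinAt h.σ_pos.le (fun t ht => ?_)
    ?_, ACDeriv.of_hasDerivWithinAt h.σ_pos.le (fun t ht => ?_) ?_⟩
  · refine ((h.x_ode t ht).log (hmem t ht).1.ne').congr_deriv ?_
    rw [Standing.growth_log (hmem t ht), rate]
    have := (hmem t ht).1.ne'
    field_simp
  · refine ContinuousOn.add (ContinuousOn.neg ?_) (Continuous.continuousOn (by fun_prop))
    exact (hM.continuousOn_rate.comp hxc hpos).congr fun t ht => Standing.growth_log (hmem t ht)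
  · refine (h.z_ode t ht).congr_deriv ?_
    rw [hexp t ht, Standing.ψStar_eq]
    ring
  · refine ContinuousOn.congr ((hM.continuousOn_ψ.comp hxc hpos).sub
      (hzc.mul (hM.continuousOn_g.comp hxc hpos))) fun t ht => ?_
    simp only [hexp t ht]
    rfl

lemma crossing (hM : M.Standing) (h : M.IsFirstZero k τ x z) :
    M.Crossing k τ (fun t => Real.log (x t)) z := by
  refine ⟨h.revTraj hM, RevTraj.y_le_of_first_zero (y := fun t => Real.log (x t)) hM
    (h.revTraj hM) h.σ_pos (fun t ht => ?_) h.z_pos h.z_σ,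
    h.z_σ.le⟩
  rcases ht.1.eq_or_lt with rfl | h0
  · rw [h.x_zero]
  · exact Real.log_le_log (h.x_mem t ⟨h0, ht.2⟩).1 (h.x_mem t ⟨h0, ht.2⟩).2.le

end IsFirstZero

/-- Without capital the switch variable becomes negative. -/
lemma Standing.exists_crossing_pos (hM : M.Standing) :
    ∃ k τ y z, 0 < k ∧ M.Crossing k τ y z := by
  -- A strict crossing at parameter zero persists for some positive one. Positivity is needed later
  -- for the bound on crossing times.
  suffices ∃ τ y z, M.RevTraj 0 τ y z ∧ y τ < Real.log M.xTilde ∧ z τ < 0 by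
    obtain ⟨τ, y, z, h, hy, hz⟩ := this
    obtain ⟨k, hk, y', z', h'⟩ := h.exists_crossing_gt hM le_rfl hy hz
    exact ⟨k, τ, y', z', hk, h'⟩
  have hK := hM.KStar_pos
  have hr := hM.r'_pos
  have hlog := hM.log_lt_log
  set m := -M.ψ (Real.exp (Real.log M.xTilde - 1))
  have hm : 0 < m := neg_pos.2 (hM.ψ_exp_neg (by linarith))
  set s := (Real.log M.xStar - Real.log M.xTilde + 1) / M.KStar
  have hs : 0 ≤ s := div_nonneg (by linarith) hK.le
  -- By time `s` the stock is below `x~ / e`. While `z ≥ 0` there, `z` decreases at rate at least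
  -- `m`, so the remaining time brings it from at most `r'` to at most `-1`.
  set T := s + (M.r' + 1) / m
  have hsT : s ≤ T := by
    have : 0 ≤ (M.r' + 1) / m := by positivity
    simp only [T]; linarith
  obtain ⟨Y, Z, -, -, H⟩ := hM.exists_revTraj (kmax := 0) le_rfl (hs.trans hsT)
  have h := (H 0 ⟨le_rfl, le_rfl⟩).1
  set y := fun t => Y (0, t)
  set z := fun t => Z (0, t)
  have hy : ∀ t ∈ Icc 0 T, y t ≤ Real.log M.xStar - M.KStar * t := fun t ht => by
    have h1 : ACDeriv (fun t => M.KStar * t) (fun _ => M.KStar) 0 t :=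
      ACDeriv.of_contDiffOn ht.1 (by fun_prop) fun t _ => by
        simpa using (hasDerivAt_id t).const_mul M.KStar
    have h2 := ((h.y_ac.mono le_rfl ht.1 ht.2).add h1).le_of_nonpos
      (Eventually.of_forall fun q _ => by have := hM.KStar_le_growth (y q); linarith)
    rw [h.y_zero, mul_zero, add_zero] at h2
    linarith
  have hy' : ∀ t ∈ Icc 0 T, y t ≤ Real.log M.xStar := fun t ht =>
    (hy t ht).trans (by have := mul_nonneg hK.le ht.1; linarith)
  have hys : ∀ t ∈ Icc s T, y t ≤ Real.log M.xTilde - 1 := fun t ht => by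
    refine (hy t ⟨hs.trans ht.1, ht.2⟩).trans ?_
    have h1 : M.KStar * s = Real.log M.xStar - Real.log M.xTilde + 1 := by
      simp only [s]; field_simp
    have := mul_le_mul_of_nonneg_left ht.1 hK.le
    linarith
  by_contra hcon
  push Not at hcon
  have hz : ∀ t ∈ Icc s T, 0 ≤ z t := fun t ht =>
    hcon t y z (h.mono (hs.trans ht.1) ht.2) (by have := hys t ht; linarith)
  have hzs : z s ≤ M.r' := by
    have h1 := ((h.z_ac.mono le_rfl hs hsT).sub (ACDeriv.const hs M.r')).nonpos_of_deriv_le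
      (M := 0) (by
        refine Eventually.of_forall fun t ht hpos => ?_
        have htT : t ∈ Icc 0 T := ⟨ht.1.le, ht.2.le.trans hsT⟩
        have e1 := hM.g_pos (hM.exp_mem (hy' t htT))
        have e2 : M.ψStar (Real.exp (y t)) ≤ 0 := by
          have e3 := (Real.le_log_iff_exp_le hM.xStar_pos).1 (hy' t htT)
          rcases e3.eq_or_lt with e4 | e4
          · rw [e4, hM.V4_ψStar_zero]
          · exact (hM.V4_ψStar_neg _ ⟨Real.exp_pos _, e4⟩).le
        rw [ψStar_eq] at e2
        have := mul_nonneg hpos.le e1.le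
        linarith) (by rw [h.z_zero, sub_self]) s ⟨hs, le_rfl⟩
    linarith
  have h1 : ACDeriv (fun t => m * t) (fun _ => m) s T :=
    ACDeriv.of_contDiffOn hsT (by fun_prop) fun t _ => by
      simpa using (hasDerivAt_id t).const_mul m
  have h2 := ((h.z_ac.mono hs hsT le_rfl).add h1).le_of_nonpos (by
    refine Eventually.of_forall fun t ht => ?_
    have htT := Ioo_subset_Icc_self ht
    have e1 := hM.g_pos (hM.exp_mem (hy' t ⟨hs.trans htT.1, htT.2⟩))
    have e2 : M.ψ (Real.exp (y t)) ≤ -m := by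
      have hlt : ∀ q, q ≤ Real.log M.xTilde - 1 → Real.exp q ∈ Ioo 0 M.xTilde := fun q hq =>
        ⟨Real.exp_pos q, (Real.lt_log_iff_exp_lt hM.xTilde_pos).1 (by linarith)⟩
      simp only [m, neg_neg]
      exact hM.strictMonoOn_ψ.monotoneOn (hlt _ (hys t htT)) (hlt _ le_rfl)
        (Real.exp_le_exp.2 (hys t htT))
    have := mul_nonneg (hz t htT) e1.le
    linarith)
  have h3 := hz T ⟨hsT, le_rfl⟩
  have h4 : m * T = m * s + (M.r' + 1) := by simp only [T]; field_simp
  linarith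

/-- Crossings take place within a time that is bounded as long as the parameter is bounded away from
zero. -/
lemma Crossing.time_le (hM : M.Standing) (h : M.Crossing k τ y z) {k₀ : ℝ} (hk₀ : 0 < k₀)
    (hk : k₀ ≤ k) : τ ≤ 2 * M.δ / (k₀ * M.γ) := by
  have hγ := hM.γ_pos
  have hτ := h.pos hM
  -- From `growth < δ` and `e^{γt} ≥ 1 + γt`, `y` gains at least `-δτ + k₀ (τ + γτ²/2)`. A crossing
  -- lies below the start, which bounds `τ`.
  have h1 : ACDeriv (fun t => M.δ * t - k₀ * (t + M.γ * t ^ 2 / 2))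
      (fun t => M.δ - k₀ * (1 + M.γ * t)) 0 τ :=
    ACDeriv.of_contDiffOn hτ.le (by fun_prop) fun t _ => by
      have e1 := ((hasDerivAt_id t).const_mul M.δ).sub (((hasDerivAt_id t).add
        ((((hasDerivAt_id t).pow 2).const_mul M.γ).div_const 2)).const_mul k₀)
      refine e1.congr_deriv ?_
      simp only [id]
      push_cast
      ring
  have h2 := (h.y_ac.add h1).le_of_nonneg (by
    refine Eventually.of_forall fun t ht => ?_
    have e1 := hM.growth_lt_δ (y t)
    have e2 := Real.add_one_le_exp (M.γ * t)
    have e3 : 0 ≤ M.γ * t := mul_nonneg hγ.le ht.1.le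
    have e4 : k₀ * (1 + M.γ * t) ≤ k * Real.exp (M.γ * t) :=
      mul_le_mul hk (by linarith) (by linarith) (hk₀.le.trans hk)
    linarith)
  have h3 := h.y_lt hM
  rw [h.y_zero] at h2
  simp only [mul_zero, zero_pow two_ne_zero, zero_div, add_zero, sub_zero] at h2
  have h4 : τ * (k₀ * M.γ * τ) ≤ τ * (2 * M.δ) := by nlinarith [mul_pos hk₀ hτ]
  rw [le_div_iff₀ (mul_pos hk₀ hγ)]
  have := le_of_mul_le_mul_left h4 hτ
  linarith

/-- There is a largest parameter with a crossing. -/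
lemma Standing.exists_max_crossing (hM : M.Standing) :
    ∃ k τ y z, 0 < k ∧ M.Crossing k τ y z ∧
      (∀ k' τ' y' z', M.Crossing k' τ' y' z' → k' ≤ k) ∧
      ∀ t ∈ Icc 0 τ, HasDerivWithinAt y (-M.growth (y t) + k * Real.exp (M.γ * t)) (Icc 0 τ) t ∧
        HasDerivWithinAt z (M.ψ (Real.exp (y t)) - z t * M.g (Real.exp (y t))) (Icc 0 τ) t := by
  obtain ⟨k₀, τ₀, y₀, z₀, hk₀, h₀⟩ := hM.exists_crossing_pos
  set T := 2 * M.δ / (k₀ * M.γ)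
  have hT : 0 ≤ T := (h₀.pos hM).le.trans (h₀.time_le hM hk₀ le_rfl)
  obtain ⟨Y, Z, hY, hZ, H⟩ := hM.exists_revTraj (T := T) hM.KStar_pos.le hT
  have hkey : ∀ k' τ' y' z', k₀ ≤ k' → M.Crossing k' τ' y' z' → k' ∈ Icc k₀ M.KStar ∧
      τ' ∈ Icc 0 T ∧ Y (k', τ') ≤ Real.log M.xTilde ∧ Z (k', τ') ≤ 0 := by
    intro k' τ' y' z' hk' h'
    have e0 := hk₀.le.trans hk'
    have e1 := (h'.lt_KStar hM e0 (h'.y_lt hM)).le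
    have e2 : τ' ∈ Icc 0 T := ⟨h'.nonneg, h'.time_le hM hk₀ hk'⟩
    obtain ⟨e3, e4⟩ := h'.unique hM ((H k' ⟨e0, e1⟩).1.mono e2.1 e2.2) τ' ⟨e2.1, le_rfl⟩
    exact ⟨⟨hk', e1⟩, e2, e3 ▸ h'.y_le, e4 ▸ h'.z_le⟩
  -- Pairs of parameter and time with a crossing form a compact set: parameters lie below `K^*`,
  -- times below `T`, and the conditions are closed. Maximise the parameter.
  have hN : IsCompact ((Icc k₀ M.KStar ×ˢ Icc 0 T) ∩
      {P : ℝ × ℝ | Y P ≤ Real.log M.xTilde ∧ Z P ≤ 0}) :=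
    (isCompact_Icc.prod isCompact_Icc).inter_right
      ((isClosed_le hY continuous_const).inter (isClosed_le hZ continuous_const))
  obtain ⟨e1, e2, e3⟩ := hkey _ _ _ _ le_rfl h₀
  obtain ⟨⟨k, τ⟩, ⟨⟨hk, hτ⟩, hy, hz⟩, hmax⟩ := hN.exists_isMaxOn ⟨(k₀, τ₀), ⟨e1, e2⟩, e3⟩
    (f := Prod.fst) continuous_fst.continuousOn
  have hk0 := hk₀.trans_le hk.1
  obtain ⟨Hk, Hd⟩ := H k ⟨hk0.le, hk.2⟩
  refine ⟨k, τ, _, _, hk0, ⟨Hk.mono hτ.1 hτ.2, hy, hz⟩, fun k' τ' y' z' h' => ?_, fun t ht => ?_⟩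
  · rcases le_or_gt k₀ k' with h1 | h1
    · obtain ⟨f1, f2, f3⟩ := hkey _ _ _ _ h1 h'
      exact hmax (a := (k', τ')) ⟨⟨f1, f2⟩, f3⟩
    · exact h1.le.trans hk.1
  · have := Hd t ⟨ht.1, ht.2.trans hτ.2⟩
    exact ⟨this.1.mono (Icc_subset_Icc le_rfl hτ.2), this.2.mono (Icc_subset_Icc le_rfl hτ.2)⟩

/-- The critical reversed trajectory: the first zero of `z` is attained in `x~`, where the capital
stock is larger than the one that holds the stock constant. -/
theorem Standing.exists_critical (hM : M.Standing) :
    ∃ σ x z, M.IsFirstZero M.K1Tilde σ x z ∧ M.firstZeroTime M.K1Tilde = σ ∧ x σ = M.xTilde ∧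
      0 < M.K1Tilde ∧ M.rate M.xTilde < M.K1Tilde * Real.exp (M.γ * σ) := by
  obtain ⟨k, σ, y, z, hk, h, hmax, hd⟩ := hM.exists_max_crossing
  obtain ⟨hyσ, hzσ⟩ := h.eq_of_forall_le hM hk.le hmax
  have hσ := h.pos hM
  have hle : ∀ t ∈ Icc 0 σ, y t ≤ Real.log M.xStar := fun t ht =>
    h.le_log_xStar hM hk.le (h.y_lt hM) ht
  -- An earlier zero `q` would be a crossing with the same maximal parameter, hence in `x~`; from
  -- there the stock increases strictly and could not be in `x~` again at `σ`.
  have hzpos : ∀ t ∈ Ico 0 σ, 0 < z t := by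
    intro s hs
    by_contra hcon
    push Not at hcon
    obtain ⟨q, hq, hqz, hpos⟩ := exists_first_hit (P := fun t => -z t) (k := 0) hs.1
      (h.z_cont le_rfl hs.2.le).neg (by rw [h.z_zero]; linarith [hM.r'_pos]) (by linarith)
    have hqσ : q < σ := hq.2.trans_lt hs.2
    have hzq : z q = 0 := by linarith
    have hrev := h.toRevTraj.mono hq.1.le hqσ.le
    have hcr : M.Crossing k q y z := ⟨hrev, hrev.y_le_of_first_zero hM hq.1
      (fun t ht => hle t ⟨ht.1, ht.2.trans hqσ.le⟩) (fun t ht => by linarith [hpos t ht]) hzq, hzq.le⟩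
    have hyq := (hcr.eq_of_forall_le hM hk.le hmax).1
    have := h.lt_of_growth_lt hM hk.le hq.1.le hqσ le_rfl (hcr.growth_lt hM hk.le hyq)
    linarith
  have hfz : M.IsFirstZero k σ (fun t => Real.exp (y t)) z := by
    refine ⟨hσ, ?_, h.z_zero, fun t ht => ?_, fun t ht => ?_, fun t ht => ⟨Real.exp_pos _, ?_⟩,
      hzpos, hzσ⟩
    · simp only [h.y_zero, Real.exp_log hM.xStar_pos]
    · refine (hd t ht).1.exp.congr_deriv ?_
      rw [growth_of_le (hle t ht), rate]
      have := Real.exp_ne_zero (y t)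
      field_simp
    · refine (hd t ht).2.congr_deriv ?_
      rw [ψStar_eq]
      ring
    · exact (Real.lt_log_iff_exp_lt hM.xStar_pos).1 (h.lt_log_xStar hM hk.le (h.y_lt hM) ht)
  have hK : M.K1Tilde = k := by
    refine IsGreatest.csSup_eq ⟨⟨⟨hk.le, (h.lt_KStar hM hk.le (h.y_lt hM)).le⟩, _, _, _, hfz⟩, ?_⟩
    rintro k' ⟨-, σ', x', z', h'⟩
    exact hmax _ _ _ _ (h'.crossing hM)
  have hl : M.firstZeroTime k = σ := by
    have : {σ | ∃ x z, M.IsFirstZero k σ x z} = {σ} := by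
      refine eq_singleton_iff_unique_mem.2 ⟨⟨_, _, hfz⟩, ?_⟩
      rintro σ' ⟨x', z', h'⟩
      have h'' := h'.revTraj hM
      rcases lt_trichotomy σ' σ with h1 | h1 | h1
      · have := (h''.unique hM (h.toRevTraj.mono h'.σ_pos.le h1.le) σ' ⟨h'.σ_pos.le, le_rfl⟩).2
        rw [h'.z_σ] at this
        exact absurd this (hzpos σ' ⟨h'.σ_pos.le, h1⟩).ne
      · exact h1
      · have := (h.toRevTraj.unique hM (h''.mono hσ.le h1.le) σ ⟨hσ.le, le_rfl⟩).2
        rw [hzσ] at this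
        exact absurd this (h'.z_pos σ ⟨hσ.le, h1⟩).ne
    rw [firstZeroTime, this, csInf_singleton]
  have hx : Real.exp (y σ) = M.xTilde := by rw [hyσ, Real.exp_log hM.xTilde_pos]
  rw [hK]
  refine ⟨σ, _, z, hfz, hl, hx, hk, ?_⟩
  have := h.growth_lt hM hk.le hyσ
  rwa [growth_of_le (hle σ ⟨hσ.le, le_rfl⟩), hx] at this

end Fishery


/-! ### Explicit arcs and the conclusion -/

lemma ACDeriv.reverse_of_hasDerivWithinAt {φ φ' : ℝ → ℝ} {σ : ℝ} (hσ : 0 ≤ σ)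
    (h : ∀ t ∈ Icc 0 σ, HasDerivWithinAt φ (φ' t) (Icc 0 σ) t) (hc : ContinuousOn φ' (Icc 0 σ)) :
    ACDeriv (fun t => φ (σ - t)) (fun t => -φ' (σ - t)) 0 σ := by
  have hmaps : MapsTo (fun t => σ - t) (Icc 0 σ) (Icc 0 σ) := fun t ht =>
    ⟨sub_nonneg.2 ht.2, by linarith [ht.1]⟩
  refine ACDeriv.of_hasDerivWithinAt hσ (fun t ht => ?_)
    (hc.comp (by fun_prop) hmaps).neg
  have h1 := (h (σ - t) (hmaps ht)).scomp t (((hasDerivAt_id t).const_sub σ).hasDerivWithinAt)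
    hmaps
  exact h1.congr_deriv (by simp)

namespace Fishery
variable {M : Fishery}

lemma _root_.ACDeriv.concat {φ φ' χ χ' : ℝ → ℝ} {τ σ : ℝ} (hφ : ACDeriv φ φ' 0 τ)
    (hχ : ACDeriv χ χ' 0 σ) (h : φ τ = χ 0) :
    ACDeriv (concat τ φ χ) (concat τ φ' χ') 0 (τ + σ) := by
  have hτ := hφ.le
  have hσ := hχ.le
  refine ACDeriv.of_integral (add_nonneg hτ hσ) (IsAdmissible.concat_intervalIntegral hτ
    (by linarith) hφ.intervalIntegrable ?_).1 (k := φ 0) fun t ht => ?_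
  · rw [add_sub_cancel_left]; exact hχ.intervalIntegrable
  · rcases lt_or_ge t τ with h1 | h1
    · rw [concat_of_lt _ _ h1, IsAdmissible.concat_intervalIntegral_of_lt ht.1 h1,
        (hφ.mono le_rfl ht.1 h1.le).integral_eq]
      ring
    · have h2 := hχ.mono le_rfl (sub_nonneg.2 h1) (by linarith [ht.2])
      rw [concat_of_le _ _ h1, (IsAdmissible.concat_intervalIntegral hτ h1
        hφ.intervalIntegrable h2.intervalIntegrable).2, hφ.integral_eq, h2.integral_eq, h]
      ring

/-- The reversal of a reversed trajectory is an extremal arc. -/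
lemma IsFirstZero.arc (hM : M.Standing) {k σ : ℝ} {x z : ℝ → ℝ} (h : M.IsFirstZero k σ x z)
    (hk : 0 ≤ k) : M.Arc (k * Real.exp (M.γ * σ)) σ (fun t => x (σ - t)) (fun t => z (σ - t))
      (fun t => k * Real.exp (M.γ * σ) * Real.exp (-M.γ * t)) := by
  have hσ := h.σ_pos.le
  have hpos : MapsTo x (Icc 0 σ) (Ioi 0) := fun t ht => by
    rcases ht.1.eq_or_lt with rfl | h0
    · rw [h.x_zero]; exact hM.xStar_pos
    · exact (h.x_mem t ⟨h0, ht.2⟩).1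
  have hxc : ContinuousOn x (Icc 0 σ) := fun t ht => (h.x_ode t ht).continuousWithinAt
  have hzc : ContinuousOn z (Icc 0 σ) := fun t ht => (h.z_ode t ht).continuousWithinAt
  refine ⟨h.σ_pos, (ACDeriv.reverse_of_hasDerivWithinAt hσ h.x_ode ?_).congr_ae ?_,
    (ACDeriv.reverse_of_hasDerivWithinAt hσ h.z_ode ?_).congr_ae ?_, fun t ht =>
    h.x_mem (σ - t) ⟨by linarith [ht.2], by linarith [ht.1]⟩, by simp only [sub_self, h.x_zero],
    by simp only [sub_self, h.z_zero],
    Eventually.of_forall fun t ht => ⟨⟨by positivity, le_rfl⟩, fun w hw => ?_⟩⟩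
  · exact ((hM.continuousOn_F.comp hxc fun t ht => mem_Ici.2 (mem_Ioi.1 (hpos ht)).le).neg).add
      ((Continuous.continuousOn (by fun_prop)).mul hxc)
  · refine Eventually.of_forall fun t ht => ?_
    rw [show M.γ * (σ - t) = M.γ * σ + -M.γ * t by ring, Real.exp_add]
    ring
  · exact ((hzc.sub continuousOn_const).neg.mul (hM.continuousOn_g.comp hxc hpos)).add
      (hM.continuousOn_ψStar.comp hxc hpos)
  · refine Eventually.of_forall fun t ht => ?_
    rw [Standing.ψStar_eq]
    ring
  · exact mul_le_mul_of_nonneg_left hw.2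
      (h.z_pos (σ - t) ⟨by linarith [ht.2], by linarith [ht.1]⟩).le

/-- An extremal arc from `x~` with vanishing switch variable can be preceded by holding the stock
at `x~`. -/
lemma Arc.hold (hM : M.Standing) {k τ σ K₀ : ℝ} {x z v : ℝ → ℝ} (h : M.Arc k σ x z v)
    (hx : x 0 = M.xTilde) (hz : z 0 = 0) (hτ : 0 ≤ τ) (hK₀ : K₀ * Real.exp (-M.γ * τ) = k)
    (hk : M.rate M.xTilde ≤ k) :
    M.Arc K₀ (τ + σ) (concat τ (fun _ => M.xTilde) x) (concat τ (fun _ => 0) z)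
      (concat τ (fun _ => M.rate M.xTilde) v) := by
  have hσ := h.τ_pos
  have hrate := hM.rate_pos hM.V4_xTilde
  have hK₀pos : 0 < K₀ := by
    refine (pos_iff_pos_of_mul_pos ?_).2 (Real.exp_pos (-M.γ * τ))
    rw [hK₀]; exact hrate.trans_le hk
  refine ⟨by linarith, (ACDeriv.concat (ACDeriv.const hτ M.xTilde) h.x_ac hx.symm).congr_ae
    (Eventually.of_forall fun t ht => ?_), (ACDeriv.concat (ACDeriv.const hτ 0) h.z_ac
    hz.symm).congr_ae (Eventually.of_forall fun t ht => ?_), fun t ht => ?_, ?_, ?_, ?_⟩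
  · rcases lt_or_ge t τ with h1 | h1
    · simp only [concat_of_lt _ _ h1, rate]
      rw [div_mul_cancel₀ _ hM.xTilde_pos.ne', sub_self]
    · simp only [concat_of_le _ _ h1]
  · rcases lt_or_ge t τ with h1 | h1
    · simp only [concat_of_lt _ _ h1, hM.V4_ψ_zero, zero_mul, sub_self]
    · simp only [concat_of_le _ _ h1]
  · rcases lt_or_ge t τ with h1 | h1
    · rw [concat_of_lt _ _ h1]; exact ⟨hM.xTilde_pos, hM.xTilde_lt_xStar⟩
    · rw [concat_of_le _ _ h1]; exact h.x_mem _ ⟨sub_nonneg.2 h1, by linarith [ht.2]⟩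
  · rw [add_comm, concat_add _ _ hσ.le, h.x_end]
  · rw [add_comm, concat_add _ _ hσ.le, h.z_end]
  · have h2 := (measurePreserving_sub_right (volume : Measure ℝ) τ).quasiMeasurePreserving.ae h.max
    have hne : ∀ᵐ s : ℝ, s ≠ τ := by simp [ae_iff, measure_singleton]
    filter_upwards [h2, hne] with t h2 hne ht
    rcases lt_or_ge t τ with h1 | h1
    -- With `z = 0` every catch rate is maximal; the one that holds the stock is available because
    -- the capital has not yet fallen below `k`.
    · simp only [concat_of_lt _ _ h1, zero_mul]
      refine ⟨⟨hrate.le, hk.trans ?_⟩, fun w _ => le_rfl⟩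
      rw [← hK₀]
      refine mul_le_mul_of_nonneg_left (Real.exp_le_exp.2 ?_) hK₀pos.le
      nlinarith [hM.γ_pos]
    · have h3 : τ < t := lt_of_le_of_ne h1 hne.symm
      have h4 : k * Real.exp (-M.γ * (t - τ)) = K₀ * Real.exp (-M.γ * t) := by
        rw [← hK₀, mul_assoc, ← Real.exp_add]
        congr 2
        ring
      simp only [concat_of_le _ _ h1]
      rw [← h4]
      exact h2 ⟨sub_pos.2 h3, by linarith [ht.2]⟩

/-- Optimal processes that start in `Σ₀`. -/
lemma IsOptimal.of_mem_SigmaZero (hM : M.Standing) {x₀ K₀ : ℝ} {x K u z lam : ℝ → ℝ}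
    {μ : Measure ℝ} (h : M.IsOptimal x₀ K₀ x K u μ) (hadj : M.IsAdjoint x K u μ z lam)
    (hmem : (x₀, K₀) ∈ M.SigmaZero) :
    z 0 = 0 ∧ lam 0 < M.r ∧
      ∃ τ, 0 < τ ∧ (x τ, K τ) ∈ M.SigmaStar ∧ μ (Ioo 0 τ) = 0 ∧
        (0 < K₀ → ∀ᵐ t ∂(volume.restrict (Ioo 0 τ)), u t = 1) := by
  obtain ⟨k, hk, σ, x', z', hfz, hP⟩ := hmem
  rw [Prod.mk.injEq] at hP
  have hK₀ : 0 ≤ K₀ := by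
    rw [hP.2]; exact mul_nonneg hk.1 (Real.exp_pos _).le
  have hx₀ : x₀ ∈ Ioo 0 M.xStar := by
    rw [hP.1]; exact hfz.x_mem σ ⟨hfz.σ_pos, le_rfl⟩
  obtain ⟨τ, harc, hμ, hKτ, hK, hl⟩ := h.exists_arc hM hx₀ hK₀ hadj
  have harc' := hfz.arc hM hk.1
  rw [← hP.2] at harc'
  obtain ⟨-, -, hz, hv⟩ := harc.unique hM harc' (by
    simp only [h.1.x_zero, hP.1, sub_zero])
  refine ⟨?_, hl, τ, harc.τ_pos, ⟨harc.x_end, ?_⟩,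
    measure_mono_null Ioo_subset_Ico_self hμ, fun hpos => ?_⟩
  · rw [hz 0 ⟨le_rfl, harc.τ_pos.le⟩, sub_zero, hfz.z_σ]
  · rw [hKτ]; exact ⟨hM.KStar_pos.le, le_rfl⟩
  · refine (ae_restrict_iff' measurableSet_Ioo).2 ?_
    filter_upwards [hv] with t h1 ht
    have h2 := h1 ht
    rw [hK t (Ioo_subset_Ico_self ht)] at h2
    exact (mul_eq_right₀ (mul_pos hpos (Real.exp_pos _)).ne').1 h2

/-- Optimal processes that start in `Σ~`. -/
lemma IsOptimal.of_mem_SigmaTilde (hM : M.Standing) {x₀ K₀ : ℝ} {x K u z lam : ℝ → ℝ}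
    {μ : Measure ℝ} (h : M.IsOptimal x₀ K₀ x K u μ) (hadj : M.IsAdjoint x K u μ z lam)
    (hmem : (x₀, K₀) ∈ M.SigmaTilde) :
    z 0 = 0 ∧ lam 0 < M.r ∧
      ∃ τ₁ τ₂, 0 ≤ τ₁ ∧ τ₁ < τ₂ ∧
        (x τ₁, K τ₁) = (M.xTilde, M.KTildeTilde) ∧ (x τ₂, K τ₂) ∈ M.SigmaStar ∧
        μ (Ioo 0 τ₁) = 0 ∧
        (∀ᵐ t ∂(volume.restrict (Ioo 0 τ₁)), u t = M.F M.xTilde / (M.xTilde * K t)) ∧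
        μ (Ioo τ₁ τ₂) = 0 ∧
        (∀ᵐ t ∂(volume.restrict (Ioo τ₁ τ₂)), u t = 1) := by
  obtain ⟨hx, hK₀⟩ := hmem
  simp only at hx hK₀
  obtain ⟨σ, x', z', hfz, hl, hxσ, hk, hrate⟩ := hM.exists_critical
  have hKTT : M.KTildeTilde = M.K1Tilde * Real.exp (M.γ * σ) := by rw [KTildeTilde, hl]
  have harc₁ := hfz.arc hM hk.le
  rw [← hKTT] at harc₁ hrate
  have hKTpos := (hM.rate_pos hM.V4_xTilde).trans hrate
  have hKpos := hKTpos.trans_le hK₀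
  have hγ := hM.γ_pos
  -- The time in which `K₀` decays to the critical level.
  set τ₁ := Real.log (K₀ / M.KTildeTilde) / M.γ
  have hτ₁ : 0 ≤ τ₁ := div_nonneg (Real.log_nonneg ((one_le_div hKTpos).2 hK₀)) hγ.le
  have hdecay : K₀ * Real.exp (-M.γ * τ₁) = M.KTildeTilde := by
    have e : -M.γ * τ₁ = -Real.log (K₀ / M.KTildeTilde) := by simp only [τ₁]; field_simp
    rw [e, Real.exp_neg, Real.exp_log (div_pos hKpos hKTpos)]
    field_simp
  have harc₂ := harc₁.hold hM (by simp only [sub_zero, hxσ]) (by simp only [sub_zero, hfz.z_σ]) hτ₁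
    hdecay hrate.le
  obtain ⟨τ, harc, hμ, hKτ, hK, hlam⟩ := h.exists_arc hM
    (hx ▸ ⟨hM.xTilde_pos, hM.xTilde_lt_xStar⟩) hKpos.le hadj
  obtain ⟨hτ, hx', hz', hv⟩ := harc.unique hM harc₂ (by
    rw [h.1.x_zero, hx]
    rcases hτ₁.eq_or_lt with h1 | h1
    · rw [concat_of_le _ _ h1.ge, ← h1, sub_zero, sub_zero, hxσ]
    · rw [concat_of_lt _ _ h1])
  have hτ₁τ : τ₁ < τ := by rw [hτ]; linarith [hfz.σ_pos]
  refine ⟨?_, hlam, τ₁, τ, hτ₁, hτ₁τ, ?_, ⟨harc.x_end, ?_⟩, measure_mono_null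
    (Ioo_subset_Ico_self.trans (Ico_subset_Ico_right hτ₁τ.le)) hμ, ?_, measure_mono_null
    (Ioo_subset_Ico_self.trans (Ico_subset_Ico_left hτ₁)) hμ, ?_⟩
  · rw [hz' 0 ⟨le_rfl, harc.τ_pos.le⟩]
    rcases hτ₁.eq_or_lt with h1 | h1
    · rw [concat_of_le _ _ h1.ge, ← h1, sub_zero, sub_zero, hfz.z_σ]
    · rw [concat_of_lt _ _ h1]
  · rw [hx' τ₁ ⟨hτ₁, hτ₁τ.le⟩, hK τ₁ ⟨hτ₁, hτ₁τ⟩, hdecay, concat_of_le _ _ le_rfl, sub_self,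
      sub_zero, hxσ]
  · rw [hKτ]; exact ⟨hM.KStar_pos.le, le_rfl⟩
  · refine (ae_restrict_iff' measurableSet_Ioo).2 ?_
    filter_upwards [hv] with t h1 ht
    have h2 := h1 ⟨ht.1, ht.2.trans hτ₁τ⟩
    have hKt : 0 < K t := by
      rw [hK t ⟨ht.1.le, ht.2.trans hτ₁τ⟩]; positivity
    rw [concat_of_lt _ _ ht.2, rate] at h2
    rw [← div_div, ← h2, mul_div_cancel_right₀ _ hKt.ne']
  · refine (ae_restrict_iff' measurableSet_Ioo).2 ?_
    filter_upwards [hv] with t h1 ht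
    have h2 := h1 ⟨hτ₁.trans_lt ht.1, ht.2⟩
    rw [concat_of_le _ _ ht.1.le, ← hdecay, mul_assoc, ← Real.exp_add,
      show -M.γ * τ₁ + -M.γ * (t - τ₁) = -M.γ * t by ring,
      hK t ⟨hτ₁.trans ht.1.le, ht.2⟩] at h2
    exact (mul_eq_right₀ (mul_pos hKpos (Real.exp_pos _)).ne').1 h2

end Fishery
end

theorem mainTheorem2 (M : Fishery) (hM : M.Standing) (x₀ K₀ : ℝ) (x K u : ℝ → ℝ)
    (μ : Measure ℝ) (z lam : ℝ → ℝ) (hopt : M.IsOptimal x₀ K₀ x K u μ)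
    (hadj : M.IsAdjoint x K u μ z lam) :
    ((x₀, K₀) ∈ M.SigmaStar →
      z 0 = M.r' ∧ (∀ t, 0 ≤ t → lam t = M.r) ∧
      x₀ = M.xStar ∧ Tendsto K (𝓝[>] 0) (𝓝 M.KStar) ∧
      (∀ᵐ t ∂(volume.restrict (Ici (0 : ℝ))), u t = 1) ∧
      μ = ENNReal.ofReal (M.KStar - K₀) • Measure.dirac 0 +
        (volume.restrict (Ici (0 : ℝ))).withDensity (fun t => ENNReal.ofReal (M.γ * K t))) ∧
    ((x₀, K₀) ∈ M.SigmaZero →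
      z 0 = 0 ∧ lam 0 < M.r ∧
      ∃ τ, 0 < τ ∧ (x τ, K τ) ∈ M.SigmaStar ∧ μ (Ioo 0 τ) = 0 ∧
        (0 < K₀ → ∀ᵐ t ∂(volume.restrict (Ioo 0 τ)), u t = 1)) ∧
    ((x₀, K₀) ∈ M.SigmaTilde →
      z 0 = 0 ∧ lam 0 < M.r ∧
      ∃ τ₁ τ₂, 0 ≤ τ₁ ∧ τ₁ < τ₂ ∧
        (x τ₁, K τ₁) = (M.xTilde, M.KTildeTilde) ∧ (x τ₂, K τ₂) ∈ M.SigmaStar ∧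
        μ (Ioo 0 τ₁) = 0 ∧
        (∀ᵐ t ∂(volume.restrict (Ioo 0 τ₁)), u t = M.F M.xTilde / (M.xTilde * K t)) ∧
        μ (Ioo τ₁ τ₂) = 0 ∧
        (∀ᵐ t ∂(volume.restrict (Ioo τ₁ τ₂)), u t = 1)) := by
  refine ⟨fun hmem => ?_, fun hmem => hopt.of_mem_SigmaZero hM hadj hmem,
    fun hmem => hopt.of_mem_SigmaTilde hM hadj hmem⟩
  obtain ⟨hx, hK₀⟩ := hmem
  simp only at hx hK₀
  subst hx
  obtain ⟨hz, hlam⟩ := hopt.adjoint_eq hM hK₀.2 hadj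
  have hK := fun t ht => (hopt.eq_xStar hM hK₀.2 t ht).2
  refine ⟨hz, hlam, rfl, ?_, ?_, ?_⟩
  · refine tendsto_const_nhds.congr' ?_
    filter_upwards [self_mem_nhdsWithin] with t ht using (hK t (le_of_lt ht)).symm
  · rw [← restrict_Ioi_eq_restrict_Ici]
    exact (ae_restrict_iff' measurableSet_Ioi).2 (hopt.u_eq_one hM hK₀.2)
  · rw [hopt.measure_eq hM hK₀.2]
    congr 1
    -- `γ K dt` has constant density because `K ≡ K^*`.
    rw [← withDensity_const]
    refine withDensity_congr_ae ((ae_restrict_iff' measurableSet_Ici).2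
      (Eventually.of_forall fun t ht => ?_))
    simp only [hK t ht]
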